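/- **Setting.** Let $\mathbb H$ be the category freely generated by the graph with vertices $n$ and $n_t$ ($n\ge 1$) and edges $n\to n+1$, $n\to n_t$. A *type-and-term structure* is a presheaf $X\in[\mathbb H^{\mathrm{op}},\mathbf{Set}]$; its restriction maps $X(n+1)\to X(n)$ and $X(n_t)\to X(n)$ are written $\partial$. *Expressions* over an alphabet are built from variables $x_1,x_2,\dots$ and formal applications $w(e_1,\dots,e_n)$ of letters $w$. A *judgement* has one of the forms $\Gamma\vdash T\ \mathsf{type}$, $\Gamma\vdash t:T$, $\Gamma\vdash T=T'\ \mathsf{type}$, $\Gamma\vdash t=t':T$, where $\Gamma=(x_1:T_1,\dots,x_{n-1}:T_{n-1})$; its degree is $n$, and judgements are taken up to renaming of context variables. The boundary $\partial$ of $\Gamma,x:T\vdash T'\ \mathsf{type}$ and of $\Gamma\vdash t:T$ is $\Gamma\vdash T\ \mathsf{type}$, that of ${}\vdash T\ \mathsf{type}$ is empty, and that of an equality judgement is the pair of judgements for its two sides. An *$\{s\}$-GAT* $\mathbb T$ is given by sets of type-constants and of term-constants and a set $\Lambda$ of basic judgements, such that each type-constant $A$ (term-constant $f$) has exactly one basic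 judgement $\Gamma\vdash A(x_1,\dots,x_{n-1})\ \mathsf{type}$ (respectively $\Gamma\vdash f(x_1,\dots,x_{n-1}):T$), all other basic judgements are equality judgements, and all basic judgements are derived. The set $\mathbb T^*$ of *derived* judgements is the smallest one that contains each $\mathcal J\in\Lambda$ whose boundary it contains, and is closed under * reflexivity, symmetry and transitivity of both equalities; from $\Gamma\vdash T_1=T_2\ \mathsf{type}$ and $\Gamma\vdash t:T_1$ (or $\Gamma\vdash t_1=t_2:T_1$) infer $\Gamma\vdash t:T_2$ (or $\Gamma\vdash t_1=t_2:T_2$); from $\Gamma\vdash T_1=T_2\ \mathsf{type}$ and $\Gamma,y:T_1,\Delta\vdash\mathcal J$ infer $\Gamma,y:T_2,\Delta\vdash\mathcal J$; * substitution: from $\Gamma\vdash t:T$ and $\Gamma,y:T,\Delta\vdash\mathcal J$ infer $\Gamma,\Delta[t/y]\vdash\mathcal J[t/y]$; from $\Gamma\vdash t_1=t_2:T$ and $\Gamma,y:T,\Delta\vdash T'\ \mathsf{type}$ (or $\Gamma,y:T,\Delta\vdash t':T'$) infer $\Gamma,\Delta[t_2/y]\vdash T'[t_1/y]=T'[t_2/y]\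 \mathsf{type}$ (or $\Gamma,\Delta[t_2/y]\vdash t'[t_1/y]=t'[t_2/y]:T'[t_2/y]$). Two derived type judgements $x_1:S_1,\dots,x_{n-1}:S_{n-1}\vdash S_n\ \mathsf{type}$ and $x_1:T_1,\dots,x_{n-1}:T_{n-1}\vdash T_n\ \mathsf{type}$ are *congruent* ($\equiv$) if $x_1:S_1,\dots,x_{i-1}:S_{i-1}\vdash S_i=T_i\ \mathsf{type}$ is derived for all $i\le n$; derived term judgements $x_1:S_1,\dots\vdash s:S_n$ and $x_1:T_1,\dots\vdash t:T_n$ are congruent if their boundaries are and $x_1:S_1,\dots,x_{n-1}:S_{n-1}\vdash s=t:S_n$ is derived. An *interpretation* $\mathbb T\to\mathbb U$ is a map $\mathbb T^*\to\mathbb U^*$ that preserves the form of judgements, boundaries and all instances of the rules; morphisms of $\{s\}$-GATs are interpretations modulo $\phi\sim\phi'$ iff $\phi(\mathcal J)\equiv\phi'(\mathcal J)$ for all derived type and term judgements $\mathcal J$. The forgetful functor $V\colon\{s\}\text{-}\mathbf{GAT}\to[\mathbb H^{\mathrm{op}},\mathbf{Set}]$ sends $\mathbb T$ to the presheaf of its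 derived type judgements of degree $n$ (at $n$) and term judgements of degree $n$ (at $n_t$) modulo $\equiv$, with $\partial$ given by boundaries. An *inc-list* of length $n$ is a strictly increasing $\alpha\colon\{0,\dots,n\}\to\mathbb N$ with $\alpha(0)=0$; let $\partial\alpha$ be its restriction to $\{0,\dots,n-1\}$ and $\iota_n$ the inc-list $i\mapsto i$. Let $[\alpha]$ be the type-and-term structure with one type-element in each degree $1\le i\le\alpha(n)$ and one term-element $i_t$ in each degree $1\le i\le\alpha(n)$ with $i\notin\operatorname{im}\alpha$, and no other elements; let $[\alpha]_t$ be $[\alpha]$ with one term-element over $\alpha(n)$ adjoined. **Proposition.** The functor $V$ has a left adjoint. Let $S$ be the monad on $[\mathbb H^{\mathrm{op}},\mathbf{Set}]$ induced by any adjunction $G\dashv V$ (the *substitution monad*). Then: 1. $S$ is strongly cartesian: it is local right adjoint (for every $X$ the functor $S/X\colon[\mathbb H^{\mathrm{op}},\mathbf{Set}]/X\to[\mathbb H^{\mathrm{op}},\mathbf{Set}]/SX$ is a right adjoint), it preserves pullbacks, and all naturality squares of its unit $\eta$ and of its multiplication $\mu$ are pullbacks. 2. There are isomorphisms, natural in $X$,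 $$SX(n)\cong\sum_{\alpha}\,[\mathbb H^{\mathrm{op}},\mathbf{Set}]([\alpha],X),\qquad SX(n_t)\cong\sum_{\alpha}\,[\mathbb H^{\mathrm{op}},\mathbf{Set}]([\alpha]_t,X),$$ the sums being over inc-lists $\alpha$ of length $n$, under which the boundary maps are $(\alpha,h)\mapsto(\partial\alpha,h|_{[\partial\alpha]})$ and $(\alpha,h)\mapsto(\alpha,h|_{[\alpha]})$. Under them: * $\eta$ sends $A\in X(n)$ to $(\iota_n,\tilde A)$, where $\tilde A$ has value $A$ in degree $n$, and sends $a\in X(n_t)$ to the pair of $\iota_n$ and the map $[\iota_n]_t\to X$ with value $a$ at $n_t$; * $\mu$ sends $(\alpha,\ell)$, where $\ell\colon[\alpha]\to SX$ has value $(\beta,h)$ in degree $\alpha(n)$ and $\ell(j_t)$ is given by the term-element $k(j)$ of $X$ (the value at the adjoined term-element), to $(\beta\alpha,h\cup k)$, where $(\beta\alpha)(i)=\beta(\alpha(i))$ and $h\cup k$ agrees with $h$ on type-elements and on $i_t$ for $i\notin\operatorname{im}\beta$, and $(h\cup k)(\beta(j)_t)=k(j)$ for $j\notin\operatorname{im}\alpha$;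 on term-elements $\mu$ keeps the adjoined term-element of $X$. -/

import Mathlib

open CategoryTheory Opposite

universe u

namespace SGAT

/-! ## Syntax of generalised algebraic theories with substitution

Judgements are considered up to renaming of their context variables: the variables of a context of
length `n` are `x₁, …, xₙ`, and `Expr.var i` stands for `xᵢ₊₁`. -/

/-- Expressions over an alphabet `W`. -/
inductive Expr (W : Type u) : Type u
  | var (i : ℕ) : Expr W
  | app (w : W) (n : ℕ) (args : Fin n → Expr W) : Expr W

/-- `e.subst m t` is `e[t / xₘ₊₁]`, with the later variables `xₘ₊₂, xₘ₊₃, …` renamed to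
`xₘ₊₁, xₘ₊₂, …`. -/
def Expr.subst {W : Type u} : Expr W → ℕ → Expr W → Expr W
  | .var i, m, t => if i < m then .var i else if i = m then t else .var (i - 1)
  | .app w n args, m, t => .app w n (fun i => (args i).subst m t)

/-- Contexts, listed from left to right. -/
abbrev Ctx (W : Type u) : Type u := List (Expr W)

/-- `Δ[t / xₘ₊₁]`. -/
def substCtx {W : Type u} (m : ℕ) (t : Expr W) (Δ : Ctx W) : Ctx W := Δ.map fun e => e.subst m t

/-- The four kinds of judgement. -/
inductive Kind
  | ty | tm | tyEq | tmEq

/-- What stands to the right of the turnstile in a judgement. -/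
inductive Assertion (W : Type u) : Type u
  | ty (T : Expr W) : Assertion W
  | tm (t T : Expr W) : Assertion W
  | tyEq (T T' : Expr W) : Assertion W
  | tmEq (t t' T : Expr W) : Assertion W

def Assertion.kind {W : Type u} : Assertion W → Kind
  | .ty _ => .ty
  | .tm _ _ => .tm
  | .tyEq _ _ => .tyEq
  | .tmEq _ _ _ => .tmEq

def Assertion.subst {W : Type u} (a : Assertion W) (m : ℕ) (s : Expr W) : Assertion W :=
  match a with
  | .ty T => .ty (T.subst m s)
  | .tm t T => .tm (t.subst m s) (T.subst m s)
  | .tyEq T T' => .tyEq (T.subst m s) (T'.subst m s)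
  | .tmEq t t' T => .tmEq (t.subst m s) (t'.subst m s) (T.subst m s)

/-- A judgement `Γ ⊢ 𝒥`. -/
structure Judgement (W : Type u) : Type u where
  ctx : Ctx W
  asn : Assertion W

/-- The boundary of a judgement. -/
def Judgement.boundary {W : Type u} : Judgement W → List (Judgement W)
  | ⟨Γ, .ty _⟩ =>
    match Γ.getLast? with
    | none => []
    | some T => [⟨Γ.dropLast, .ty T⟩]
  | ⟨Γ, .tm _ T⟩ => [⟨Γ, .ty T⟩]
  | ⟨Γ, .tyEq T T'⟩ => [⟨Γ, .ty T⟩, ⟨Γ, .ty T'⟩]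
  | ⟨Γ, .tmEq t t' T⟩ => [⟨Γ, .tm t T⟩, ⟨Γ, .tm t' T⟩]

/-- Names for the deduction rules of `{s}`-GATs. -/
inductive RuleName
  | tmRefl | tmSymm | tmTrans | tyRefl | tySymm | tyTrans | tmConv | tmEqConv | ctxConv
  | subst | substTyEq | substTmEq

/-- The deduction rules of `{s}`-GATs: the rules for equality, including conversion of a type in
the context along a derivable equality, and the substitution rules.
`Rule r Js J` says that `J` is the conclusion of the instance of the rule `r` with list of
hypotheses `Js`. -/
inductive Rule {W : Type u} : RuleName → List (Judgement W) → Judgement W → Prop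
  | tmRefl (Γ : Ctx W) (t T : Expr W) : Rule .tmRefl [⟨Γ, .tm t T⟩] ⟨Γ, .tmEq t t T⟩
  | tmSymm (Γ : Ctx W) (t₁ t₂ T : Expr W) :
      Rule .tmSymm [⟨Γ, .tmEq t₁ t₂ T⟩] ⟨Γ, .tmEq t₂ t₁ T⟩
  | tmTrans (Γ : Ctx W) (t₁ t₂ t₃ T : Expr W) :
      Rule .tmTrans [⟨Γ, .tmEq t₁ t₂ T⟩, ⟨Γ, .tmEq t₂ t₃ T⟩] ⟨Γ, .tmEq t₁ t₃ T⟩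
  | tyRefl (Γ : Ctx W) (T : Expr W) : Rule .tyRefl [⟨Γ, .ty T⟩] ⟨Γ, .tyEq T T⟩
  | tySymm (Γ : Ctx W) (T₁ T₂ : Expr W) : Rule .tySymm [⟨Γ, .tyEq T₁ T₂⟩] ⟨Γ, .tyEq T₂ T₁⟩
  | tyTrans (Γ : Ctx W) (T₁ T₂ T₃ : Expr W) :
      Rule .tyTrans [⟨Γ, .tyEq T₁ T₂⟩, ⟨Γ, .tyEq T₂ T₃⟩] ⟨Γ, .tyEq T₁ T₃⟩
  | tmConv (Γ : Ctx W) (t T₁ T₂ : Expr W) :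
      Rule .tmConv [⟨Γ, .tyEq T₁ T₂⟩, ⟨Γ, .tm t T₁⟩] ⟨Γ, .tm t T₂⟩
  | tmEqConv (Γ : Ctx W) (t₁ t₂ T₁ T₂ : Expr W) :
      Rule .tmEqConv [⟨Γ, .tyEq T₁ T₂⟩, ⟨Γ, .tmEq t₁ t₂ T₁⟩] ⟨Γ, .tmEq t₁ t₂ T₂⟩
  | ctxConv (Γ Δ : Ctx W) (T₁ T₂ : Expr W) (a : Assertion W) :
      Rule .ctxConv [⟨Γ, .tyEq T₁ T₂⟩, ⟨Γ ++ T₁ :: Δ, a⟩] ⟨Γ ++ T₂ :: Δ, a⟩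
  | subst (Γ Δ : Ctx W) (t T : Expr W) (a : Assertion W) :
      Rule .subst [⟨Γ, .tm t T⟩, ⟨Γ ++ T :: Δ, a⟩]
        ⟨Γ ++ substCtx Γ.length t Δ, a.subst Γ.length t⟩
  | substTyEq (Γ Δ : Ctx W) (t₁ t₂ T T' : Expr W) :
      Rule .substTyEq [⟨Γ, .tmEq t₁ t₂ T⟩, ⟨Γ ++ T :: Δ, .ty T'⟩]
        ⟨Γ ++ substCtx Γ.length t₂ Δ, .tyEq (T'.subst Γ.length t₁) (T'.subst Γ.length t₂)⟩
  | substTmEq (Γ Δ : Ctx W) (t₁ t₂ T t' T' : Expr W) :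
      Rule .substTmEq [⟨Γ, .tmEq t₁ t₂ T⟩, ⟨Γ ++ T :: Δ, .tm t' T'⟩]
        ⟨Γ ++ substCtx Γ.length t₂ Δ,
          .tmEq (t'.subst Γ.length t₁) (t'.subst Γ.length t₂) (T'.subst Γ.length t₂)⟩

/-- The smallest collection of judgements closed under the deduction rules and containing a
judgement of `Λ` whenever it contains each judgement in its boundary. -/
inductive Derivable {W : Type u} (Λ : Set (Judgement W)) : Judgement W → Prop
  | basic (J : Judgement W) : J ∈ Λ → (∀ K ∈ J.boundary, Derivable Λ K) → Derivable Λ J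
  | rule (r : RuleName) (Js : List (Judgement W)) (J : Judgement W) :
      Rule r Js J → (∀ K ∈ Js, Derivable Λ K) → Derivable Λ J

/-! ### Basic facts on derivability -/

section Facts

variable {W : Type u} {Λ : Set (Judgement W)}

theorem boundary_nil (T : Expr W) : (⟨[], .ty T⟩ : Judgement W).boundary = [] := rfl

theorem boundary_concat (Γ : Ctx W) (S T : Expr W) :
    (⟨Γ ++ [S], .ty T⟩ : Judgement W).boundary = [⟨Γ, .ty S⟩] := by
  simp [Judgement.boundary]

theorem Derivable.rule₁ {r : RuleName} {J K : Judgement W} (h : Rule r [J] K)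
    (hJ : Derivable Λ J) : Derivable Λ K :=
  .rule r _ _ h (by simpa using hJ)

theorem Derivable.rule₂ {r : RuleName} {J J' K : Judgement W} (h : Rule r [J, J'] K)
    (hJ : Derivable Λ J) (hJ' : Derivable Λ J') : Derivable Λ K :=
  .rule r _ _ h (by simpa using ⟨hJ, hJ'⟩)

/-- Derivable equality of contexts, type by type. -/
inductive CtxEq (Λ : Set (Judgement W)) : Ctx W → Ctx W → Prop
  | nil : CtxEq Λ [] []
  | concat (Γ Γ' : Ctx W) (T T' : Expr W) : CtxEq Λ Γ Γ' → Derivable Λ ⟨Γ, .tyEq T T'⟩ →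
      CtxEq Λ (Γ ++ [T]) (Γ' ++ [T'])

theorem CtxEq.conv {Γ Γ' : Ctx W} (h : CtxEq Λ Γ Γ') :
    ∀ (Δ : Ctx W) (a : Assertion W), Derivable Λ ⟨Γ' ++ Δ, a⟩ → Derivable Λ ⟨Γ ++ Δ, a⟩ := by
  induction h with
  | nil => intro Δ a h; exact h
  | concat Γ Γ' T T' _ hT ih =>
    intro Δ a h
    have h1 := ih (T' :: Δ) a (by simpa using h)
    have h2 := Derivable.rule₂ (Rule.ctxConv Γ Δ T' T a)
      (Derivable.rule₁ (Rule.tySymm Γ T T') hT) h1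
    simpa using h2

/-- All types in the context of a judgement are derivable. -/
def PrefixDerivable (Λ : Set (Judgement W)) (Γ : Ctx W) : Prop :=
  ∀ (Γ₀ : Ctx W) (T : Expr W) (Δ : Ctx W), Γ = Γ₀ ++ T :: Δ → Derivable Λ ⟨Γ₀, .ty T⟩

theorem PrefixDerivable.concat {Γ : Ctx W} {T : Expr W} (h : PrefixDerivable Λ Γ)
    (hT : Derivable Λ ⟨Γ, .ty T⟩) : PrefixDerivable Λ (Γ ++ [T]) := by
  intro Γ₀ S Δ e
  rcases List.eq_nil_or_concat Δ with rfl | ⟨Δ', R, rfl⟩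
  · obtain ⟨rfl, h'⟩ := List.append_inj' e rfl
    simp only [List.cons.injEq, and_true] at h'
    subst h'; exact hT
  · have e' : Γ ++ [T] = (Γ₀ ++ S :: Δ') ++ [R] := by simpa using e
    obtain ⟨rfl, -⟩ := List.append_inj' e' rfl
    exact h _ _ _ rfl

theorem PrefixDerivable.left {Γ Δ : Ctx W} (h : PrefixDerivable Λ (Γ ++ Δ)) :
    PrefixDerivable Λ Γ := by
  rintro Γ₀ T Δ' rfl
  exact h Γ₀ T (Δ' ++ Δ) (by simp)

theorem CtxEq.refl {Γ : Ctx W} (h : PrefixDerivable Λ Γ) : CtxEq Λ Γ Γ := by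
  induction Γ using List.reverseRecOn with
  | nil => exact .nil
  | append_singleton Γ T ih =>
    exact .concat _ _ _ _ (ih h.left) (Derivable.rule₁ (Rule.tyRefl Γ T) (h Γ T [] rfl))

theorem prefix_of_boundary {J : Judgement W}
    (h : ∀ K ∈ J.boundary, Derivable Λ K ∧ PrefixDerivable Λ K.ctx) :
    PrefixDerivable Λ J.ctx := by
  obtain ⟨Γ, a⟩ := J
  cases a with
  | ty T =>
    rcases List.eq_nil_or_concat Γ with rfl | ⟨Γ', S, rfl⟩
    · intro Γ₀ T Δ e
      simp at e
    · rw [List.concat_eq_append] at h ⊢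
      rw [boundary_concat] at h
      obtain ⟨h1, h2⟩ := h _ (List.mem_singleton.2 rfl)
      exact h2.concat h1
  | tm t T => exact (h _ (List.mem_singleton.2 rfl)).2
  | tyEq T T' => exact (h ⟨Γ, .ty T⟩ (by simp [Judgement.boundary])).2
  | tmEq t t' T => exact (h ⟨Γ, .tm t T⟩ (by simp [Judgement.boundary])).2

theorem PrefixDerivable.subst {Γ Δ : Ctx W} {t T : Expr W} (h : PrefixDerivable Λ (Γ ++ T :: Δ))
    (ht : Derivable Λ ⟨Γ, .tm t T⟩) : PrefixDerivable Λ (Γ ++ substCtx Γ.length t Δ) := by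
  induction Δ using List.reverseRecOn with
  | nil => simpa [substCtx] using h.left
  | append_singleton Δ S ih =>
    have h0 : PrefixDerivable Λ (Γ ++ T :: Δ) :=
      PrefixDerivable.left (Δ := [S]) (by simpa using h)
    have h1 : Derivable Λ ⟨Γ ++ T :: Δ, .ty S⟩ := h _ _ [] (by simp)
    have h2 := (ih h0).concat (Derivable.rule₂ (Rule.subst Γ Δ t T (.ty S)) ht h1)
    simpa [substCtx, Assertion.subst] using h2

theorem PrefixDerivable.ctxConv {Γ Δ : Ctx W} {T T' : Expr W}
    (h : PrefixDerivable Λ (Γ ++ T :: Δ))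
    (hT : Derivable Λ ⟨Γ, .tyEq T T'⟩) (hT' : Derivable Λ ⟨Γ, .ty T'⟩) :
    PrefixDerivable Λ (Γ ++ T' :: Δ) := by
  induction Δ using List.reverseRecOn with
  | nil => exact (PrefixDerivable.left h).concat hT'
  | append_singleton Δ S ih =>
    have h0 : PrefixDerivable Λ (Γ ++ T :: Δ) :=
      PrefixDerivable.left (Δ := [S]) (by simpa using h)
    have h1 : Derivable Λ ⟨Γ ++ T :: Δ, .ty S⟩ := h _ _ [] (by simp)
    have h2 := (ih h0).concat (Derivable.rule₂ (Rule.ctxConv Γ Δ T T' (.ty S)) hT h1)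
    simpa using h2

theorem CtxEq.subst {Γ Δ : Ctx W} {t₁ t₂ T : Expr W} (h : PrefixDerivable Λ (Γ ++ T :: Δ))
    (ht : Derivable Λ ⟨Γ, .tmEq t₁ t₂ T⟩) :
    CtxEq Λ (Γ ++ substCtx Γ.length t₂ Δ) (Γ ++ substCtx Γ.length t₁ Δ) := by
  induction Δ using List.reverseRecOn with
  | nil => simpa [substCtx] using CtxEq.refl h.left
  | append_singleton Δ S ih =>
    have h0 : PrefixDerivable Λ (Γ ++ T :: Δ) :=
      PrefixDerivable.left (Δ := [S]) (by simpa using h)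
    have h1 : Derivable Λ ⟨Γ ++ T :: Δ, .ty S⟩ := h _ _ [] (by simp)
    have h2 := CtxEq.concat _ _ _ _ (ih h0) (Derivable.rule₁ (Rule.tySymm _ _ _)
      (Derivable.rule₂ (Rule.substTyEq Γ Δ t₁ t₂ T S) ht h1))
    simpa [substCtx] using h2

theorem CtxEq.conv' {Γ Γ' : Ctx W} (h : CtxEq Λ Γ Γ') {a : Assertion W}
    (ha : Derivable Λ ⟨Γ', a⟩) : Derivable Λ ⟨Γ, a⟩ := by
  simpa using h.conv [] a (by simpa using ha)

theorem Derivable.presup {J : Judgement W} (h : Derivable Λ J) :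
    (∀ K ∈ J.boundary, Derivable Λ K) ∧ PrefixDerivable Λ J.ctx := by
  induction h with
  | basic J _ hb ih => exact ⟨hb, prefix_of_boundary fun K hK => ⟨hb K hK, (ih K hK).2⟩⟩
  | rule r Js J hr hJs ih =>
    cases hr with
    | tmRefl Γ t T =>
      simp only [forall_eq, Judgement.boundary, List.mem_cons,
        List.not_mem_nil, or_false, forall_eq_or_imp] at *
      exact ⟨⟨hJs, hJs⟩, ih.2⟩
    | tmSymm Γ t₁ t₂ T =>
      simp only [forall_eq, Judgement.boundary, List.mem_cons,
        List.not_mem_nil, or_false, forall_eq_or_imp] at *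
      exact ⟨⟨ih.1.2, ih.1.1⟩, ih.2⟩
    | tmTrans Γ t₁ t₂ t₃ T =>
      simp only [forall_eq, Judgement.boundary, List.mem_cons,
        List.not_mem_nil, or_false, forall_eq_or_imp] at *
      exact ⟨⟨ih.1.1.1, ih.2.1.2⟩, ih.1.2⟩
    | tyRefl Γ T =>
      refine ⟨?_, (ih _ (List.mem_singleton.2 rfl)).2⟩
      have := hJs _ (List.mem_singleton.2 rfl)
      simp [Judgement.boundary, this]
    | tySymm Γ T₁ T₂ =>
      simp only [forall_eq, Judgement.boundary, List.mem_cons,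
        List.not_mem_nil, or_false, forall_eq_or_imp] at *
      exact ⟨⟨ih.1.2, ih.1.1⟩, ih.2⟩
    | tyTrans Γ T₁ T₂ T₃ =>
      simp only [forall_eq, Judgement.boundary, List.mem_cons,
        List.not_mem_nil, or_false, forall_eq_or_imp] at *
      exact ⟨⟨ih.1.1.1, ih.2.1.2⟩, ih.1.2⟩
    | tmConv Γ t T₁ T₂ =>
      simp only [forall_eq, Judgement.boundary, List.mem_cons,
        List.not_mem_nil, or_false, forall_eq_or_imp] at *
      exact ⟨ih.1.1.2, ih.1.2⟩
    | tmEqConv Γ t₁ t₂ T₁ T₂ =>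
      simp only [forall_eq, Judgement.boundary, List.mem_cons,
        List.not_mem_nil, or_false, forall_eq_or_imp] at *
      exact ⟨⟨Derivable.rule₂ (Rule.tmConv _ _ _ _) hJs.1 ih.2.1.1,
        Derivable.rule₂ (Rule.tmConv _ _ _ _) hJs.1 ih.2.1.2⟩, ih.1.2⟩
    | ctxConv Γ Δ T₁ T₂ a =>
      simp only [List.mem_cons, List.not_mem_nil, or_false, forall_eq_or_imp, forall_eq] at hJs ih
      obtain ⟨hE, hA⟩ := hJs
      obtain ⟨⟨ihE, -⟩, ⟨ihA, ihP⟩⟩ := ih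
      have hT₂ : Derivable Λ ⟨Γ, .ty T₂⟩ := ihE _ (by simp [Judgement.boundary])
      have hP := ihP.ctxConv hE hT₂
      refine ⟨?_, hP⟩
      have key : ∀ b, Derivable Λ ⟨Γ ++ T₁ :: Δ, b⟩ → Derivable Λ ⟨Γ ++ T₂ :: Δ, b⟩ :=
        fun b hb => Derivable.rule₂ (Rule.ctxConv Γ Δ T₁ T₂ b) hE hb
      cases a with
      | ty T =>
        rcases List.eq_nil_or_concat Δ with rfl | ⟨Δ', S, rfl⟩
        · rw [boundary_concat]; simpa using hT₂
        · have : (⟨Γ ++ T₂ :: (Δ' ++ [S]), .ty T⟩ : Judgement W).boundary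
              = [⟨Γ ++ T₂ :: Δ', .ty S⟩] := by
            simpa using boundary_concat (Γ ++ T₂ :: Δ') S T
          rw [List.concat_eq_append, this]
          simpa using hP (Γ ++ T₂ :: Δ') S [] (by simp)
      | tm t T =>
        simp only [Judgement.boundary, List.mem_singleton, forall_eq] at ihA ⊢
        exact key _ ihA
      | tyEq T T' =>
        simp only [Judgement.boundary, List.mem_cons, List.not_mem_nil, or_false,
          forall_eq_or_imp, forall_eq] at ihA ⊢
        exact ⟨key _ ihA.1, key _ ihA.2⟩
      | tmEq t t' T =>
        simp only [Judgement.boundary, List.mem_cons, List.not_mem_nil, or_false,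
          forall_eq_or_imp, forall_eq] at ihA ⊢
        exact ⟨key _ ihA.1, key _ ihA.2⟩
    | subst Γ Δ t T a =>
      simp only [List.mem_cons, List.not_mem_nil, or_false, forall_eq_or_imp, forall_eq] at hJs ih
      obtain ⟨hE, hA⟩ := hJs
      obtain ⟨⟨ihE, ihΓ⟩, ⟨ihA, ihP⟩⟩ := ih
      have hP := ihP.subst hE
      refine ⟨?_, hP⟩
      have key : ∀ b : Assertion W, Derivable Λ ⟨Γ ++ T :: Δ, b⟩ →
          Derivable Λ ⟨Γ ++ substCtx Γ.length t Δ, b.subst Γ.length t⟩ :=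
        fun b hb => Derivable.rule₂ (Rule.subst Γ Δ t T b) hE hb
      cases a with
      | ty T' =>
        intro K hK
        simp only [Assertion.subst] at hK
        generalize hΘ : Γ ++ substCtx Γ.length t Δ = Θ at hK hP
        rcases List.eq_nil_or_concat Θ with rfl | ⟨Θ', S, rfl⟩
        · simp [boundary_nil] at hK
        · rw [List.concat_eq_append, boundary_concat, List.mem_singleton] at hK
          subst hK
          exact hP Θ' S [] (by simp)
      | tm t' T' =>
        simp only [Judgement.boundary, List.mem_singleton, forall_eq, Assertion.subst] at ihA ⊢
        exact key _ ihA
      | tyEq T₁ T₂ =>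
        simp only [Judgement.boundary, List.mem_cons, List.not_mem_nil, or_false,
          forall_eq_or_imp, forall_eq, Assertion.subst] at ihA ⊢
        exact ⟨key _ ihA.1, key _ ihA.2⟩
      | tmEq t₁ t₂ T' =>
        simp only [Judgement.boundary, List.mem_cons, List.not_mem_nil, or_false,
          forall_eq_or_imp, forall_eq, Assertion.subst] at ihA ⊢
        exact ⟨key _ ihA.1, key _ ihA.2⟩
    | substTyEq Γ Δ t₁ t₂ T T' =>
      simp only [List.mem_cons, List.not_mem_nil, or_false, forall_eq_or_imp, forall_eq] at hJs ih
      obtain ⟨hE, hA⟩ := hJs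
      obtain ⟨⟨ihE, ihΓ⟩, ⟨ihA, ihP⟩⟩ := ih
      simp only [Judgement.boundary, List.mem_cons, List.not_mem_nil, or_false,
          forall_eq_or_imp, forall_eq] at ihE ⊢
      exact ⟨⟨(CtxEq.subst ihP hE).conv' (Derivable.rule₂ (Rule.subst Γ Δ t₁ T _) ihE.1 hA),
        Derivable.rule₂ (Rule.subst Γ Δ t₂ T _) ihE.2 hA⟩, ihP.subst ihE.2⟩
    | substTmEq Γ Δ t₁ t₂ T t' T' =>
      simp only [List.mem_cons, List.not_mem_nil, or_false, forall_eq_or_imp, forall_eq] at hJs ih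
      obtain ⟨hE, hA⟩ := hJs
      obtain ⟨⟨ihE, ihΓ⟩, ⟨ihA, ihP⟩⟩ := ih
      simp only [Judgement.boundary, List.mem_cons, List.not_mem_nil, or_false,
          forall_eq_or_imp, forall_eq] at ihE ihA ⊢
      refine ⟨⟨?_, Derivable.rule₂ (Rule.subst Γ Δ t₂ T _) ihE.2 hA⟩, ihP.subst ihE.2⟩
      exact Derivable.rule₂ (Rule.tmConv _ _ _ _)
        (Derivable.rule₂ (Rule.substTyEq Γ Δ t₁ t₂ T T') hE ihA)
        ((CtxEq.subst ihP hE).conv' (Derivable.rule₂ (Rule.subst Γ Δ t₁ T (.tm t' T')) ihE.1 hA))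

end Facts

/-! ## Type-and-term structures -/

/-- The vertices of the graph generating `ℍ`: `ty k` is the object `k + 1` and `tm k` is the object
`(k + 1)_t`. -/
inductive HVertex
  | ty (k : ℕ) : HVertex
  | tm (k : ℕ) : HVertex

/-- The edges `k + 1 → k + 2` and `k + 1 → (k + 1)_t` of the graph generating `ℍ`. -/
inductive HEdge : HVertex → HVertex → Type
  | ty (k : ℕ) : HEdge (.ty k) (.ty (k + 1))
  | tm (k : ℕ) : HEdge (.ty k) (.tm k)

instance : Quiver HVertex := ⟨HEdge⟩

/-- The category `ℍ`. -/
abbrev H : Type := Paths HVertex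

abbrev H.ty (k : ℕ) : H := (Paths.of HVertex).obj (.ty k)

abbrev H.tm (k : ℕ) : H := (Paths.of HVertex).obj (.tm k)

/-- Type-and-term structures. -/
abbrev TTS : Type (u + 1) := Hᵒᵖ ⥤ Type u

namespace TTS

/-- Type-elements of degree `k + 1`. -/
abbrev Ty (X : TTS.{u}) (k : ℕ) : Type u := X.obj (op (H.ty k))

/-- Term-elements of degree `k + 1`. -/
abbrev Tm (X : TTS.{u}) (k : ℕ) : Type u := X.obj (op (H.tm k))

/-- The boundary maps `X(k + 2) → X(k + 1)`. -/
def bd (X : TTS.{u}) (k : ℕ) (A : X.Ty (k + 1)) : X.Ty k :=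
  X.map ((Paths.of HVertex).map (HEdge.ty k)).op A

/-- The boundary maps `X((k + 1)_t) → X(k + 1)`. -/
def bdTm (X : TTS.{u}) (k : ℕ) (a : X.Tm k) : X.Ty k :=
  X.map ((Paths.of HVertex).map (HEdge.tm k)).op a

/-- The action of a map of type-and-term structures on type-elements. -/
abbrev onTy {X Y : TTS.{u}} (f : X ⟶ Y) (k : ℕ) (A : X.Ty k) : Y.Ty k := f.app (op (H.ty k)) A

/-- The action of a map of type-and-term structures on term-elements. -/
abbrev onTm {X Y : TTS.{u}} (f : X ⟶ Y) (k : ℕ) (a : X.Tm k) : Y.Tm k := f.app (op (H.tm k)) a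

section Mk

variable (Ty Tm : ℕ → Type u) (bd : ∀ k, Ty (k + 1) → Ty k) (bdTm : ∀ k, Tm k → Ty k)

def mkObj : HVertex → Type u
  | .ty k => Ty k
  | .tm k => Tm k

def mkMap : ∀ {v w : HVertex}, HEdge v w → mkObj Ty Tm w → mkObj Ty Tm v
  | _, _, .ty k => bd k
  | _, _, .tm k => bdTm k

/-- The type-and-term structure with given elements and boundary maps. -/
def mk : TTS.{u} :=
  (Paths.lift (C := (Type u)ᵒᵖ)
    { obj := fun v => op (mkObj Ty Tm v)
      map := fun e => (TypeCat.ofHom (mkMap Ty Tm bd bdTm e)).op }).leftOp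

theorem mk_bd (k : ℕ) (A : Ty (k + 1)) : (mk Ty Tm bd bdTm).bd k A = bd k A := rfl

theorem mk_bdTm (k : ℕ) (a : Tm k) : (mk Ty Tm bd bdTm).bdTm k a = bdTm k a := rfl

end Mk

section Hom

variable {X Y : TTS.{u}}

def homApp (f : ∀ k, X.Ty k → Y.Ty k) (g : ∀ k, X.Tm k → Y.Tm k) :
    ∀ v : HVertex, X.obj (op ((Paths.of HVertex).obj v)) → Y.obj (op ((Paths.of HVertex).obj v))
  | .ty k => f k
  | .tm k => g k

/-- The map of type-and-term structures with given components. -/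
def homMk (f : ∀ k, X.Ty k → Y.Ty k) (g : ∀ k, X.Tm k → Y.Tm k)
    (hf : ∀ k A, f k (X.bd k A) = Y.bd k (f (k + 1) A))
    (hg : ∀ k a, f k (X.bdTm k a) = Y.bdTm k (g k a)) : X ⟶ Y where
  app v := TypeCat.ofHom (homApp f g v.unop)
  naturality := by
    have edge : ∀ {v w : HVertex} (q : HEdge v w) (x : X.obj (op ((Paths.of HVertex).obj w))),
        homApp f g v (X.map ((Paths.of HVertex).map q).op x) =
          Y.map ((Paths.of HVertex).map q).op (homApp f g w x) := by
      intro v w q x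
      cases q with
      | ty k => exact hf k x
      | tm k => exact hg k x
    have key : ∀ {a b : H} (p : a ⟶ b) (x : X.obj (op b)),
        homApp f g a (X.map p.op x) = Y.map p.op (homApp f g b x) := by
      intro a b p
      induction p using Paths.induction with
      | id => intro x; simp; rfl
      | comp p q ih =>
        intro x
        rw [op_comp, X.map_comp, Y.map_comp]
        simp only [types_comp_apply]
        rw [ih]
        exact congrArg _ (edge q x)
    intro a b p
    ext x
    exact key p.unop x

theorem bd_onTy (f : X ⟶ Y) (k : ℕ) (A : X.Ty (k + 1)) :
    onTy f k (X.bd k A) = Y.bd k (onTy f (k + 1) A) :=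
  NatTrans.naturality_apply f _ A

theorem bdTm_onTm (f : X ⟶ Y) (k : ℕ) (a : X.Tm k) :
    onTy f k (X.bdTm k a) = Y.bdTm k (onTm f k a) :=
  NatTrans.naturality_apply f _ a

theorem hom_ext {f g : X ⟶ Y} (h : ∀ k A, onTy f k A = onTy g k A)
    (h' : ∀ k a, onTm f k a = onTm g k a) : f = g := by
  ext ⟨v⟩ x
  cases v with
  | ty k => exact h k x
  | tm k => exact h' k x

end Hom

end TTS

/-! ## The category of `{s}`-GATs -/

/-- An `{s}`-GAT: type-constants, term-constants and basic judgements, such that each constant is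
introduced by exactly one basic judgement, applied to the variables of its context, all other basic
judgements are equality judgements, and all basic judgements are derivable. -/
structure GAT : Type (u + 1) where
  /-- The type-constants. -/
  TyConst : Type u
  /-- The term-constants. -/
  TmConst : Type u
  /-- The basic judgements. -/
  basic : Set (Judgement (TyConst ⊕ TmConst))
  existsUnique_ty (A : TyConst) : ∃! J, J ∈ basic ∧
    ∃ Γ, J = ⟨Γ, .ty (.app (.inl A) Γ.length fun i => .var i)⟩
  existsUnique_tm (f : TmConst) : ∃! J, J ∈ basic ∧
    ∃ Γ T, J = ⟨Γ, .tm (.app (.inr f) Γ.length fun i => .var i) T⟩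
  of_kind_ty (J) : J ∈ basic → J.asn.kind = .ty →
    ∃ A Γ, J = ⟨Γ, .ty (.app (.inl A) Γ.length fun i => .var i)⟩
  of_kind_tm (J) : J ∈ basic → J.asn.kind = .tm →
    ∃ f Γ T, J = ⟨Γ, .tm (.app (.inr f) Γ.length fun i => .var i) T⟩
  derivable_of_basic (J) : J ∈ basic → Derivable basic J

namespace GAT

/-- The alphabet of a theory. -/
abbrev Alphabet (𝕋 : GAT.{u}) : Type u := 𝕋.TyConst ⊕ 𝕋.TmConst

/-- The derived judgements of a theory. -/
abbrev Derived (𝕋 : GAT.{u}) : Type u := {J : Judgement 𝕋.Alphabet // Derivable 𝕋.basic J}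

/-- The boundary of a derived judgement consists of derived judgements. -/
def Derived.boundary {𝕋 : GAT.{u}} (J : 𝕋.Derived) : List 𝕋.Derived :=
  J.1.boundary.attachWith _ J.2.presup.1

/-- The relation `≡` on derived type judgements and on derived term judgements. -/
inductive Eqv (𝕋 : GAT.{u}) : Judgement 𝕋.Alphabet → Judgement 𝕋.Alphabet → Prop
  | ty (Γ Γ' : Ctx 𝕋.Alphabet) (T T' : Expr 𝕋.Alphabet) : CtxEq 𝕋.basic Γ Γ' →
      Derivable 𝕋.basic ⟨Γ, .tyEq T T'⟩ → Eqv 𝕋 ⟨Γ, .ty T⟩ ⟨Γ', .ty T'⟩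
  | tm (Γ Γ' : Ctx 𝕋.Alphabet) (t t' T T' : Expr 𝕋.Alphabet) : CtxEq 𝕋.basic Γ Γ' →
      Derivable 𝕋.basic ⟨Γ, .tyEq T T'⟩ → Derivable 𝕋.basic ⟨Γ, .tmEq t t' T⟩ →
      Eqv 𝕋 ⟨Γ, .tm t T⟩ ⟨Γ', .tm t' T'⟩

/-- Interpretations of one theory in another. -/
@[ext]
structure Interp (𝕋 𝕌 : GAT.{u}) where
  toFun : 𝕋.Derived → 𝕌.Derived
  kind (J) : (toFun J).1.asn.kind = J.1.asn.kind
  boundary (J) : (toFun J).boundary = J.boundary.map toFun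
  /-- Deductions are preserved. (Each rule is a partial function of its hypotheses; that it is
  defined at the images of the hypotheses whenever it is defined at the hypotheses also follows
  from `kind` and `boundary`.) -/
  rule (r : RuleName) (Js : List 𝕋.Derived) (J : 𝕋.Derived) :
    Rule r (Js.map Subtype.val) J.1 → Rule r ((Js.map toFun).map Subtype.val) (toFun J).1

namespace Interp

def id (𝕋 : GAT.{u}) : Interp 𝕋 𝕋 where
  toFun J := J
  kind _ := rfl
  boundary J := by simp
  rule r Js J h := by simpa using h

def comp {𝕋 𝕌 𝕍 : GAT.{u}} (φ : Interp 𝕋 𝕌) (ψ : Interp 𝕌 𝕍) : Interp 𝕋 𝕍 where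
  toFun J := ψ.toFun (φ.toFun J)
  kind J := (ψ.kind _).trans (φ.kind J)
  boundary J := by rw [ψ.boundary, φ.boundary, List.map_map]; rfl
  rule r Js J h := by
    have := ψ.rule r _ _ (φ.rule r Js J h)
    rw [List.map_map (g := ψ.toFun)] at this
    exact this

/-- Two interpretations are equivalent when they agree up to `≡` on derived type judgements and
term judgements. -/
def Equivalent {𝕋 𝕌 : GAT.{u}} (φ ψ : Interp 𝕋 𝕌) : Prop :=
  ∀ J : 𝕋.Derived, J.1.asn.kind = .ty ∨ J.1.asn.kind = .tm →
    𝕌.Eqv (φ.toFun J).1 (ψ.toFun J).1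

section Facts

variable {𝕋 𝕌 : GAT.{u}} (φ : Interp 𝕋 𝕌)

theorem asn_conv {Γ Γ' : Ctx 𝕋.Alphabet} (h : CtxEq 𝕋.basic Γ Γ') :
    ∀ (Δ : Ctx 𝕋.Alphabet) (a : Assertion 𝕋.Alphabet) (hJ' : Derivable 𝕋.basic ⟨Γ' ++ Δ, a⟩)
      (hJ : Derivable 𝕋.basic ⟨Γ ++ Δ, a⟩),
      (φ.toFun ⟨_, hJ⟩).1.asn = (φ.toFun ⟨_, hJ'⟩).1.asn := by
  induction h with
  | nil => intros; rfl
  | concat Γ Γ' T T' hΓ hT ih =>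
    intro Δ a hJ' hJ
    have hJ₁ : Derivable 𝕋.basic ⟨Γ' ++ T' :: Δ, a⟩ := by simpa using hJ'
    have hJ₂ : Derivable 𝕋.basic ⟨Γ ++ T :: Δ, a⟩ := by simpa using hJ
    have h1 := hΓ.conv (T' :: Δ) a hJ₁
    have hS := Derivable.rule₁ (Rule.tySymm Γ T T') hT
    have h2 := φ.rule .ctxConv [⟨_, hS⟩, ⟨_, h1⟩] ⟨_, hJ₂⟩ (Rule.ctxConv Γ Δ T' T a)
    have h3 : (φ.toFun ⟨_, hJ₂⟩).1.asn = (φ.toFun ⟨_, h1⟩).1.asn := by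
      simp only [List.map_cons, List.map_nil] at h2
      generalize (φ.toFun ⟨_, hJ₂⟩).1 = x at h2 ⊢
      generalize (φ.toFun ⟨_, h1⟩).1 = y at h2 ⊢
      generalize (φ.toFun ⟨_, hS⟩).1 = z at h2
      cases h2
      rfl
    have h4 := ih (T' :: Δ) a hJ₁ h1
    have e1 : (⟨_, hJ⟩ : 𝕋.Derived) = ⟨_, hJ₂⟩ := Subtype.ext (by simp)
    have e2 : (⟨_, hJ'⟩ : 𝕋.Derived) = ⟨_, hJ₁⟩ := Subtype.ext (by simp)
    rw [e1, e2, h3, h4]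

theorem asn_conv' {Γ Γ' : Ctx 𝕋.Alphabet} (h : CtxEq 𝕋.basic Γ Γ') {a : Assertion 𝕋.Alphabet}
    (hJ' : Derivable 𝕋.basic ⟨Γ', a⟩) (hJ : Derivable 𝕋.basic ⟨Γ, a⟩) :
    (φ.toFun ⟨_, hJ⟩).1.asn = (φ.toFun ⟨_, hJ'⟩).1.asn := by
  have e1 : (⟨_, hJ⟩ : 𝕋.Derived) = ⟨⟨Γ ++ [], a⟩, by simpa using hJ⟩ := Subtype.ext (by simp)
  have e2 : (⟨_, hJ'⟩ : 𝕋.Derived) = ⟨⟨Γ' ++ [], a⟩, by simpa using hJ'⟩ := Subtype.ext (by simp)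
  rw [e1, e2]
  exact φ.asn_conv h [] a _ _

theorem val_boundary (J : 𝕋.Derived) : J.boundary.map Subtype.val = J.1.boundary := by
  simp [Derived.boundary]

theorem boundary_val (J : 𝕋.Derived) :
    (φ.toFun J).1.boundary = J.boundary.map fun K => (φ.toFun K).1 := by
  rw [← val_boundary, φ.boundary, List.map_map]; rfl

theorem tyEq_spec {Γ : Ctx 𝕋.Alphabet} {T T' : Expr 𝕋.Alphabet}
    (h : Derivable 𝕋.basic ⟨Γ, .tyEq T T'⟩) (h₁ : Derivable 𝕋.basic ⟨Γ, .ty T⟩)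
    (h₂ : Derivable 𝕋.basic ⟨Γ, .ty T'⟩) :
    ∃ Θ A B, (φ.toFun ⟨_, h⟩).1 = ⟨Θ, .tyEq A B⟩ ∧ (φ.toFun ⟨_, h₁⟩).1 = ⟨Θ, .ty A⟩ ∧
      (φ.toFun ⟨_, h₂⟩).1 = ⟨Θ, .ty B⟩ := by
  have hk := φ.kind ⟨_, h⟩
  have hb : (φ.toFun ⟨_, h⟩).1.boundary = [(φ.toFun ⟨_, h₁⟩).1, (φ.toFun ⟨_, h₂⟩).1] :=
    φ.boundary_val ⟨_, h⟩
  generalize (φ.toFun ⟨_, h⟩).1 = x at hk hb ⊢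
  obtain ⟨Θ, a⟩ := x
  cases a <;> simp [Assertion.kind] at hk
  simp only [Judgement.boundary, List.cons.injEq, and_true] at hb
  exact ⟨_, _, _, rfl, hb.1.symm, hb.2.symm⟩

theorem tm_spec {Γ : Ctx 𝕋.Alphabet} {t T : Expr 𝕋.Alphabet}
    (h : Derivable 𝕋.basic ⟨Γ, .tm t T⟩) (h₁ : Derivable 𝕋.basic ⟨Γ, .ty T⟩) :
    ∃ Θ s A, (φ.toFun ⟨_, h⟩).1 = ⟨Θ, .tm s A⟩ ∧ (φ.toFun ⟨_, h₁⟩).1 = ⟨Θ, .ty A⟩ := by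
  have hk := φ.kind ⟨_, h⟩
  have hb : (φ.toFun ⟨_, h⟩).1.boundary = [(φ.toFun ⟨_, h₁⟩).1] := φ.boundary_val ⟨_, h⟩
  generalize (φ.toFun ⟨_, h⟩).1 = x at hk hb ⊢
  obtain ⟨Θ, a⟩ := x
  cases a <;> simp [Assertion.kind] at hk
  simp only [Judgement.boundary, List.cons.injEq, and_true] at hb
  exact ⟨_, _, _, rfl, hb.symm⟩

theorem tmEq_spec {Γ : Ctx 𝕋.Alphabet} {t t' T : Expr 𝕋.Alphabet}
    (h : Derivable 𝕋.basic ⟨Γ, .tmEq t t' T⟩) (h₁ : Derivable 𝕋.basic ⟨Γ, .tm t T⟩)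
    (h₂ : Derivable 𝕋.basic ⟨Γ, .tm t' T⟩) :
    ∃ Θ s s' A, (φ.toFun ⟨_, h⟩).1 = ⟨Θ, .tmEq s s' A⟩ ∧ (φ.toFun ⟨_, h₁⟩).1 = ⟨Θ, .tm s A⟩ ∧
      (φ.toFun ⟨_, h₂⟩).1 = ⟨Θ, .tm s' A⟩ := by
  have hk := φ.kind ⟨_, h⟩
  have hb : (φ.toFun ⟨_, h⟩).1.boundary = [(φ.toFun ⟨_, h₁⟩).1, (φ.toFun ⟨_, h₂⟩).1] :=
    φ.boundary_val ⟨_, h⟩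
  generalize (φ.toFun ⟨_, h⟩).1 = x at hk hb ⊢
  obtain ⟨Θ, a⟩ := x
  cases a <;> simp [Assertion.kind] at hk
  simp only [Judgement.boundary, List.cons.injEq, and_true] at hb
  exact ⟨_, _, _, _, rfl, hb.1.symm, hb.2.symm⟩

theorem ty_nil_spec {T : Expr 𝕋.Alphabet} (h : Derivable 𝕋.basic ⟨[], .ty T⟩) :
    ∃ A, (φ.toFun ⟨_, h⟩).1 = ⟨[], .ty A⟩ := by
  have hk := φ.kind ⟨_, h⟩
  have hb : (φ.toFun ⟨_, h⟩).1.boundary = [] := φ.boundary_val ⟨_, h⟩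
  generalize (φ.toFun ⟨_, h⟩).1 = x at hk hb ⊢
  obtain ⟨Θ, a⟩ := x
  cases a <;> simp [Assertion.kind] at hk
  rcases List.eq_nil_or_concat Θ with rfl | ⟨Θ, S, rfl⟩
  · exact ⟨_, rfl⟩
  · rw [List.concat_eq_append, boundary_concat] at hb
    simp at hb

theorem ty_concat_spec {Γ : Ctx 𝕋.Alphabet} {S T : Expr 𝕋.Alphabet}
    (h : Derivable 𝕋.basic ⟨Γ ++ [S], .ty T⟩) (h₁ : Derivable 𝕋.basic ⟨Γ, .ty S⟩) :
    ∃ Θ A B, (φ.toFun ⟨_, h⟩).1 = ⟨Θ ++ [A], .ty B⟩ ∧ (φ.toFun ⟨_, h₁⟩).1 = ⟨Θ, .ty A⟩ := by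
  have hk := φ.kind ⟨_, h⟩
  have hb : (φ.toFun ⟨_, h⟩).1.boundary = [(φ.toFun ⟨_, h₁⟩).1] := by
    rw [φ.boundary_val]
    have e : Derived.boundary (𝕋 := 𝕋) ⟨_, h⟩ = [⟨_, h₁⟩] := by
      apply List.map_injective_iff.2 Subtype.val_injective
      rw [val_boundary, boundary_concat]; rfl
    rw [e]; rfl
  generalize (φ.toFun ⟨_, h⟩).1 = x at hk hb ⊢
  obtain ⟨Θ, a⟩ := x
  cases a <;> simp [Assertion.kind] at hk
  rcases List.eq_nil_or_concat Θ with rfl | ⟨Θ, S, rfl⟩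
  · simp [boundary_nil] at hb
  · rw [List.concat_eq_append, boundary_concat] at hb
    simp only [List.cons.injEq, and_true] at hb
    exact ⟨Θ, S, _, by rw [List.concat_eq_append], hb.symm⟩

theorem map_eqv_ty {Γ Γ' : Ctx 𝕋.Alphabet} (h : CtxEq 𝕋.basic Γ Γ') :
    ∀ {T T' : Expr 𝕋.Alphabet} (_ : Derivable 𝕋.basic ⟨Γ, .tyEq T T'⟩)
      (hJ : Derivable 𝕋.basic ⟨Γ, .ty T⟩) (hJ' : Derivable 𝕋.basic ⟨Γ', .ty T'⟩),
      𝕌.Eqv (φ.toFun ⟨_, hJ⟩).1 (φ.toFun ⟨_, hJ'⟩).1 := by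
  have step : ∀ {Γ Γ' Θ' : Ctx _} {T T' B : Expr _} {Δ : Ctx _} {A : Expr _},
      CtxEq 𝕋.basic Γ Γ' → Derivable 𝕋.basic ⟨Γ, .tyEq T T'⟩ →
      ∀ (hJ : Derivable 𝕋.basic ⟨Γ, .ty T⟩) (hJ' : Derivable 𝕋.basic ⟨Γ', .ty T'⟩),
      (φ.toFun ⟨_, hJ⟩).1 = ⟨Δ, .ty A⟩ → (φ.toFun ⟨_, hJ'⟩).1 = ⟨Θ', .ty B⟩ →
      Derivable 𝕌.basic ⟨Δ, .tyEq A B⟩ := by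
    intro Γ Γ' Θ' T T' B Δ A hΓ hT hJ hJ' e e'
    have h₂ : Derivable 𝕋.basic ⟨Γ, .ty T'⟩ := hΓ.conv' hJ'
    obtain ⟨Θ, A₀, B₀, e0, e1, e2⟩ := φ.tyEq_spec hT hJ h₂
    have e3 := φ.asn_conv' hΓ hJ' h₂
    rw [e2, e'] at e3
    rw [e1] at e
    simp only [Assertion.ty.injEq] at e3
    simp only [Judgement.mk.injEq, Assertion.ty.injEq] at e
    obtain ⟨rfl, rfl⟩ := e
    subst e3
    rw [← e0]
    exact (φ.toFun _).2
  induction h with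
  | nil =>
    intro T T' hT hJ hJ'
    obtain ⟨A, e⟩ := φ.ty_nil_spec hJ
    obtain ⟨B, e'⟩ := φ.ty_nil_spec hJ'
    have := step .nil hT hJ hJ' e e'
    rw [e, e']
    exact .ty _ _ _ _ .nil this
  | concat Γ Γ' S S' hΓ hS ih =>
    intro T T' hT hJ hJ'
    have hJ₀ : Derivable 𝕋.basic ⟨Γ, .ty S⟩ := hJ.presup.2 Γ S [] rfl
    have hJ₀' : Derivable 𝕋.basic ⟨Γ', .ty S'⟩ := hJ'.presup.2 Γ' S' [] rfl
    obtain ⟨Θ, A, B, e, e₀⟩ := φ.ty_concat_spec hJ hJ₀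
    obtain ⟨Θ', A', B', e', e₀'⟩ := φ.ty_concat_spec hJ' hJ₀'
    have h1 := step (.concat _ _ _ _ hΓ hS) hT hJ hJ' e e'
    have h2 := ih hS hJ₀ hJ₀'
    rw [e₀, e₀'] at h2
    rw [e, e']
    cases h2 with
    | ty _ _ _ _ h3 h4 => exact .ty _ _ _ _ (.concat _ _ _ _ h3 h4) h1

/-- Interpretations preserve `≡`. -/
theorem map_eqv {J J' : 𝕋.Derived} (h : 𝕋.Eqv J.1 J'.1) :
    𝕌.Eqv (φ.toFun J).1 (φ.toFun J').1 := by
  obtain ⟨J, hJ⟩ := J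
  obtain ⟨J', hJ'⟩ := J'
  cases h with
  | ty Γ Γ' T T' hΓ hT => exact φ.map_eqv_ty hΓ hT hJ hJ'
  | tm Γ Γ' t t' T T' hΓ hT ht =>
    have h₀ : Derivable 𝕋.basic ⟨Γ, .ty T⟩ := hJ.presup.1 _ (List.mem_singleton.2 rfl)
    have h₀' : Derivable 𝕋.basic ⟨Γ', .ty T'⟩ := hJ'.presup.1 _ (List.mem_singleton.2 rfl)
    have h₁ := φ.map_eqv_ty hΓ hT h₀ h₀'
    obtain ⟨Θ, s, A, e, e₀⟩ := φ.tm_spec hJ h₀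
    obtain ⟨Θ', s', A', e', e₀'⟩ := φ.tm_spec hJ' h₀'
    rw [e₀, e₀'] at h₁
    have c₁ : Derivable 𝕋.basic ⟨Γ, .tm t' T'⟩ := hΓ.conv' hJ'
    have hT' := Derivable.rule₁ (Rule.tySymm Γ T T') hT
    have c₂ : Derivable 𝕋.basic ⟨Γ, .tm t' T⟩ :=
      Derivable.rule₂ (Rule.tmConv Γ t' T' T) hT' c₁
    obtain ⟨Θ₀, s₀, s₀', A₀, f, f₁, f₂⟩ := φ.tmEq_spec ht hJ c₂
    have g := φ.asn_conv' hΓ hJ' c₁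
    have r := φ.rule .tmConv [⟨_, hT'⟩, ⟨_, c₁⟩] ⟨_, c₂⟩ (Rule.tmConv Γ t' T' T)
    simp only [List.map_cons, List.map_nil] at r
    rw [e'] at g
    rw [e] at f₁
    simp only [Judgement.mk.injEq, Assertion.tm.injEq] at f₁
    obtain ⟨rfl, rfl, rfl⟩ := f₁
    have hs : s₀' = s' := by
      rw [f₂] at r
      generalize (φ.toFun ⟨_, c₁⟩).1 = y at r g
      generalize (φ.toFun ⟨_, hT'⟩).1 = z at r
      cases r
      simp only [Assertion.tm.injEq] at g
      exact g.1
    subst hs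
    rw [e, e']
    cases h₁ with
    | ty _ _ _ _ h3 h4 =>
      refine .tm _ _ _ _ _ _ h3 h4 ?_
      rw [← f]
      exact (φ.toFun _).2

theorem length_ty {Γ : Ctx 𝕋.Alphabet} : ∀ {T : Expr 𝕋.Alphabet}
    (h : Derivable 𝕋.basic ⟨Γ, .ty T⟩), (φ.toFun ⟨_, h⟩).1.ctx.length = Γ.length := by
  induction Γ using List.reverseRecOn with
  | nil =>
    intro T h
    obtain ⟨A, e⟩ := φ.ty_nil_spec h
    rw [e]; rfl
  | append_singleton Γ S ih =>
    intro T h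
    have h₁ : Derivable 𝕋.basic ⟨Γ, .ty S⟩ := h.presup.2 Γ S [] rfl
    obtain ⟨Θ, A, B, e, e₁⟩ := φ.ty_concat_spec h h₁
    have := ih h₁
    rw [e₁] at this
    rw [e]
    simpa using this

theorem length_eq {J : 𝕋.Derived} (h : J.1.asn.kind = .ty ∨ J.1.asn.kind = .tm) :
    (φ.toFun J).1.ctx.length = J.1.ctx.length := by
  obtain ⟨⟨Γ, a⟩, hJ⟩ := J
  cases a with
  | ty T => exact φ.length_ty hJ
  | tm t T =>
    have h₁ : Derivable 𝕋.basic ⟨Γ, .ty T⟩ := hJ.presup.1 _ (List.mem_singleton.2 rfl)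
    obtain ⟨Θ, s, A, e, e₁⟩ := φ.tm_spec hJ h₁
    have := φ.length_ty h₁
    rw [e₁] at this
    rw [e]
    exact this
  | tyEq T T' => simp [Assertion.kind] at h
  | tmEq t t' T => simp [Assertion.kind] at h

end Facts

end Interp

/-- Morphisms of theories: interpretations modulo equivalence. -/
def Hom (𝕋 𝕌 : GAT.{u}) : Type u := Quot (Interp.Equivalent (𝕋 := 𝕋) (𝕌 := 𝕌))

def Hom.id (𝕋 : GAT.{u}) : Hom 𝕋 𝕋 := Quot.mk _ (Interp.id 𝕋)

def Hom.comp {𝕋 𝕌 𝕍 : GAT.{u}} : Hom 𝕋 𝕌 → Hom 𝕌 𝕍 → Hom 𝕋 𝕍 :=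
  Quot.map₂ Interp.comp
    (fun φ ψ ψ' h J hJ => h (φ.toFun J) (by rwa [φ.kind]))
    (fun φ φ' ψ h J hJ => ψ.map_eqv (h J hJ))

/-- The category of `{s}`-GATs. -/
instance : Category.{u} GAT.{u} where
  Hom := Hom
  id := Hom.id
  comp := Hom.comp
  id_comp := by rintro 𝕋 𝕌 ⟨φ⟩; rfl
  comp_id := by rintro 𝕋 𝕌 ⟨φ⟩; rfl
  assoc := by rintro 𝕋 𝕌 𝕍 𝕎 ⟨φ⟩ ⟨ψ⟩ ⟨χ⟩; rfl

/-! ## The forgetful functor -/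

/-- Derived type judgements of degree `k + 1`. -/
def TyJudgement (𝕋 : GAT.{u}) (k : ℕ) : Type u :=
  {J : 𝕋.Derived // J.1.asn.kind = .ty ∧ J.1.ctx.length = k}

/-- Derived term judgements of degree `k + 1`. -/
def TmJudgement (𝕋 : GAT.{u}) (k : ℕ) : Type u :=
  {J : 𝕋.Derived // J.1.asn.kind = .tm ∧ J.1.ctx.length = k}

theorem TyJudgement.exists_boundary {𝕋 : GAT.{u}} {k : ℕ} (J : 𝕋.TyJudgement (k + 1)) :
    ∃ (K : 𝕋.TyJudgement k) (T : Expr 𝕋.Alphabet) (S : Expr 𝕋.Alphabet),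
      J.1.boundary = [K.1] ∧ K.1.1 = ⟨K.1.1.ctx, .ty S⟩ ∧
        J.1.1 = ⟨K.1.1.ctx ++ [S], .ty T⟩ := by
  obtain ⟨⟨⟨Γ, a⟩, hJ⟩, hk, hl⟩ := J
  obtain ⟨T, rfl⟩ : ∃ T, a = .ty T := by cases a <;> simp_all [Assertion.kind]
  rcases List.eq_nil_or_concat Γ with rfl | ⟨Γ, S, rfl⟩
  · simp at hl
  · rw [List.concat_eq_append] at hJ
    refine ⟨⟨⟨⟨Γ, .ty S⟩, hJ.presup.2 Γ S [] rfl⟩, rfl, by simpa using hl⟩, T, S, ?_, rfl, by simp⟩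
    apply List.map_injective_iff.2 Subtype.val_injective
    rw [Interp.val_boundary]
    simp [Judgement.boundary]

theorem TmJudgement.exists_boundary {𝕋 : GAT.{u}} {k : ℕ} (J : 𝕋.TmJudgement k) :
    ∃ (K : 𝕋.TyJudgement k) (t T : Expr 𝕋.Alphabet),
      J.1.boundary = [K.1] ∧ K.1.1 = ⟨K.1.1.ctx, .ty T⟩ ∧ J.1.1 = ⟨K.1.1.ctx, .tm t T⟩ := by
  obtain ⟨⟨⟨Γ, a⟩, hJ⟩, hk, hl⟩ := J
  obtain ⟨t, T, rfl⟩ : ∃ t T, a = .tm t T := by cases a <;> simp_all [Assertion.kind]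
  exact ⟨⟨⟨⟨Γ, .ty T⟩, hJ.presup.1 _ (List.mem_singleton.2 rfl)⟩, rfl, hl⟩, t, T, rfl, rfl, rfl⟩

/-- The unique judgement in the boundary of a type judgement in a non-empty context. -/
def TyJudgement.boundary {𝕋 : GAT.{u}} {k : ℕ} (J : 𝕋.TyJudgement (k + 1)) : 𝕋.TyJudgement k :=
  ⟨J.1.boundary.head (by obtain ⟨K, T, S, h, -⟩ := J.exists_boundary; simp [h]), by
    obtain ⟨K, T, S, h, -⟩ := J.exists_boundary
    simpa [h] using K.2⟩

/-- The unique judgement in the boundary of a term judgement. -/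
def TmJudgement.boundary {𝕋 : GAT.{u}} {k : ℕ} (J : 𝕋.TmJudgement k) : 𝕋.TyJudgement k :=
  ⟨J.1.boundary.head (by obtain ⟨K, t, T, h, -⟩ := J.exists_boundary; simp [h]), by
    obtain ⟨K, t, T, h, -⟩ := J.exists_boundary
    simpa [h] using K.2⟩

theorem TyJudgement.exists_eq {𝕋 : GAT.{u}} {k : ℕ} (J : 𝕋.TyJudgement (k + 1)) :
    ∃ (Γ : Ctx 𝕋.Alphabet) (S T : Expr 𝕋.Alphabet),
      J.1.1 = ⟨Γ ++ [S], .ty T⟩ ∧ J.boundary.1.1 = ⟨Γ, .ty S⟩ := by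
  obtain ⟨K, T, S, h, h1, h2⟩ := J.exists_boundary
  have : J.boundary = K := by
    apply Subtype.ext
    simp [TyJudgement.boundary, h]
  exact ⟨_, S, T, h2, by rw [this]; exact h1⟩

theorem TmJudgement.exists_eq {𝕋 : GAT.{u}} {k : ℕ} (J : 𝕋.TmJudgement k) :
    ∃ (Γ : Ctx 𝕋.Alphabet) (t T : Expr 𝕋.Alphabet),
      J.1.1 = ⟨Γ, .tm t T⟩ ∧ J.boundary.1.1 = ⟨Γ, .ty T⟩ := by
  obtain ⟨K, t, T, h, h1, h2⟩ := J.exists_boundary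
  have : J.boundary = K := by
    apply Subtype.ext
    simp [TmJudgement.boundary, h]
  exact ⟨_, t, T, h2, by rw [this]; exact h1⟩

theorem _root_.SGAT.CtxEq.concat_inv {W : Type u} {Λ : Set (Judgement W)} {Γ Γ' : Ctx W}
    {S S' : Expr W} (h : CtxEq Λ (Γ ++ [S]) (Γ' ++ [S'])) :
    CtxEq Λ Γ Γ' ∧ Derivable Λ ⟨Γ, .tyEq S S'⟩ := by
  generalize hx : Γ ++ [S] = x at h
  generalize hy : Γ' ++ [S'] = y at h
  cases h with
  | nil => simp at hx
  | concat Δ Δ' R R' h1 h2 =>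
    obtain ⟨rfl, e⟩ := List.append_inj' hx rfl
    obtain ⟨rfl, e'⟩ := List.append_inj' hy rfl
    simp only [List.cons.injEq, and_true] at e e'
    subst e; subst e'
    exact ⟨h1, h2⟩

theorem TyJudgement.boundary_eqv {𝕋 : GAT.{u}} {k : ℕ} {J J' : 𝕋.TyJudgement (k + 1)}
    (h : 𝕋.Eqv J.1.1 J'.1.1) : 𝕋.Eqv J.boundary.1.1 J'.boundary.1.1 := by
  obtain ⟨Γ, S, T, e, e₁⟩ := J.exists_eq
  obtain ⟨Γ', S', T', e', e₁'⟩ := J'.exists_eq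
  rw [e, e'] at h
  rw [e₁, e₁']
  cases h with
  | ty _ _ _ _ h1 h2 => exact .ty _ _ _ _ h1.concat_inv.1 h1.concat_inv.2

theorem TmJudgement.boundary_eqv {𝕋 : GAT.{u}} {k : ℕ} {J J' : 𝕋.TmJudgement k}
    (h : 𝕋.Eqv J.1.1 J'.1.1) : 𝕋.Eqv J.boundary.1.1 J'.boundary.1.1 := by
  obtain ⟨Γ, t, T, e, e₁⟩ := J.exists_eq
  obtain ⟨Γ', t', T', e', e₁'⟩ := J'.exists_eq
  rw [e, e'] at h
  rw [e₁, e₁']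
  cases h with
  | tm _ _ _ _ _ _ h1 h2 h3 => exact .ty _ _ _ _ h1 h2

/-- `V𝕋(k + 1)`. -/
def VTy (𝕋 : GAT.{u}) (k : ℕ) : Type u := Quot fun J J' : 𝕋.TyJudgement k => 𝕋.Eqv J.1.1 J'.1.1

/-- `V𝕋((k + 1)_t)`. -/
def VTm (𝕋 : GAT.{u}) (k : ℕ) : Type u := Quot fun J J' : 𝕋.TmJudgement k => 𝕋.Eqv J.1.1 J'.1.1

/-- The type-and-term structure `V𝕋` of derived type judgements and term judgements modulo `≡`. -/
def forgetObj (𝕋 : GAT.{u}) : TTS.{u} :=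
  TTS.mk 𝕋.VTy 𝕋.VTm
    (fun _ => Quot.map TyJudgement.boundary fun _ _ => TyJudgement.boundary_eqv)
    (fun _ => Quot.map TmJudgement.boundary fun _ _ => TmJudgement.boundary_eqv)

namespace Interp

variable {𝕋 𝕌 : GAT.{u}}

def onTy (φ : Interp 𝕋 𝕌) (k : ℕ) (J : 𝕋.TyJudgement k) : 𝕌.TyJudgement k :=
  ⟨φ.toFun J.1, (φ.kind J.1).trans J.2.1, (φ.length_eq (.inl J.2.1)).trans J.2.2⟩

def onTm (φ : Interp 𝕋 𝕌) (k : ℕ) (J : 𝕋.TmJudgement k) : 𝕌.TmJudgement k :=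
  ⟨φ.toFun J.1, (φ.kind J.1).trans J.2.1, (φ.length_eq (.inr J.2.1)).trans J.2.2⟩

theorem onTy_boundary (φ : Interp 𝕋 𝕌) (k : ℕ) (J : 𝕋.TyJudgement (k + 1)) :
    φ.onTy k J.boundary = (φ.onTy (k + 1) J).boundary := by
  apply Subtype.ext
  simp only [onTy, TyJudgement.boundary, φ.boundary, List.head_map]

theorem onTm_boundary (φ : Interp 𝕋 𝕌) (k : ℕ) (J : 𝕋.TmJudgement k) :
    φ.onTy k J.boundary = (φ.onTm k J).boundary := by
  apply Subtype.ext
  simp only [onTy, onTm, TmJudgement.boundary, φ.boundary, List.head_map]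

/-- `Vφ` for an interpretation `φ`. -/
def forgetMap (φ : Interp 𝕋 𝕌) : 𝕋.forgetObj ⟶ 𝕌.forgetObj :=
  TTS.homMk (X := 𝕋.forgetObj) (Y := 𝕌.forgetObj)
    (fun k => Quot.map (φ.onTy k) fun _ _ h => φ.map_eqv h)
    (fun k => Quot.map (φ.onTm k) fun _ _ h => φ.map_eqv h)
    (by rintro k ⟨J⟩; exact congrArg (Quot.mk _) (φ.onTy_boundary k J))
    (by rintro k ⟨J⟩; exact congrArg (Quot.mk _) (φ.onTm_boundary k J))

end Interp

/-- The forgetful functor `V` from `{s}`-GATs to type-and-term structures. -/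
def forget : GAT.{u} ⥤ TTS.{u} where
  obj := forgetObj
  map {𝕋 𝕌} := Quot.lift (Interp.forgetMap (𝕋 := 𝕋) (𝕌 := 𝕌)) fun φ ψ h => by
    apply TTS.hom_ext
    · rintro k ⟨J⟩
      exact Quot.sound (h J.1 (.inl J.2.1))
    · rintro k ⟨J⟩
      exact Quot.sound (h J.1 (.inr J.2.1))
  map_id 𝕋 := by
    apply TTS.hom_ext
    · rintro k ⟨J⟩; rfl
    · rintro k ⟨J⟩; rfl
  map_comp := by
    rintro 𝕋 𝕌 𝕍 ⟨φ⟩ ⟨ψ⟩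
    apply TTS.hom_ext
    · rintro k ⟨J⟩; rfl
    · rintro k ⟨J⟩; rfl

end GAT

end SGAT

/-! ## Cartesian and local right adjoint monads -/

/-- A functor is local right adjoint if the functors it induces on slice categories are right
adjoints. -/
def IsLocalRightAdjoint {C : Type*} {D : Type*} [Category* C] [Category* D] (F : C ⥤ D) : Prop :=
  ∀ X : C, (Over.post (X := X) F).IsRightAdjoint

/-- A monad is cartesian if it preserves pullbacks and all naturality squares of its unit and of
its multiplication are pullbacks. -/
structure IsCartesianMonad {C : Type*} [Category* C] (S : Monad C) : Prop where
  preservesPullbacks :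
    Limits.PreservesLimitsOfShape Limits.WalkingCospan S.toFunctor
  unit : NatTrans.Equifibered S.η
  mult : NatTrans.Equifibered S.μ

/-- A monad is strongly cartesian if it is cartesian and local right adjoint. -/
structure IsStronglyCartesian {C : Type*} [Category* C] (S : Monad C) : Prop where
  cartesian : IsCartesianMonad S
  localRightAdjoint : IsLocalRightAdjoint S.toFunctor

namespace SGAT

/-! ## Inc-lists -/

/-- Inc-lists of length `n`. -/
@[ext]
structure IncList (n : ℕ) where
  toFun : Fin (n + 1) → ℕ
  map_zero : toFun 0 = 0
  strictMono : StrictMono toFun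

namespace IncList

/-- The last value `α(n)` of an inc-list `α` of length `n`. -/
def top {n : ℕ} (α : IncList n) : ℕ := α.toFun (Fin.last n)

/-- The restriction of an inc-list of length `n + 1` to `[0, n]`. -/
def bd {n : ℕ} (α : IncList (n + 1)) : IncList n where
  toFun i := α.toFun i.castSucc
  map_zero := α.map_zero
  strictMono _ _ h := α.strictMono (Fin.castSucc_lt_castSucc_iff.2 h)

/-- The inc-list `i ↦ i`. -/
def iota (n : ℕ) : IncList n where
  toFun i := i
  map_zero := rfl
  strictMono _ _ h := h

/-- The composite `βα`, for `α` of length `n` and `β` of length `m = α(n)`. -/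
def comp {n m : ℕ} (α : IncList n) (β : IncList m) (h : α.top = m) : IncList n where
  toFun i := β.toFun ⟨α.toFun i, by
    have : α.toFun i ≤ α.top := α.strictMono.monotone (Fin.le_last i)
    omega⟩
  map_zero := by
    simp only [α.map_zero]
    exact β.map_zero
  strictMono _ _ hij := β.strictMono (Fin.mk_lt_mk.2 (α.strictMono hij))

end IncList

/-- The type-and-term structure with one type-element in each degree `1 ≤ i ≤ m`, one term-element
in each degree `1 ≤ i ≤ m` that belongs to `s`, and no other elements. -/
def shape (m : ℕ) (s : Set ℕ) : TTS.{u} :=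
  TTS.mk (fun k => ULift (PLift (k + 1 ≤ m))) (fun k => ULift (PLift (k + 1 ≤ m ∧ k + 1 ∈ s)))
    (fun _ h => ⟨⟨(Nat.le_succ _).trans h.down.down⟩⟩) (fun _ h => ⟨⟨h.down.down.1⟩⟩)

/-- The inclusion of one such structure in another. -/
def shapeIncl {m m' : ℕ} {s s' : Set ℕ} (h : m ≤ m') (h' : ∀ i ≤ m, i ∈ s → i ∈ s') :
    shape.{u} m s ⟶ shape.{u} m' s' :=
  TTS.homMk (X := shape m s) (Y := shape m' s')
    (fun _ x => ⟨⟨x.down.down.trans h⟩⟩)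
    (fun _ x => ⟨⟨x.down.down.1.trans h, h' _ x.down.down.1 x.down.down.2⟩⟩)
    (fun _ _ => rfl) (fun _ _ => rfl)

namespace IncList

/-- The type-and-term structure `[α]`: it has a type-element in each degree `i ≤ α(n)` and a
term-element in each degree `i ≤ α(n)` with `i ∉ im α`. -/
def shape {n : ℕ} (α : IncList n) : TTS.{u} := SGAT.shape α.top (Set.range α.toFun)ᶜ

/-- The type-and-term structure `[α]_t`, which is `[α]` with a term-element in degree `α(n)`
adjoined. -/
def shapeTm {n : ℕ} (α : IncList n) : TTS.{u} :=
  SGAT.shape α.top ((Set.range α.toFun)ᶜ ∪ {α.top})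

/-- The inclusion of `[∂α]` in `[α]`. -/
def inclBd {n : ℕ} (α : IncList (n + 1)) : α.bd.shape ⟶ α.shape :=
  shapeIncl (α.strictMono.monotone (Fin.le_last _)) (by
    rintro i hi hs ⟨j, rfl⟩
    rcases Fin.eq_castSucc_or_eq_last j with ⟨j, rfl⟩ | rfl
    · exact hs ⟨j, rfl⟩
    · exact absurd (α.strictMono (Fin.castSucc_lt_last (Fin.last n))) (not_lt.2 hi))

/-- The inclusion of `[α]` in `[α]_t`. -/
def inclTm {n : ℕ} (α : IncList n) : α.shape ⟶ α.shapeTm :=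
  shapeIncl le_rfl fun _ _ h => .inl h

end IncList

/-- The type-and-term structure with type-elements of degree `n` the pairs of an inc-list `α` of
length `n` and a map `[α] ⟶ X`, and term-elements of degree `n` the pairs of an inc-list `α` of
length `n` and a map `[α]_t ⟶ X`. -/
def incObj (X : TTS.{u}) : TTS.{u} :=
  TTS.mk (fun k => Σ α : IncList (k + 1), (α.shape ⟶ X))
    (fun k => Σ α : IncList (k + 1), (α.shapeTm ⟶ X))
    (fun _ x => ⟨x.1.bd, x.1.inclBd ≫ x.2⟩) (fun _ x => ⟨x.1, x.1.inclTm ≫ x.2⟩)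

/-- The endofunctor `X ↦ incObj X`. In each degree it is a coproduct of representable functors,
indexed by inc-lists. -/
def incFunctor : TTS.{u} ⥤ TTS.{u} where
  obj := incObj
  map {X Y} f := TTS.homMk (X := incObj X) (Y := incObj Y)
    (fun _ x => ⟨x.1, x.2 ≫ f⟩) (fun _ x => ⟨x.1, x.2 ≫ f⟩)
    (fun _ x => congrArg (Sigma.mk x.1.bd) (Category.assoc _ _ _))
    (fun _ x => congrArg (Sigma.mk x.1) (Category.assoc _ _ _))
  map_id _ := TTS.hom_ext (fun _ x => congrArg (Sigma.mk x.1) (Category.comp_id _))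
    (fun _ x => congrArg (Sigma.mk x.1) (Category.comp_id _))
  map_comp _ _ := TTS.hom_ext (fun _ x => congrArg (Sigma.mk x.1) (Category.assoc _ _ _).symm)
    (fun _ x => congrArg (Sigma.mk x.1) (Category.assoc _ _ _).symm)

/-- The type-element `A` of `X` is the value of `h` at the type-element of degree `k + 1`. -/
def HasTy {X : TTS.{u}} {m : ℕ} {s : Set ℕ} (h : shape m s ⟶ X) (k : ℕ) (A : X.Ty k) : Prop :=
  ∃ hk : k + 1 ≤ m, TTS.onTy h k ⟨⟨hk⟩⟩ = A

/-- The term-element `a` of `X` is the value of `h` at the term-element of degree `k + 1`. -/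
def HasTm {X : TTS.{u}} {m : ℕ} {s : Set ℕ} (h : shape m s ⟶ X) (k : ℕ) (a : X.Tm k) : Prop :=
  ∃ hk : k + 1 ≤ m ∧ k + 1 ∈ s, TTS.onTm h k ⟨⟨hk⟩⟩ = a

/-- A type-element `A` of degree `n` is sent to `(ι, Ã)`, where `ι` is the inc-list `i ↦ i` of
length `n` and `Ã` is the map `[ι] ⟶ X` with value `A` in degree `n`; and similarly for
term-elements. -/
structure IsIncUnit (η : 𝟭 TTS.{u} ⟶ incFunctor.{u}) : Prop where
  ty (X : TTS.{u}) (k : ℕ) (A : X.Ty k) : ∃ h : (IncList.iota (k + 1)).shape ⟶ X,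
    HasTy h k A ∧ TTS.onTy (η.app X) k A = ⟨IncList.iota (k + 1), h⟩
  tm (X : TTS.{u}) (k : ℕ) (a : X.Tm k) : ∃ h : (IncList.iota (k + 1)).shapeTm ⟶ X,
    HasTm h k a ∧ TTS.onTm (η.app X) k a = ⟨IncList.iota (k + 1), h⟩

/-- Let `ℓ : [α] ⟶ incObj X` have value `(β, h)` in degree `α(n) = m + 1`, and values `k(j)` at
the term-elements of degree `j ∉ im α`. Then `IsUnion` says that `g : [βα] ⟶ X` is the map
`h ∪ k`: it agrees with `h` on type-elements and on the term-elements of degree `i ∉ im β`, and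
its value at the term-element of degree `β(j)` is the term-element `k(j)`. -/
structure IsUnion {X : TTS.{u}} {n m : ℕ} {α : IncList n} (ℓ : α.shape ⟶ incObj X)
    {β : IncList (m + 1)} (h : β.shape ⟶ X) (hm : α.top = m + 1)
    (g : (α.comp β hm).shape ⟶ X) : Prop where
  ty (i : ℕ) (A : X.Ty i) : HasTy h i A → HasTy g i A
  tm_left (i : ℕ) (a : X.Tm i) : HasTm h i a → HasTm g i a
  tm_right (j : ℕ) (δ : IncList (j + 1)) (b : δ.shapeTm ⟶ X) (p : Fin (m + 1 + 1)) (i : ℕ)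
    (a : X.Tm i) : HasTm ℓ j (⟨δ, b⟩ : Σ δ : IncList (j + 1), (δ.shapeTm ⟶ X)) →
    (p : ℕ) = j + 1 → β.toFun p = i + 1 → HasTm b i a → HasTm g i a

/-- A type-element `(α, ℓ)`, where `ℓ` consists of `(β, h)` and `k`, is sent to `(βα, h ∪ k)`; and
a term-element over it that is given by a term-element `a` of `X` is sent to the term-element over
`(βα, h ∪ k)` that is given by `a`. -/
structure IsIncMult (μ : incFunctor.{u} ⋙ incFunctor.{u} ⟶ incFunctor.{u}) : Prop where
  ty (X : TTS.{u}) (k : ℕ) (α : IncList (k + 1)) (ℓ : α.shape ⟶ incObj X) (m : ℕ)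
    (hm : α.top = m + 1) (β : IncList (m + 1)) (h : β.shape ⟶ X) :
    HasTy ℓ m (⟨β, h⟩ : Σ β : IncList (m + 1), (β.shape ⟶ X)) →
    ∃ g : (α.comp β hm).shape ⟶ X, IsUnion ℓ h hm g ∧
      TTS.onTy (μ.app X) k (⟨α, ℓ⟩ : Σ α : IncList (k + 1), (α.shape ⟶ incObj X)) =
        (⟨α.comp β hm, g⟩ : Σ α : IncList (k + 1), (α.shape ⟶ X))
  tm (X : TTS.{u}) (k : ℕ) (α : IncList (k + 1)) (ℓ : α.shapeTm ⟶ incObj X) (m : ℕ)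
    (hm : α.top = m + 1) (β : IncList (m + 1)) (b : β.shapeTm ⟶ X) :
    HasTm ℓ m (⟨β, b⟩ : Σ β : IncList (m + 1), (β.shapeTm ⟶ X)) →
    ∃ g : (α.comp β hm).shapeTm ⟶ X,
      (∀ (i : ℕ) (a : X.Tm i), i + 1 = β.top → HasTm b i a → HasTm g i a) ∧
      TTS.onTm (μ.app X) k (⟨α, ℓ⟩ : Σ α : IncList (k + 1), (α.shapeTm ⟶ incObj X)) =
        (⟨α.comp β hm, g⟩ : Σ α : IncList (k + 1), (α.shapeTm ⟶ X))

end SGAT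

/-! The free theory on `X` has one constant for each element of `X`, introduced in the context
formed by its iterated boundaries, and no equations. Only trivial equalities are then derivable
(`diagonal_of_derivable`), so congruent judgements coincide (`eq_of_eqv`), and all type and term
judgements come from the generators by substitution. An interpretation is thus determined up to `≡`
by the generators (`GAT.Interp.equivalent_of_gen`). Conversely, a map from `X` to the judgements of
a theory extends by replacing letters by expressions, once representatives with strictly matching
boundaries are chosen (`Assign.exists_toHom_eq`). This is the left adjoint.

Derivable judgements of the free theory have normal forms. Take a type-element of degree `m + 1`
with its context of `m` places and fill some places with terms. The term in a place is headed by a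
term-element of `X` over the type-element of that place, and its arguments are the contents of the
earlier places. So the data are a set of filled places and a map from a `shape` to `X`; the unfilled
places, together with `0` and `m + 1`, form an inc-list `α`, and the map restricts to `[α]`.
Substitution into a normal form fills one more place (`exists_fill`), hence everything derivable is
normal, and the expression displays all the data (`incTy_inj`, `incTm_inj`). This makes `incHom` an
isomorphism.

For the multiplication, an element of `incObj (incObj X)` amounts to `α`, `β` and a map `g` from
`[βα]` to `X` (`unfold`, `exists_unfold`), where `g` is the union of the two kinds of term-elements.
Translating the outer normal form by the inner ones yields the normal form of `g` (`argE_unfold`).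

Strong cartesianness is then formal. Degreewise the functor is a sum of representables, so it
preserves pullbacks and is local right adjoint. The unit has index `ι`, the multiplication sends
`(α, β, g)` to `(βα, g)`, and maps of `X` do not affect indices, so the naturality squares are
pullbacks. Uniqueness of adjoints transports everything to an arbitrary left adjoint. -/

namespace SGAT

/-! ## Simultaneous substitution and translation of expressions -/

section Bind

variable {W W' : Type u}

/-- Simultaneous substitution. -/
def Expr.bind : Expr W → (ℕ → Expr W) → Expr W
  | .var i, σ => σ i
  | .app w n args, σ => .app w n fun i => (args i).bind σ

/-- The simultaneous substitution that corresponds to `Expr.subst`. -/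
def substFun (m : ℕ) (t : Expr W) (i : ℕ) : Expr W :=
  if i < m then .var i else if i = m then t else .var (i - 1)

theorem Expr.subst_eq_bind (e : Expr W) (m : ℕ) (t : Expr W) :
    e.subst m t = e.bind (substFun m t) := by
  induction e with
  | var i => rfl
  | app w n args ih => simp only [Expr.subst, Expr.bind, ih]

theorem Expr.bind_bind (e : Expr W) (σ τ : ℕ → Expr W) :
    (e.bind σ).bind τ = e.bind fun i => (σ i).bind τ := by
  induction e with
  | var i => rfl
  | app w n args ih => simp only [Expr.bind, ih]

/-- All variables of the expression are among the first `n`. -/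
def Expr.Scoped : Expr W → ℕ → Prop
  | .var i, n => i < n
  | .app _ _ args, n => ∀ i, (args i).Scoped n

theorem Expr.Scoped.mono {e : Expr W} {m n : ℕ} (h : e.Scoped m) (hmn : m ≤ n) : e.Scoped n := by
  induction e with
  | var i => exact lt_of_lt_of_le h hmn
  | app w k args ih => exact fun i => ih i (h i)

theorem Expr.Scoped.bind_congr {e : Expr W} {n : ℕ} (h : e.Scoped n) {σ τ : ℕ → Expr W}
    (hστ : ∀ i < n, σ i = τ i) : e.bind σ = e.bind τ := by
  induction e with
  | var i => exact hστ i h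
  | app w k args ih => simp only [Expr.bind]; congr 1; funext i; exact ih i (h i)

theorem Expr.bind_var (e : Expr W) : e.bind .var = e := by
  induction e with
  | var i => rfl
  | app w k args ih => simp only [Expr.bind, ih]

theorem Expr.Scoped.bind_eq_self {e : Expr W} {n : ℕ} (h : e.Scoped n) {σ : ℕ → Expr W}
    (hσ : ∀ i < n, σ i = .var i) : e.bind σ = e :=
  (h.bind_congr hσ).trans e.bind_var

theorem Expr.Scoped.bind {e : Expr W} {m n : ℕ} (h : e.Scoped m) {σ : ℕ → Expr W}
    (hσ : ∀ i < m, (σ i).Scoped n) : (e.bind σ).Scoped n := by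
  induction e with
  | var i => exact hσ i h
  | app w k args ih => exact fun i => ih i (h i)

theorem Expr.Scoped.subst {e : Expr W} {m n : ℕ} (h : e.Scoped (m + n + 1)) {t : Expr W}
    (ht : t.Scoped m) : (e.subst m t).Scoped (m + n) := by
  rw [Expr.subst_eq_bind]
  refine h.bind fun i hi => ?_
  unfold substFun
  split_ifs with h1 h2
  · exact lt_of_lt_of_le h1 (Nat.le_add_right _ _)
  · exact ht.mono (Nat.le_add_right _ _)
  · change i - 1 < m + n
    omega

/-- Replacement of the letters `w` by expressions `τ w`; missing arguments are replaced by `d`. -/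
def Expr.tr : Expr W → (W → Expr W') → Expr W' → Expr W'
  | .var i, _, _ => .var i
  | .app w n args, τ, d => (τ w).bind fun i => if h : i < n then (args ⟨i, h⟩).tr τ d else d

/-- The default `d` has to be closed: one side inserts it after the substitution for the variables,
the other before. -/
theorem Expr.tr_bind (τ : W → Expr W') {d : Expr W'} (hd : d.Scoped 0) (e : Expr W)
    (σ : ℕ → Expr W) : (e.bind σ).tr τ d = (e.tr τ d).bind fun i => (σ i).tr τ d := by
  induction e with
  | var i => rfl
  | app w n args ih =>
    simp only [Expr.bind, Expr.tr, Expr.bind_bind]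
    congr 1
    funext i
    split_ifs with h
    · exact ih _
    · exact (hd.bind_eq_self fun i hi => absurd hi (Nat.not_lt_zero i)).symm

theorem Expr.tr_subst (τ : W → Expr W') {d : Expr W'} (hd : d.Scoped 0) (e : Expr W) (m : ℕ)
    (t : Expr W) : (e.subst m t).tr τ d = (e.tr τ d).subst m (t.tr τ d) := by
  rw [Expr.subst_eq_bind, Expr.tr_bind τ hd, Expr.subst_eq_bind]
  congr 1
  funext i
  unfold substFun
  split_ifs <;> rfl

def Assertion.tr (τ : W → Expr W') (d : Expr W') : Assertion W → Assertion W'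
  | .ty T => .ty (T.tr τ d)
  | .tm t T => .tm (t.tr τ d) (T.tr τ d)
  | .tyEq T T' => .tyEq (T.tr τ d) (T'.tr τ d)
  | .tmEq t t' T => .tmEq (t.tr τ d) (t'.tr τ d) (T.tr τ d)

def Judgement.tr (τ : W → Expr W') (d : Expr W') (J : Judgement W) : Judgement W' :=
  ⟨J.ctx.map (Expr.tr · τ d), J.asn.tr τ d⟩

theorem Assertion.tr_kind (τ : W → Expr W') (d : Expr W') (a : Assertion W) :
    (a.tr τ d).kind = a.kind := by
  cases a <;> rfl

theorem Assertion.tr_subst (τ : W → Expr W') {d : Expr W'} (hd : d.Scoped 0) (a : Assertion W)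
    (m : ℕ) (t : Expr W) : (a.subst m t).tr τ d = (a.tr τ d).subst m (t.tr τ d) := by
  cases a <;> simp [Assertion.subst, Assertion.tr, Expr.tr_subst τ hd]

theorem substCtx_tr (τ : W → Expr W') {d : Expr W'} (hd : d.Scoped 0) (Δ : Ctx W)
    (m : ℕ) (t : Expr W) :
    (substCtx m t Δ).map (Expr.tr · τ d) = substCtx m (t.tr τ d) (Δ.map (Expr.tr · τ d)) := by
  simp [substCtx, Expr.tr_subst τ hd]

theorem Judgement.boundary_tr (τ : W → Expr W') (d : Expr W') (J : Judgement W) :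
    (J.tr τ d).boundary = J.boundary.map (Judgement.tr τ d) := by
  obtain ⟨Γ, a⟩ := J
  cases a with
  | ty T =>
    rcases List.eq_nil_or_concat Γ with rfl | ⟨Γ, S, rfl⟩
    · rfl
    · simp [Judgement.tr, Assertion.tr, boundary_concat]
  | _ => rfl

/-- The rules are built from concatenation of contexts and substitution. Translation commutes with
both and keeps the length of a context, hence also the index of the variable that is substituted. -/
theorem Rule.tr (τ : W → Expr W') {d : Expr W'} (hd : d.Scoped 0) {r : RuleName}
    {Js : List (Judgement W)} {J : Judgement W} (h : Rule r Js J) :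
    Rule r (Js.map (Judgement.tr τ d)) (J.tr τ d) := by
  cases h with
  | subst Γ Δ t T a =>
    have := Rule.subst (Γ.map (Expr.tr · τ d)) (Δ.map (Expr.tr · τ d)) (t.tr τ d) (T.tr τ d)
      (a.tr τ d)
    rw [List.length_map, ← Assertion.tr_subst τ hd, ← substCtx_tr τ hd] at this
    have hsimp : (Assertion.tm t T).tr τ d = .tm (t.tr τ d) (T.tr τ d) := rfl
    simpa [Judgement.tr, hsimp] using this
  | substTyEq Γ Δ t₁ t₂ T T' =>
    have := Rule.substTyEq (Γ.map (Expr.tr · τ d)) (Δ.map (Expr.tr · τ d)) (t₁.tr τ d) (t₂.tr τ d)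
      (T.tr τ d) (T'.tr τ d)
    simpa [Judgement.tr, Assertion.tr, substCtx_tr τ hd, Expr.tr_subst τ hd] using this
  | substTmEq Γ Δ t₁ t₂ T t' T' =>
    have := Rule.substTmEq (Γ.map (Expr.tr · τ d)) (Δ.map (Expr.tr · τ d)) (t₁.tr τ d) (t₂.tr τ d)
      (T.tr τ d) (t'.tr τ d) (T'.tr τ d)
    simpa [Judgement.tr, Assertion.tr, substCtx_tr τ hd, Expr.tr_subst τ hd] using this
  | ctxConv Γ Δ T₁ T₂ a =>
    have := Rule.ctxConv (Γ.map (Expr.tr · τ d)) (Δ.map (Expr.tr · τ d)) (T₁.tr τ d) (T₂.tr τ d)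
      (a.tr τ d)
    simpa [Judgement.tr, Assertion.tr] using this
  | tmRefl => exact .tmRefl ..
  | tmSymm => exact .tmSymm ..
  | tmTrans => exact .tmTrans ..
  | tyRefl => exact .tyRefl ..
  | tySymm => exact .tySymm ..
  | tyTrans => exact .tyTrans ..
  | tmConv => exact .tmConv ..
  | tmEqConv => exact .tmEqConv ..

end Bind

/-! ## Derivability in a theory -/

section Facts

variable {W : Type u} {Λ : Set (Judgement W)}

theorem CtxEq.length_eq {Γ Γ' : Ctx W} (h : CtxEq Λ Γ Γ') : Γ.length = Γ'.length := by
  induction h with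
  | nil => rfl
  | concat Γ Γ' T T' _ _ ih => simp [ih]

theorem CtxEq.symm {Γ Γ' : Ctx W} (h : CtxEq Λ Γ Γ') : CtxEq Λ Γ' Γ := by
  induction h with
  | nil => exact .nil
  | concat Γ Γ' T T' h hT ih =>
    exact .concat _ _ _ _ ih (ih.conv' (Derivable.rule₁ (Rule.tySymm _ _ _) hT))

theorem CtxEq.trans {Γ Γ' Γ'' : Ctx W} (h : CtxEq Λ Γ Γ') (h' : CtxEq Λ Γ' Γ'') :
    CtxEq Λ Γ Γ'' := by
  induction h generalizing Γ'' with
  | nil => exact h'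
  | concat Γ Γ' T T' h hT ih =>
    generalize hx : Γ' ++ [T'] = x at h'
    cases h' with
    | nil => simp at hx
    | concat Δ Γ'' R T'' h1 h2 =>
      obtain ⟨rfl, e⟩ := List.append_inj' hx rfl
      simp only [List.cons.injEq, and_true] at e
      subst e
      exact .concat _ _ _ _ (ih h1) (Derivable.rule₂ (Rule.tyTrans _ _ _ _) hT (h.conv' h2))

/-- Equal terms substituted in equal contexts and types yield equal contexts and types. -/
theorem tyEq_subst {Γ Δ : Ctx W} {t₁ t₂ T S₁ S₂ : Expr W} (ht : Derivable Λ ⟨Γ, .tmEq t₁ t₂ T⟩)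
    (hS : Derivable Λ ⟨Γ ++ T :: Δ, .tyEq S₁ S₂⟩) :
    Derivable Λ ⟨Γ ++ substCtx Γ.length t₁ Δ,
      .tyEq (S₁.subst Γ.length t₁) (S₂.subst Γ.length t₂)⟩ := by
  have h₁ := ht.presup.1 ⟨Γ, .tm t₁ T⟩ (by simp [Judgement.boundary])
  have h₂ := hS.presup.1 ⟨Γ ++ T :: Δ, .ty S₂⟩ (by simp [Judgement.boundary])
  exact Derivable.rule₂ (Rule.tyTrans _ _ _ _) (Derivable.rule₂ (Rule.subst Γ Δ t₁ T _) h₁ hS)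
    ((CtxEq.subst hS.presup.2 ht).symm.conv'
      (Derivable.rule₂ (Rule.substTyEq Γ Δ t₁ t₂ T S₂) ht h₂))

/-- Transitivity through `s₂[t₁]`. The second equality, `s₂[t₁] = s₂[t₂]`, is delivered by the rule
in the context and type with `t₂` and is converted back to those with `t₁`. -/
theorem tmEq_subst {Γ Δ : Ctx W} {t₁ t₂ T s₁ s₂ S : Expr W} (ht : Derivable Λ ⟨Γ, .tmEq t₁ t₂ T⟩)
    (hS : Derivable Λ ⟨Γ ++ T :: Δ, .tmEq s₁ s₂ S⟩) :
    Derivable Λ ⟨Γ ++ substCtx Γ.length t₁ Δ,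
      .tmEq (s₁.subst Γ.length t₁) (s₂.subst Γ.length t₂) (S.subst Γ.length t₁)⟩ := by
  have h₁ := ht.presup.1 ⟨Γ, .tm t₁ T⟩ (by simp [Judgement.boundary])
  have h₂ := hS.presup.1 ⟨Γ ++ T :: Δ, .tm s₂ S⟩ (by simp [Judgement.boundary])
  have hS' := h₂.presup.1 ⟨Γ ++ T :: Δ, .ty S⟩ (by simp [Judgement.boundary])
  have hc := (CtxEq.subst hS.presup.2 ht).symm
  exact Derivable.rule₂ (Rule.tmTrans _ _ _ _ _) (Derivable.rule₂ (Rule.subst Γ Δ t₁ T _) h₁ hS)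
    (Derivable.rule₂ (Rule.tmEqConv _ _ _ _ _)
      (hc.conv' (Derivable.rule₁ (Rule.tySymm _ _ _)
        (Derivable.rule₂ (Rule.substTyEq Γ Δ t₁ t₂ T S) ht hS')))
      (hc.conv' (Derivable.rule₂ (Rule.substTmEq Γ Δ t₁ t₂ T s₂ S) ht h₂)))

/-- Equal contexts have equal lengths, so the parts behind `T` and `T'` can be taken apart from the
right in parallel. This serves as an induction principle for those parts. -/
theorem CtxEq.append_inv {Γ Γ' Δ Δ' : Ctx W} {T T' : Expr W} (hl : Γ.length = Γ'.length)
    (h : CtxEq Λ (Γ ++ T :: Δ) (Γ' ++ T' :: Δ')) (P : Ctx W → Ctx W → Prop)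
    (h0 : P [] [])
    (hs : ∀ Θ Θ' S S', P Θ Θ' → Derivable Λ ⟨Γ ++ T :: Θ, .tyEq S S'⟩ →
      P (Θ ++ [S]) (Θ' ++ [S'])) : P Δ Δ' := by
  induction Δ using List.reverseRecOn generalizing Δ' with
  | nil =>
    have := h.length_eq
    simp only [List.length_append, List.length_cons, List.length_nil] at this
    have : Δ' = [] := List.eq_nil_of_length_eq_zero (by omega)
    subst this
    exact h0
  | append_singleton Θ S ih =>
    rcases List.eq_nil_or_concat Δ' with rfl | ⟨Θ', S', rfl⟩
    · have := h.length_eq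
      simp only [List.length_append, List.length_cons, List.length_nil] at this
      omega
    · have h' : CtxEq Λ ((Γ ++ T :: Θ) ++ [S]) ((Γ' ++ T' :: Θ') ++ [S']) := by simpa using h
      rw [List.concat_eq_append]
      exact hs _ _ _ _ (ih h'.concat_inv.1) h'.concat_inv.2

theorem CtxEq.subst₂ {Γ Γ' Δ Δ' : Ctx W} {t t' T T' : Expr W} (hΓ : CtxEq Λ Γ Γ')
    (ht : Derivable Λ ⟨Γ, .tmEq t t' T⟩) (h : CtxEq Λ (Γ ++ T :: Δ) (Γ' ++ T' :: Δ')) :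
    CtxEq Λ (Γ ++ substCtx Γ.length t Δ) (Γ' ++ substCtx Γ.length t' Δ') := by
  refine h.append_inv hΓ.length_eq
    (fun Δ Δ' => CtxEq Λ (Γ ++ substCtx Γ.length t Δ) (Γ' ++ substCtx Γ.length t' Δ')) ?_ ?_
  · simpa [substCtx] using hΓ
  · intro Θ Θ' S S' ih hS
    simpa [substCtx] using CtxEq.concat _ _ _ _ ih (tyEq_subst ht hS)

end Facts

namespace GAT

variable {𝕋 𝕌 : GAT.{u}}

theorem Eqv.refl (J : 𝕋.Derived) (hJ : J.1.asn.kind = .ty ∨ J.1.asn.kind = .tm) :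
    𝕋.Eqv J.1 J.1 := by
  obtain ⟨⟨Γ, a⟩, h⟩ := J
  have hp := h.presup
  cases a with
  | ty T => exact .ty _ _ _ _ (.refl hp.2) (Derivable.rule₁ (Rule.tyRefl _ _) h)
  | tm t T =>
    exact .tm _ _ _ _ _ _ (.refl hp.2)
      (Derivable.rule₁ (Rule.tyRefl _ _) (hp.1 _ (by simp [Judgement.boundary])))
      (Derivable.rule₁ (Rule.tmRefl _ _ _) h)
  | tyEq T T' => simp [Assertion.kind] at hJ
  | tmEq t t' T => simp [Assertion.kind] at hJ

theorem Eqv.symm {J J' : Judgement 𝕋.Alphabet} (h : 𝕋.Eqv J J') : 𝕋.Eqv J' J := by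
  cases h with
  | ty Γ Γ' T T' hΓ hT =>
    exact .ty _ _ _ _ hΓ.symm (hΓ.symm.conv' (Derivable.rule₁ (Rule.tySymm _ _ _) hT))
  | tm Γ Γ' t t' T T' hΓ hT ht =>
    refine .tm _ _ _ _ _ _ hΓ.symm (hΓ.symm.conv' (Derivable.rule₁ (Rule.tySymm _ _ _) hT))
      (hΓ.symm.conv' ?_)
    exact Derivable.rule₂ (Rule.tmEqConv _ _ _ _ _) hT (Derivable.rule₁ (Rule.tmSymm _ _ _ _) ht)

theorem Eqv.trans {J J' J'' : Judgement 𝕋.Alphabet} (h : 𝕋.Eqv J J') (h' : 𝕋.Eqv J' J'') :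
    𝕋.Eqv J J'' := by
  cases h with
  | ty Γ Γ' T T' hΓ hT =>
    cases h' with
    | ty _ Γ'' _ T'' hΓ' hT' =>
      exact .ty _ _ _ _ (hΓ.trans hΓ') (Derivable.rule₂ (Rule.tyTrans _ _ _ _) hT (hΓ.conv' hT'))
  | tm Γ Γ' t t' T T' hΓ hT ht =>
    cases h' with
    | tm _ Γ'' _ t'' _ T'' hΓ' hT' ht' =>
      refine .tm _ _ _ _ _ _ (hΓ.trans hΓ')
        (Derivable.rule₂ (Rule.tyTrans _ _ _ _) hT (hΓ.conv' hT')) ?_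
      exact Derivable.rule₂ (Rule.tmTrans _ _ _ _ _) ht
        (Derivable.rule₂ (Rule.tmEqConv _ _ _ _ _) (Derivable.rule₁ (Rule.tySymm _ _ _) hT)
          (hΓ.conv' ht'))

/-- Congruence is preserved by substitution. -/
theorem Eqv.subst {K K' L L' J J' : Judgement 𝕋.Alphabet} (hK : 𝕋.Eqv K K') (hL : 𝕋.Eqv L L')
    (hJ : Rule .subst [K, L] J) (hJ' : Rule .subst [K', L'] J') : 𝕋.Eqv J J' := by
  cases hJ with
  | subst Γ Δ t T a =>
    cases hJ' with
    | subst Γ' Δ' t' T' a' =>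
      cases hK with
      | tm _ _ _ _ _ _ hΓ hT ht =>
        have hl := hΓ.length_eq
        cases hL with
        | ty _ _ S S' hΘ hS =>
          rw [← hl]
          exact .ty _ _ _ _ (hΓ.subst₂ ht hΘ) (tyEq_subst ht hS)
        | tm _ _ s s' S S' hΘ hS hs =>
          rw [← hl]
          exact .tm _ _ _ _ _ _ (hΓ.subst₂ ht hΘ) (tyEq_subst ht hS) (tmEq_subst ht hs)

/-- Equality in a `Quot` is the equivalence relation generated by `≡`, and `≡` is already an
equivalence relation on derived type judgements. -/
theorem TyJudgement.eqv_of_mk_eq {k : ℕ} {J J' : 𝕋.TyJudgement k}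
    (h : (Quot.mk _ J : 𝕋.VTy k) = Quot.mk _ J') : 𝕋.Eqv J.1.1 J'.1.1 := by
  have h' := Quot.eqvGen_exact h
  clear h
  induction h' with
  | rel _ _ h => exact h
  | refl J => exact .refl _ (.inl J.2.1)
  | symm _ _ _ ih => exact ih.symm
  | trans _ _ _ _ _ ih1 ih2 => exact ih1.trans ih2

theorem TmJudgement.eqv_of_mk_eq {k : ℕ} {J J' : 𝕋.TmJudgement k}
    (h : (Quot.mk _ J : 𝕋.VTm k) = Quot.mk _ J') : 𝕋.Eqv J.1.1 J'.1.1 := by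
  have h' := Quot.eqvGen_exact h
  clear h
  induction h' with
  | rel _ _ h => exact h
  | refl J => exact .refl _ (.inr J.2.1)
  | symm _ _ _ ih => exact ih.symm
  | trans _ _ _ _ _ ih1 ih2 => exact ih1.trans ih2

/-- The alphabet of a theory with a derivable judgement is not empty. -/
theorem nonempty_alphabet {J : Judgement 𝕋.Alphabet} (h : Derivable 𝕋.basic J) :
    Nonempty 𝕋.Alphabet := by
  induction h with
  | basic J hJ _ ih =>
    obtain ⟨Γ, a⟩ := J
    cases a with
    | ty T => obtain ⟨A, -⟩ := 𝕋.of_kind_ty _ hJ rfl; exact ⟨.inl A⟩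
    | tm t T => obtain ⟨f, -⟩ := 𝕋.of_kind_tm _ hJ rfl; exact ⟨.inr f⟩
    | tyEq T T' => exact ih _ (List.mem_cons_self ..)
    | tmEq t t' T => exact ih _ (List.mem_cons_self ..)
  | rule r Js J hr _ ih => cases hr <;> exact ih _ (List.mem_cons_self ..)

end GAT

def Assertion.Scoped {W : Type u} : Assertion W → ℕ → Prop
  | .ty T, n => T.Scoped n
  | .tm t T, n => t.Scoped n ∧ T.Scoped n
  | .tyEq T T', n => T.Scoped n ∧ T'.Scoped n
  | .tmEq t t' T, n => t.Scoped n ∧ t'.Scoped n ∧ T.Scoped n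

theorem Assertion.Scoped.subst {W : Type u} {a : Assertion W} {m n : ℕ}
    (h : a.Scoped (m + n + 1)) {t : Expr W} (ht : t.Scoped m) : (a.subst m t).Scoped (m + n) := by
  cases a with
  | ty T => exact Expr.Scoped.subst h ht
  | tm t T => exact ⟨h.1.subst ht, h.2.subst ht⟩
  | tyEq T T' => exact ⟨h.1.subst ht, h.2.subst ht⟩
  | tmEq t t' T => exact ⟨h.1.subst ht, h.2.1.subst ht, h.2.2.subst ht⟩

/-- Only variables of the context occur in a derivable assertion. -/
theorem GAT.scoped {𝕋 : GAT.{u}} {J : Judgement 𝕋.Alphabet} (h : Derivable 𝕋.basic J) :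
    J.asn.Scoped J.ctx.length := by
  induction h with
  | basic J hJ _ ih =>
    obtain ⟨Γ, a⟩ := J
    cases a with
    | ty T =>
      -- A basic type judgement is a constant applied to exactly the variables of its context.
      obtain ⟨A, Γ', e⟩ := 𝕋.of_kind_ty _ hJ rfl
      cases e
      exact fun i => i.2
    | tm t T =>
      have := ih _ (List.mem_cons_self ..)
      obtain ⟨f, Γ', T', e⟩ := 𝕋.of_kind_tm _ hJ rfl
      cases e
      exact ⟨fun i => i.2, this⟩
    | tyEq T T' =>
      exact ⟨ih ⟨Γ, .ty T⟩ (by simp [Judgement.boundary]),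
        ih ⟨Γ, .ty T'⟩ (by simp [Judgement.boundary])⟩
    | tmEq t t' T =>
      have := ih ⟨Γ, .tm t T⟩ (by simp [Judgement.boundary])
      exact ⟨this.1, (ih ⟨Γ, .tm t' T⟩ (by simp [Judgement.boundary])).1, this.2⟩
  | rule r Js J hr _ ih =>
    cases hr with
    | tmRefl => have := ih _ (List.mem_cons_self ..); exact ⟨this.1, this.1, this.2⟩
    | tyRefl => have := ih _ (List.mem_cons_self ..); exact ⟨this, this⟩
    | tmSymm => have := ih _ (List.mem_cons_self ..); exact ⟨this.2.1, this.1, this.2.2⟩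
    | tySymm => have := ih _ (List.mem_cons_self ..); exact ⟨this.2, this.1⟩
    | tmTrans =>
      simp only [List.forall_mem_cons] at ih
      exact ⟨ih.1.1, ih.2.1.2⟩
    | tyTrans =>
      simp only [List.forall_mem_cons] at ih
      exact ⟨ih.1.1, ih.2.1.2⟩
    | tmConv =>
      simp only [List.forall_mem_cons] at ih
      exact ⟨ih.2.1.1, ih.1.2⟩
    | tmEqConv =>
      simp only [List.forall_mem_cons] at ih
      exact ⟨ih.2.1.1, ih.2.1.2.1, ih.1.2⟩
    | ctxConv Γ Δ T₁ T₂ a =>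
      simp only [List.forall_mem_cons] at ih
      simpa using ih.2.1
    | subst Γ Δ t T a =>
      simp only [List.forall_mem_cons] at ih
      have := Assertion.Scoped.subst (m := Γ.length) (n := Δ.length) (a := a)
        (by simpa [add_assoc] using ih.2.1) ih.1.1
      simpa [substCtx] using this
    | substTyEq Γ Δ t₁ t₂ T T' =>
      simp only [List.forall_mem_cons] at ih
      have h1 : T'.Scoped (Γ.length + Δ.length + 1) := by
        simpa [add_assoc, Assertion.Scoped] using ih.2.1
      simpa [substCtx, Assertion.Scoped] using And.intro (h1.subst ih.1.1) (h1.subst ih.1.2.1)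
    | substTmEq Γ Δ t₁ t₂ T t' T' =>
      simp only [List.forall_mem_cons] at ih
      have h1 : (Assertion.tm t' T').Scoped (Γ.length + Δ.length + 1) := by
        simpa [add_assoc] using ih.2.1
      have := (⟨h1.1.subst ih.1.1, h1.1.subst ih.1.2.1, h1.2.subst ih.1.2.1⟩ :
        (Assertion.tmEq (t'.subst Γ.length t₁) (t'.subst Γ.length t₂)
          (T'.subst Γ.length t₂)).Scoped (Γ.length + Δ.length))
      simpa [substCtx, Assertion.Scoped] using this


namespace GAT

variable {𝕋 𝕌 : GAT.{u}}

/-- The type judgement `Γ ⊢ T type`. -/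
def TyJudgement.of {k : ℕ} {Γ : Ctx 𝕋.Alphabet} {T : Expr 𝕋.Alphabet}
    (h : Derivable 𝕋.basic ⟨Γ, .ty T⟩) (hl : Γ.length = k) : 𝕋.TyJudgement k :=
  ⟨⟨_, h⟩, rfl, hl⟩

/-- The term judgement `Γ ⊢ t : T`. -/
def TmJudgement.of {k : ℕ} {Γ : Ctx 𝕋.Alphabet} {t T : Expr 𝕋.Alphabet}
    (h : Derivable 𝕋.basic ⟨Γ, .tm t T⟩) (hl : Γ.length = k) : 𝕋.TmJudgement k :=
  ⟨⟨_, h⟩, rfl, hl⟩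

theorem TyJudgement.exists_of {k : ℕ} (J : 𝕋.TyJudgement k) :
    ∃ (Γ : Ctx 𝕋.Alphabet) (T : Expr 𝕋.Alphabet) (h : Derivable 𝕋.basic ⟨Γ, .ty T⟩)
      (hl : Γ.length = k), J = .of h hl := by
  obtain ⟨⟨⟨Γ, a⟩, hJ⟩, hk, hl⟩ := J
  cases a <;> simp [Assertion.kind] at hk
  exact ⟨_, _, hJ, hl, rfl⟩

theorem TmJudgement.exists_of {k : ℕ} (J : 𝕋.TmJudgement k) :
    ∃ (Γ : Ctx 𝕋.Alphabet) (t T : Expr 𝕋.Alphabet) (h : Derivable 𝕋.basic ⟨Γ, .tm t T⟩)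
      (hl : Γ.length = k), J = .of h hl := by
  obtain ⟨⟨⟨Γ, a⟩, hJ⟩, hk, hl⟩ := J
  cases a <;> simp [Assertion.kind] at hk
  exact ⟨_, _, _, hJ, hl, rfl⟩

theorem _root_.SGAT.Derivable.last {W : Type u} {Λ : Set (Judgement W)} {Γ : Ctx W} {S : Expr W}
    {a : Assertion W} (h : Derivable Λ ⟨Γ ++ [S], a⟩) : Derivable Λ ⟨Γ, .ty S⟩ :=
  h.presup.2 Γ S [] rfl

theorem TyJudgement.boundary_of {k : ℕ} {Γ : Ctx 𝕋.Alphabet} {S T : Expr 𝕋.Alphabet}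
    (h : Derivable 𝕋.basic ⟨Γ ++ [S], .ty T⟩) (hl : (Γ ++ [S]).length = k + 1) :
    (TyJudgement.of h hl).boundary = .of h.last (by simpa using hl) := by
  obtain ⟨Γ', S', T', e, e'⟩ := (TyJudgement.of h hl).exists_eq
  apply Subtype.ext
  apply Subtype.ext
  rw [e']
  have e₁ : Γ ++ [S] = Γ' ++ [S'] := congrArg Judgement.ctx e
  obtain ⟨rfl, e₂⟩ := List.append_inj' e₁ rfl
  obtain rfl := List.singleton_inj.1 e₂
  rfl

theorem TmJudgement.boundary_of {k : ℕ} {Γ : Ctx 𝕋.Alphabet} {t T : Expr 𝕋.Alphabet}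
    (h : Derivable 𝕋.basic ⟨Γ, .tm t T⟩) (hl : Γ.length = k) :
    (TmJudgement.of h hl).boundary = .of (h.presup.1 _ (List.mem_singleton.2 rfl)) hl := rfl

/-- A type judgement is congruent to one with a prescribed boundary. -/
theorem TyJudgement.exists_lift {k : ℕ} (J : 𝕋.TyJudgement (k + 1)) (K : 𝕋.TyJudgement k)
    (h : 𝕋.Eqv K.1.1 J.boundary.1.1) :
    ∃ J' : 𝕋.TyJudgement (k + 1), (Quot.mk _ J' : 𝕋.VTy (k + 1)) = Quot.mk _ J ∧
      J'.boundary = K := by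
  obtain ⟨Γ, T, hJ, hl, rfl⟩ := J.exists_of
  rcases List.eq_nil_or_concat Γ with rfl | ⟨Γ, S, rfl⟩
  · simp at hl
  obtain ⟨Γ', S', hK, hl', rfl⟩ := K.exists_of
  revert hJ hl
  rw [List.concat_eq_append]
  intro hJ hl h
  rw [TyJudgement.boundary_of] at h
  cases h with
  | ty _ _ _ _ hΓ hS =>
    have hΓ' := CtxEq.concat _ _ _ _ hΓ hS
    have hJ' := hΓ'.conv' hJ
    refine ⟨.of hJ' (by simp [hl']), Quot.sound ?_, by rw [TyJudgement.boundary_of]⟩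
    exact .ty _ _ _ _ hΓ' (Derivable.rule₁ (Rule.tyRefl _ _) hJ')

/-- The term is moved to the prescribed context by conversion of contexts, then to the prescribed
type by `tmConv`. -/
theorem TmJudgement.exists_lift {k : ℕ} (J : 𝕋.TmJudgement k) (K : 𝕋.TyJudgement k)
    (h : 𝕋.Eqv K.1.1 J.boundary.1.1) :
    ∃ J' : 𝕋.TmJudgement k, (Quot.mk _ J' : 𝕋.VTm k) = Quot.mk _ J ∧ J'.boundary = K := by
  obtain ⟨Γ, t, T, hJ, hl, rfl⟩ := J.exists_of
  obtain ⟨Γ', S', hK, hl', rfl⟩ := K.exists_of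
  rw [TmJudgement.boundary_of] at h
  cases h with
  | ty _ _ _ _ hΓ hS =>
    have hJ' := Derivable.rule₂ (Rule.tmConv _ _ _ _) (Derivable.rule₁ (Rule.tySymm _ _ _) hS)
      (hΓ.conv' hJ)
    refine ⟨.of hJ' hl', Quot.sound ?_, rfl⟩
    exact .tm _ _ _ _ _ _ hΓ hS (Derivable.rule₁ (Rule.tmRefl _ _ _) hJ')

end GAT

/-! ## Free theories -/

/-- The context of the type given by a type-element `A`, if the types in it are given by `ty`. -/
def teleCtx {W : Type u} (X : TTS.{u}) (ty : ∀ k, X.Ty k → Expr W) : ∀ k, X.Ty k → Ctx W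
  | 0, _ => []
  | k + 1, A => teleCtx X ty k (X.bd k A) ++ [ty k (X.bd k A)]

theorem length_teleCtx {W : Type u} (X : TTS.{u}) (ty : ∀ k, X.Ty k → Expr W) (k : ℕ)
    (A : X.Ty k) : (teleCtx X ty k A).length = k := by
  induction k with
  | zero => rfl
  | succ k ih => simp [teleCtx, ih]

theorem teleCtx_map {W W' : Type u} (X : TTS.{u}) (ty : ∀ k, X.Ty k → Expr W)
    (ty' : ∀ k, X.Ty k → Expr W') (f : Expr W → Expr W') (h : ∀ k A, f (ty k A) = ty' k A)
    (k : ℕ) (A : X.Ty k) : (teleCtx X ty k A).map f = teleCtx X ty' k A := by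
  induction k with
  | zero => rfl
  | succ k ih => simp [teleCtx, ih, h]

/-- The letter `w` applied to the first `n` variables. -/
def applyVars {W : Type u} (w : W) (n : ℕ) : Expr W := .app w n fun i => .var i

/-- The letters of the free theory. -/
abbrev Letter (X : TTS.{u}) : Type u := (Σ k, X.Ty k) ⊕ (Σ k, X.Tm k)

abbrev genTy (X : TTS.{u}) (k : ℕ) (A : X.Ty k) : Expr (Letter X) := applyVars (.inl ⟨k, A⟩) k

abbrev genTm (X : TTS.{u}) (k : ℕ) (a : X.Tm k) : Expr (Letter X) := applyVars (.inr ⟨k, a⟩) k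

/-- The basic judgements of the free theory. -/
inductive FreeBasic (X : TTS.{u}) : Judgement (Letter X) → Prop
  | ty (k : ℕ) (A : X.Ty k) : FreeBasic X ⟨teleCtx X (genTy X) k A, .ty (genTy X k A)⟩
  | tm (k : ℕ) (a : X.Tm k) : FreeBasic X
      ⟨teleCtx X (genTy X) k (X.bdTm k a), .tm (genTm X k a) (genTy X k (X.bdTm k a))⟩

/-- The set of basic judgements of the free theory. -/
abbrev freeBasic (X : TTS.{u}) : Set (Judgement (Letter X)) := {J | FreeBasic X J}

/-- The boundary of the generator of `A` is the generator of the boundary of `A`, so induction on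
the degree provides what `Derivable.basic` demands. -/
theorem derivable_genTy (X : TTS.{u}) (k : ℕ) (A : X.Ty k) :
    Derivable (freeBasic X) ⟨teleCtx X (genTy X) k A, .ty (genTy X k A)⟩ := by
  induction k with
  | zero => exact .basic _ (.ty 0 A) (by simp [teleCtx, Judgement.boundary])
  | succ k ih =>
    refine .basic _ (.ty (k + 1) A) fun K hK => ?_
    rw [teleCtx, boundary_concat, List.mem_singleton] at hK
    rw [hK]
    exact ih _

theorem derivable_genTm (X : TTS.{u}) (k : ℕ) (a : X.Tm k) :
    Derivable (freeBasic X)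
      ⟨teleCtx X (genTy X) k (X.bdTm k a), .tm (genTm X k a) (genTy X k (X.bdTm k a))⟩ := by
  refine .basic _ (.tm k a) fun K hK => ?_
  rw [List.mem_singleton.1 hK]
  exact derivable_genTy X k _

/-- The free theory on a type-and-term structure. -/
abbrev freeGAT (X : TTS.{u}) : GAT.{u} where
  TyConst := Σ k, X.Ty k
  TmConst := Σ k, X.Tm k
  basic := freeBasic X
  existsUnique_ty := by
    rintro ⟨k, A⟩
    refine ⟨_, ⟨.ty k A, teleCtx X (genTy X) k A, by rw [length_teleCtx]; rfl⟩, ?_⟩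
    rintro J ⟨hJ, Γ, rfl⟩
    generalize hx : (⟨Γ, _⟩ : Judgement (Letter X)) = x at hJ
    cases hJ with
    | ty k' A' =>
      simp only [applyVars, Judgement.mk.injEq, Assertion.ty.injEq, Expr.app.injEq,
        Sum.inl.injEq] at hx
      obtain ⟨-, h, -⟩ := hx
      cases h
      rfl
    | tm => simp at hx
  existsUnique_tm := by
    rintro ⟨k, a⟩
    refine ⟨_, ⟨.tm k a, teleCtx X (genTy X) k (X.bdTm k a), genTy X k (X.bdTm k a),
      by rw [length_teleCtx]; rfl⟩, ?_⟩
    rintro J ⟨hJ, Γ, T, rfl⟩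
    generalize hx : (⟨Γ, _⟩ : Judgement (Letter X)) = x at hJ
    cases hJ with
    | tm k' a' =>
      simp only [applyVars, Judgement.mk.injEq, Assertion.tm.injEq, Expr.app.injEq,
        Sum.inr.injEq] at hx
      obtain ⟨-, ⟨h, -⟩, -⟩ := hx
      cases h
      rfl
    | ty => simp at hx
  of_kind_ty := by
    rintro J (⟨k, A⟩ | ⟨k, a⟩) h
    · exact ⟨⟨k, A⟩, teleCtx X (genTy X) k A, by rw [length_teleCtx]; rfl⟩
    · cases h
  of_kind_tm := by
    rintro J (⟨k, A⟩ | ⟨k, a⟩) h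
    · cases h
    · exact ⟨⟨k, a⟩, teleCtx X (genTy X) k (X.bdTm k a), _, by rw [length_teleCtx]; rfl⟩
  derivable_of_basic := by
    rintro J (⟨k, A⟩ | ⟨k, a⟩)
    · exact derivable_genTy X k A
    · exact derivable_genTm X k a

/-- The two sides of an equality agree. -/
def Assertion.Diagonal {W : Type u} : Assertion W → Prop
  | .ty _ => True
  | .tm _ _ => True
  | .tyEq T T' => T = T'
  | .tmEq t t' _ => t = t'

/-- Only trivial equalities are derivable in the free theory. -/
theorem diagonal_of_derivable {X : TTS.{u}} {J : Judgement (Letter X)}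
    (h : Derivable (freeBasic X) J) : J.asn.Diagonal := by
  induction h with
  -- No basic judgement of the free theory is an equality.
  | basic J hJ => cases hJ <;> trivial
  | rule r Js J hr _ ih =>
    cases hr with
    | tmRefl => rfl
    | tyRefl => rfl
    | tmSymm => exact (ih _ (List.mem_cons_self ..)).symm
    | tySymm => exact (ih _ (List.mem_cons_self ..)).symm
    | tmTrans => simp only [List.forall_mem_cons] at ih; exact ih.1.trans ih.2.1
    | tyTrans => simp only [List.forall_mem_cons] at ih; exact ih.1.trans ih.2.1
    | tmConv => trivial
    | tmEqConv => simp only [List.forall_mem_cons] at ih; exact ih.2.1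
    | ctxConv => simp only [List.forall_mem_cons] at ih; exact ih.2.1
    | subst Γ Δ t T a =>
      simp only [List.forall_mem_cons] at ih
      have := ih.2.1
      cases a with
      | ty => trivial
      | tm => trivial
      | tyEq T T' => exact congrArg (fun e => e.subst Γ.length t) this
      | tmEq s s' T => exact congrArg (fun e => e.subst Γ.length t) this
    | substTyEq Γ Δ t₁ t₂ T T' =>
      simp only [List.forall_mem_cons] at ih
      exact congrArg (T'.subst Γ.length) ih.1
    | substTmEq Γ Δ t₁ t₂ T t' T' =>
      simp only [List.forall_mem_cons] at ih
      exact congrArg (t'.subst Γ.length) ih.1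

/-! ## The universal property of free theories -/

/-- A compatible choice of type judgements and term judgements of a theory, one for each element
of a type-and-term structure. -/
structure Assign (X : TTS.{u}) (𝕌 : GAT.{u}) where
  ty : ∀ k, X.Ty k → Expr 𝕌.Alphabet
  tm : ∀ k, X.Tm k → Expr 𝕌.Alphabet
  derivable_ty : ∀ k A, Derivable 𝕌.basic ⟨teleCtx X ty k A, .ty (ty k A)⟩
  derivable_tm : ∀ k a, Derivable 𝕌.basic
    ⟨teleCtx X ty k (X.bdTm k a), .tm (tm k a) (ty k (X.bdTm k a))⟩

namespace Assign

variable {X : TTS.{u}} {𝕌 : GAT.{u}}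

/-- The map of type-and-term structures given by the classes of the judgements. -/
def toHom (a : Assign X 𝕌) : X ⟶ 𝕌.forgetObj :=
  TTS.homMk (X := X) (Y := 𝕌.forgetObj)
    (fun k A => Quot.mk _ (.of (a.derivable_ty k A) (length_teleCtx ..)))
    (fun k t => Quot.mk _ (.of (a.derivable_tm k t) (length_teleCtx ..)))
    (fun k A => congrArg (Quot.mk _)
      (GAT.TyJudgement.boundary_of (a.derivable_ty (k + 1) A) (length_teleCtx X a.ty _ A)).symm)
    (fun _ _ => rfl)

/-- The judgements by which the free theory is generated. -/
def gen (X : TTS.{u}) : Assign X (freeGAT X) where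
  ty := genTy X
  tm := genTm X
  derivable_ty := derivable_genTy X
  derivable_tm := derivable_genTm X

/-- The expressions by which the letters of the free theory are interpreted. -/
def letter (a : Assign X 𝕌) : Letter X → Expr 𝕌.Alphabet
  | .inl A => a.ty A.1 A.2
  | .inr t => a.tm t.1 t.2

open Classical in
/-- A closed expression. -/
noncomputable def _root_.SGAT.closedExpr (W : Type u) : Expr W :=
  if h : Nonempty W then .app h.some 0 Fin.elim0 else .var 0

theorem _root_.SGAT.closedExpr_scoped {W : Type u} (h : Nonempty W) : (closedExpr W).Scoped 0 := by
  rw [closedExpr, dif_pos h]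
  exact fun i => i.elim0

/-- A derived judgement of the free theory needs a letter, hence an element of `X`, to which `a`
assigns a derivable judgement of `𝕌`. This is what makes a closed default expression available. -/
theorem nonempty (a : Assign X 𝕌) (J : (freeGAT X).Derived) : Nonempty 𝕌.Alphabet := by
  obtain ⟨⟨k, A⟩ | ⟨k, t⟩⟩ := GAT.nonempty_alphabet J.2
  · exact GAT.nonempty_alphabet (a.derivable_ty k A)
  · exact GAT.nonempty_alphabet (a.derivable_tm k t)

/-- A generator is applied to the variables themselves, and by `GAT.scoped` only the first `k`
variables occur in `a.ty k A`; the default `d` is therefore never inserted. -/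
theorem tr_genTy (a : Assign X 𝕌) (d : Expr 𝕌.Alphabet) (k : ℕ) (A : X.Ty k) :
    (genTy X k A).tr a.letter d = a.ty k A := by
  have := GAT.scoped (a.derivable_ty k A)
  rw [length_teleCtx] at this
  refine Expr.Scoped.bind_eq_self (n := k) this fun i hi => ?_
  rw [dif_pos hi]
  rfl

theorem tr_genTm (a : Assign X 𝕌) (d : Expr 𝕌.Alphabet) (k : ℕ) (t : X.Tm k) :
    (genTm X k t).tr a.letter d = a.tm k t := by
  have := (GAT.scoped (a.derivable_tm k t)).1
  rw [length_teleCtx] at this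
  refine Expr.Scoped.bind_eq_self (n := k) this fun i hi => ?_
  rw [dif_pos hi]
  rfl

/-- Basic judgements go to the assigned ones, and instances of rules go to instances of rules. -/
theorem derivable_tr (a : Assign X 𝕌) {J : Judgement (freeGAT X).Alphabet}
    (h : Derivable (freeGAT X).basic J) :
    Derivable 𝕌.basic (J.tr a.letter (closedExpr 𝕌.Alphabet)) := by
  have hd := closedExpr_scoped (a.nonempty ⟨J, h⟩)
  induction h with
  | basic J hJ =>
    obtain ⟨k, A⟩ | ⟨k, t⟩ := hJ
    · simp only [Judgement.tr, Assertion.tr]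
      rw [teleCtx_map X _ a.ty _ (a.tr_genTy _), a.tr_genTy]
      exact a.derivable_ty k A
    · simp only [Judgement.tr, Assertion.tr]
      rw [teleCtx_map X _ a.ty _ (a.tr_genTy _), a.tr_genTy, a.tr_genTm]
      exact a.derivable_tm k t
  | rule r Js J hr _ ih =>
    refine .rule r _ _ (hr.tr a.letter hd) fun K hK => ?_
    obtain ⟨L, hL, rfl⟩ := List.mem_map.1 hK
    exact ih L hL

/-- The interpretation of the free theory. -/
noncomputable def interp (a : Assign X 𝕌) : GAT.Interp (freeGAT X) 𝕌 where
  toFun J := ⟨_, a.derivable_tr J.2⟩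
  kind J := Assertion.tr_kind ..
  boundary J := by
    apply List.map_injective_iff.2 Subtype.val_injective
    rw [GAT.Interp.val_boundary]
    refine (Judgement.boundary_tr ..).trans ?_
    rw [← GAT.Interp.val_boundary, List.map_map, List.map_map]
    rfl
  rule r Js J h := by
    have := h.tr a.letter (closedExpr_scoped (a.nonempty J))
    rw [List.map_map] at this
    rw [List.map_map]
    exact this

/-- The morphism of theories. -/
noncomputable def hom (a : Assign X 𝕌) : freeGAT X ⟶ 𝕌 := Quot.mk _ a.interp

theorem gen_hom (a : Assign X 𝕌) : (gen X).toHom ≫ GAT.forget.map a.hom = a.toHom := by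
  apply TTS.hom_ext
  · intro k A
    refine congrArg (Quot.mk _) (Subtype.ext (Subtype.ext ?_))
    change Judgement.mk _ _ = Judgement.mk _ _
    congr 1
    · exact teleCtx_map X _ a.ty _ (a.tr_genTy _) k A
    · exact congrArg _ (a.tr_genTy _ k A)
  · intro k t
    refine congrArg (Quot.mk _) (Subtype.ext (Subtype.ext ?_))
    change Judgement.mk _ _ = Judgement.mk _ _
    congr 1
    · exact teleCtx_map X _ a.ty _ (a.tr_genTy _) k _
    · exact congrArg₂ _ (a.tr_genTm _ k t) (a.tr_genTy _ k _)

/-- The map `f` gives only classes, whose boundaries match up to `≡`, whereas an `Assign` needs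
representatives whose boundaries match on the nose. They are chosen by recursion on the degree:
`exists_lift` replaces any representative by one over the boundary chosen before. -/
theorem exists_toHom_eq (f : X ⟶ 𝕌.forgetObj) : ∃ a : Assign X 𝕌, a.toHom = f := by
  obtain ⟨R, hR, hb⟩ : ∃ R : ∀ k, X.Ty k → 𝕌.TyJudgement k,
      (∀ k A, (Quot.mk _ (R k A) : 𝕌.VTy k) = TTS.onTy f k A) ∧
      ∀ k A, (R (k + 1) A).boundary = R k (X.bd k A) := by
    -- `F k` records only that the classes are right; compatibility with the previous degree is a
    -- property of the successor step, so that plain recursion suffices.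
    let F (k : ℕ) := {r : X.Ty k → 𝕌.TyJudgement k //
      ∀ A, (Quot.mk _ (r A) : 𝕌.VTy k) = TTS.onTy f k A}
    have step (k : ℕ) (r : F k) : ∃ r' : F (k + 1), ∀ A, (r'.1 A).boundary = r.1 (X.bd k A) := by
      have (A : X.Ty (k + 1)) : ∃ J : 𝕌.TyJudgement (k + 1),
          (Quot.mk _ J : 𝕌.VTy (k + 1)) = TTS.onTy f (k + 1) A ∧
            J.boundary = r.1 (X.bd k A) := by
        obtain ⟨J, hJ⟩ := Quot.exists_rep (TTS.onTy f (k + 1) A : 𝕌.VTy (k + 1))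
        obtain ⟨J', h1, h2⟩ := J.exists_lift (r.1 (X.bd k A)) (by
          apply GAT.TyJudgement.eqv_of_mk_eq
          rw [r.2, TTS.bd_onTy]
          exact (congrArg (𝕌.forgetObj.bd k) hJ).symm)
        exact ⟨J', h1.trans hJ, h2⟩
      choose r' h1 h2 using this
      exact ⟨⟨r', h1⟩, h2⟩
    choose next hnext using step
    have h0 (A : X.Ty 0) := Quot.exists_rep (TTS.onTy f 0 A : 𝕌.VTy 0)
    choose r0 hr0 using h0
    let S (k : ℕ) : F k := Nat.rec ⟨r0, hr0⟩ next k
    exact ⟨fun k => (S k).1, fun k => (S k).2, fun k A => hnext k (S k) A⟩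
  have hT (k : ℕ) (t : X.Tm k) : ∃ J : 𝕌.TmJudgement k,
      (Quot.mk _ J : 𝕌.VTm k) = TTS.onTm f k t ∧ J.boundary = R k (X.bdTm k t) := by
    obtain ⟨J, hJ⟩ := Quot.exists_rep (TTS.onTm f k t : 𝕌.VTm k)
    obtain ⟨J', h1, h2⟩ := J.exists_lift (R k (X.bdTm k t)) (by
      apply GAT.TyJudgement.eqv_of_mk_eq
      rw [hR, TTS.bdTm_onTm]
      exact (congrArg (𝕌.forgetObj.bdTm k) hJ).symm)
    exact ⟨J', h1.trans hJ, h2⟩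
  choose Q hQ hQb using hT
  choose Γ T hd hl e using fun k A => (R k A).exists_of
  choose Γ' t T' hd' hl' e' using fun k a => (Q k a).exists_of
  -- Since boundaries agree strictly, the context of each chosen judgement consists of the types
  -- chosen for its iterated boundaries.
  have hΓ (k : ℕ) (A : X.Ty k) : Γ k A = teleCtx X T k A := by
    induction k with
    | zero => exact List.eq_nil_of_length_eq_zero (hl 0 A)
    | succ k ih =>
      have h := hb k A
      obtain ⟨Θ, S, T₀, h1, h2⟩ := (R (k + 1) A).exists_eq
      rw [h, e] at h2
      rw [e] at h1
      simp only [GAT.TyJudgement.of, Judgement.mk.injEq, Assertion.ty.injEq] at h1 h2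
      rw [h1.1, teleCtx, ← ih, h2.1, h2.2]
  have hΓ' (k : ℕ) (a : X.Tm k) :
      Γ' k a = teleCtx X T k (X.bdTm k a) ∧ T' k a = T k (X.bdTm k a) := by
    have h := hQb k a
    rw [e', e] at h
    have h1 := congrArg (fun J => J.1.1) h
    simp only [GAT.TmJudgement.boundary_of, GAT.TyJudgement.of, Judgement.mk.injEq,
      Assertion.ty.injEq] at h1
    rw [← hΓ]
    exact h1
  refine ⟨⟨T, t, fun k A => by rw [← hΓ]; exact hd k A,
    fun k a => by rw [← (hΓ' k a).1, ← (hΓ' k a).2]; exact hd' k a⟩, ?_⟩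
  apply TTS.hom_ext
  · intro k A
    rw [← hR, e]
    refine congrArg (Quot.mk _) (Subtype.ext (Subtype.ext ?_))
    change Judgement.mk _ _ = Judgement.mk _ _
    rw [hΓ]
  · intro k a
    rw [← hQ, e']
    refine congrArg (Quot.mk _) (Subtype.ext (Subtype.ext ?_))
    change Judgement.mk _ _ = Judgement.mk _ _
    rw [(hΓ' k a).1, (hΓ' k a).2]

end Assign

/-- In the free theory all equalities are trivial, so a type or term judgement is built from
generators by substitution, apart from conversions that do nothing. Interpretations preserve
substitution, and substitution respects `≡` by `Eqv.subst`. -/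
theorem GAT.Interp.equivalent_of_gen {X : TTS.{u}} {𝕌 : GAT.{u}}
    (φ ψ : GAT.Interp (freeGAT X) 𝕌)
    (hty : ∀ k A, 𝕌.Eqv (φ.toFun ⟨_, derivable_genTy X k A⟩).1
      (ψ.toFun ⟨_, derivable_genTy X k A⟩).1)
    (htm : ∀ k a, 𝕌.Eqv (φ.toFun ⟨_, derivable_genTm X k a⟩).1
      (ψ.toFun ⟨_, derivable_genTm X k a⟩).1) : φ.Equivalent ψ := by
  rintro ⟨J, hJ⟩ hk
  dsimp only at hk
  induction hJ with
  | basic J hJ _ =>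
    cases hJ with
    | ty k A => exact hty k A
    | tm k a => exact htm k a
  | rule r Js J hr hJs ih =>
    cases hr with
    | tmRefl => simp [Assertion.kind] at hk
    | tyRefl => simp [Assertion.kind] at hk
    | tmSymm => simp [Assertion.kind] at hk
    | tySymm => simp [Assertion.kind] at hk
    | tmTrans => simp [Assertion.kind] at hk
    | tyTrans => simp [Assertion.kind] at hk
    | tmEqConv => simp [Assertion.kind] at hk
    | substTyEq => simp [Assertion.kind] at hk
    | substTmEq => simp [Assertion.kind] at hk
    | tmConv Γ t T₁ T₂ =>
      -- Conversion along a trivial equality returns its hypothesis.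
      obtain rfl : T₁ = T₂ := diagonal_of_derivable (hJs _ (List.mem_cons_self ..))
      exact ih _ (List.mem_cons_of_mem _ (List.mem_cons_self ..)) (.inr rfl)
    | ctxConv Γ Δ T₁ T₂ a =>
      obtain rfl : T₁ = T₂ := diagonal_of_derivable (hJs _ (List.mem_cons_self ..))
      exact ih _ (List.mem_cons_of_mem _ (List.mem_cons_self ..)) hk
    | subst Γ Δ t T a =>
      have h := Derivable.rule _ _ _ (Rule.subst Γ Δ t T a) hJs
      have h1 := List.mem_cons_self (a := (⟨Γ, .tm t T⟩ : Judgement (Letter X)))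
        (l := [⟨Γ ++ T :: Δ, a⟩])
      have h2 := List.mem_cons_of_mem (⟨Γ, .tm t T⟩ : Judgement (Letter X))
        (List.mem_cons_self (a := (⟨Γ ++ T :: Δ, a⟩ : Judgement (Letter X))) (l := []))
      have hk' : a.kind = .ty ∨ a.kind = .tm := by
        cases a <;> simp [Assertion.kind, Assertion.subst] at hk ⊢
      exact (ih _ h1 (.inr rfl)).subst (ih _ h2 hk')
        (φ.rule .subst [⟨_, hJs _ h1⟩, ⟨_, hJs _ h2⟩] ⟨_, h⟩ (Rule.subst Γ Δ t T a))
        (ψ.rule .subst [⟨_, hJs _ h1⟩, ⟨_, hJs _ h2⟩] ⟨_, h⟩ (Rule.subst Γ Δ t T a))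

/-- The unit at `X`. -/
abbrev freeUnit (X : TTS.{u}) : X ⟶ GAT.forget.obj (freeGAT X) := (Assign.gen X).toHom

theorem freeGAT_hom_ext {X : TTS.{u}} {𝕌 : GAT.{u}} {φ ψ : freeGAT X ⟶ 𝕌}
    (h : freeUnit X ≫ GAT.forget.map φ = freeUnit X ≫ GAT.forget.map ψ) : φ = ψ := by
  obtain ⟨φ, rfl⟩ := Quot.exists_rep φ
  obtain ⟨ψ, rfl⟩ := Quot.exists_rep ψ
  refine Quot.sound (GAT.Interp.equivalent_of_gen φ ψ (fun k A => ?_) (fun k a => ?_))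
  · exact GAT.TyJudgement.eqv_of_mk_eq (J := φ.onTy k (.of (derivable_genTy X k A)
      (length_teleCtx ..))) (congrArg (fun f => TTS.onTy f k A) h)
  · exact GAT.TmJudgement.eqv_of_mk_eq (J := φ.onTm k (.of (derivable_genTm X k a)
      (length_teleCtx ..))) (congrArg (fun f => TTS.onTm f k a) h)

/-- The universal property of the free theory. -/
noncomputable def freeEquiv (X : TTS.{u}) (𝕌 : GAT.{u}) :
    (freeGAT X ⟶ 𝕌) ≃ (X ⟶ GAT.forget.obj 𝕌) :=
  Equiv.ofBijective (fun φ => freeUnit X ≫ GAT.forget.map φ)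
    ⟨fun _ _ h => freeGAT_hom_ext h, fun f => by
      obtain ⟨a, rfl⟩ := Assign.exists_toHom_eq f
      exact ⟨a.hom, a.gen_hom⟩⟩

/-- The free theory functor is left adjoint to the forgetful functor. -/
noncomputable def freeAdj : Adjunction.leftAdjointOfEquiv (G := GAT.forget.{u}) freeEquiv
    (fun X _ _ g h => by
      change freeUnit X ≫ GAT.forget.map (h ≫ g) = (freeUnit X ≫ GAT.forget.map h) ≫ _
      rw [Functor.map_comp, Category.assoc]) ⊣ GAT.forget.{u} :=
  Adjunction.adjunctionOfEquivLeft _ _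

theorem freeAdj_unit_app (X : TTS.{u}) : freeAdj.unit.app X = freeUnit X := by
  change freeUnit X ≫ GAT.forget.map (𝟙 _) = _
  simp


/-! ## Normal forms of the derivable judgements of a free theory -/

section Shape

variable {X : TTS.{u}} {m : ℕ} {s : Set ℕ}

/-- The map out of a shape with given values. -/
def shapeHom (ty : ∀ i, i + 1 ≤ m → X.Ty i) (tm : ∀ i, i + 1 ≤ m ∧ i + 1 ∈ s → X.Tm i)
    (hty : ∀ i (hi : i + 2 ≤ m), X.bd i (ty (i + 1) hi) = ty i ((Nat.le_succ _).trans hi))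
    (htm : ∀ i hi, X.bdTm i (tm i hi) = ty i hi.1) : shape m s ⟶ X :=
  TTS.homMk (X := shape m s) (Y := X) (fun i x => ty i x.down.down) (fun i x => tm i x.down.down)
    (fun i x => (hty i x.down.down).symm) (fun i x => (htm i x.down.down).symm)

/-- The value at the type-element of degree `i + 1`. -/
def tyAt (h : shape m s ⟶ X) (i : ℕ) (hi : i + 1 ≤ m) : X.Ty i := TTS.onTy h i ⟨⟨hi⟩⟩

/-- The value at the term-element of degree `i + 1`. -/
def tmAt (h : shape m s ⟶ X) (i : ℕ) (hi : i + 1 ≤ m ∧ i + 1 ∈ s) : X.Tm i :=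
  TTS.onTm h i ⟨⟨hi⟩⟩

theorem tyAt_shapeHom {ty : ∀ i, i + 1 ≤ m → X.Ty i} {tm : ∀ i, i + 1 ≤ m ∧ i + 1 ∈ s → X.Tm i}
    {hty htm} (i hi) : tyAt (shapeHom ty tm hty htm) i hi = ty i hi := rfl

theorem tmAt_shapeHom {ty : ∀ i, i + 1 ≤ m → X.Ty i} {tm : ∀ i, i + 1 ≤ m ∧ i + 1 ∈ s → X.Tm i}
    {hty htm} (i hi) : tmAt (shapeHom ty tm hty htm) i hi = tm i hi := rfl

theorem bd_tyAt (h : shape m s ⟶ X) (i : ℕ) (hi : i + 2 ≤ m) :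
    X.bd i (tyAt h (i + 1) hi) = tyAt h i ((Nat.le_succ _).trans hi) :=
  (TTS.bd_onTy h i _).symm

theorem bdTm_tmAt (h : shape m s ⟶ X) (i : ℕ) (hi : i + 1 ≤ m ∧ i + 1 ∈ s) :
    X.bdTm i (tmAt h i hi) = tyAt h i hi.1 :=
  (TTS.bdTm_onTm h i _).symm

theorem shape_hom_ext {h h' : shape m s ⟶ X} (hty : ∀ i hi, tyAt h i hi = tyAt h' i hi)
    (htm : ∀ i hi, tmAt h i hi = tmAt h' i hi) : h = h' :=
  TTS.hom_ext (fun i x => hty i x.down.down) (fun i x => htm i x.down.down)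

theorem tyAt_incl {m' : ℕ} {s' : Set ℕ} (hm : m ≤ m') (hs : ∀ i ≤ m, i ∈ s → i ∈ s')
    (h : shape m' s' ⟶ X) (i : ℕ) (hi : i + 1 ≤ m) :
    tyAt (shapeIncl hm hs ≫ h) i hi = tyAt h i (hi.trans hm) := rfl

theorem tmAt_incl {m' : ℕ} {s' : Set ℕ} (hm : m ≤ m') (hs : ∀ i ≤ m, i ∈ s → i ∈ s')
    (h : shape m' s' ⟶ X) (i : ℕ) (hi : i + 1 ≤ m ∧ i + 1 ∈ s) :
    tmAt (shapeIncl hm hs ≫ h) i hi = tmAt h i ⟨hi.1.trans hm, hs _ hi.1 hi.2⟩ := rfl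

theorem tyAt_comp {Y : TTS.{u}} (h : shape m s ⟶ X) (f : X ⟶ Y) (i : ℕ) (hi : i + 1 ≤ m) :
    tyAt (h ≫ f) i hi = TTS.onTy f i (tyAt h i hi) := rfl

theorem tmAt_comp {Y : TTS.{u}} (h : shape m s ⟶ X) (f : X ⟶ Y) (i : ℕ)
    (hi : i + 1 ≤ m ∧ i + 1 ∈ s) : tmAt (h ≫ f) i hi = TTS.onTm f i (tmAt h i hi) := rfl

/-- The type-elements below the top one are its iterated boundaries, so only the top one has to be
compared. -/
theorem shape_hom_ext_top {h h' : shape m s ⟶ X} (k : ℕ) (hk : m = k + 1)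
    (hty : tyAt h k hk.ge = tyAt h' k hk.ge)
    (htm : ∀ i hi, tmAt h i hi = tmAt h' i hi) : h = h' := by
  subst hk
  refine shape_hom_ext (fun i hi => ?_) htm
  have hi' : i ≤ k := Nat.le_of_succ_le_succ hi
  clear htm
  induction k, hi' using Nat.le_induction with
  | base => exact hty
  | succ k hk ih =>
    have := congrArg (X.bd k) hty
    rw [bd_tyAt, bd_tyAt] at this
    exact ih (h := shapeIncl (Nat.le_succ _) (fun _ _ h => h) ≫ h)
      (h' := shapeIncl (Nat.le_succ _) (fun _ _ h => h) ≫ h') this (Nat.succ_le_succ hk)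

/-- Addition of a new last type-element. -/
theorem exists_extend_top (h : shape (m + 1) s ⟶ X) (hs : m + 2 ∉ s) (A : X.Ty (m + 1))
    (hA : X.bd m A = tyAt h m le_rfl) :
    ∃ h' : shape (m + 2) s ⟶ X, tyAt h' (m + 1) le_rfl = A ∧
      shapeIncl (Nat.le_succ _) (fun _ _ h => h) ≫ h' = h := by
  -- The values of `h` are kept and `A` is added on top. For a general `i` the degree is equal to `m
  -- + 1` only propositionally, hence the heterogeneous equality.
  have (i : ℕ) (hi : i + 1 ≤ m + 2) : ∃ B : X.Ty i, (∀ hi' : i + 1 ≤ m + 1, B = tyAt h i hi') ∧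
      (i = m + 1 → HEq B A) := by
    by_cases hi' : i + 1 ≤ m + 1
    · exact ⟨tyAt h i hi', fun _ => rfl, fun e => by omega⟩
    · obtain rfl : i = m + 1 := by omega
      exact ⟨A, fun h => absurd h hi', fun _ => HEq.rfl⟩
  choose ty hty1 hty2 using this
  have htop : ty (m + 1) le_rfl = A := eq_of_heq (hty2 _ _ rfl)
  have hlow (i : ℕ) (hi : i + 1 ≤ m + 2 ∧ i + 1 ∈ s) : i + 1 ≤ m + 1 ∧ i + 1 ∈ s := by
    refine ⟨Nat.le_of_lt_succ (lt_of_le_of_ne hi.1 ?_), hi.2⟩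
    rintro e
    exact hs (by simpa [e] using hi.2)
  refine ⟨shapeHom ty (fun i hi => tmAt h i (hlow i hi)) (fun i hi => ?_) (fun i hi => ?_),
    htop, ?_⟩
  · rw [hty1 i _ (by omega)]
    by_cases hi' : i + 2 ≤ m + 1
    · rw [hty1 (i + 1) _ hi', bd_tyAt]
    · obtain rfl : i = m := by omega
      rw [htop, hA]
  · rw [bdTm_tmAt, hty1]
  · refine shape_hom_ext (fun i hi => ?_) (fun i hi => ?_)
    · rw [tyAt_incl, tyAt_shapeHom, hty1]
    · rw [tmAt_incl, tmAt_shapeHom]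

/-- Without term-elements the shape is the chain of boundaries of its top element; the map is built
upwards from the iterated boundaries of `A`. -/
theorem exists_shape_hom (k : ℕ) (A : X.Ty k) :
    ∃ h : shape (k + 1) ∅ ⟶ X, tyAt h k le_rfl = A := by
  induction k with
  | zero =>
    refine ⟨shapeHom (fun i hi => (Nat.le_zero.1 (Nat.le_of_succ_le_succ hi)) ▸ A)
      (fun i hi => hi.2.elim) (fun i hi => by omega) (fun i hi => hi.2.elim), rfl⟩
  | succ k ih =>
    obtain ⟨h, hh⟩ := ih (X.bd k A)
    obtain ⟨h', hh', -⟩ := exists_extend_top h (Set.notMem_empty _) A hh.symm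
    exact ⟨h', hh'⟩

/-- Addition of a new term-element. -/
theorem exists_extend_tm (h : shape m s ⟶ X) (p : ℕ) (hp : p + 1 ≤ m) (hps : p + 1 ∉ s)
    (a : X.Tm p) (ha : X.bdTm p a = tyAt h p hp) :
    ∃ h' : shape m (insert (p + 1) s) ⟶ X, tmAt h' p ⟨hp, Set.mem_insert _ _⟩ = a ∧
      shapeIncl le_rfl (fun _ _ h => Set.mem_insert_of_mem _ h) ≫ h' = h := by
  have (i : ℕ) (hi : i + 1 ≤ m ∧ i + 1 ∈ insert (p + 1) s) : ∃ b : X.Tm i,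
      X.bdTm i b = tyAt h i hi.1 ∧ (∀ hs : i + 1 ∈ s, b = tmAt h i ⟨hi.1, hs⟩) ∧
      (i = p → HEq b a) := by
    by_cases hs : i + 1 ∈ s
    · exact ⟨tmAt h i ⟨hi.1, hs⟩, bdTm_tmAt .., fun _ => rfl, fun e => absurd (e ▸ hs) hps⟩
    · obtain rfl : i = p := by simpa [hs] using hi.2
      exact ⟨a, ha, fun h => absurd h hs, fun _ => HEq.rfl⟩
  choose tm h1 h2 h3 using this
  refine ⟨shapeHom (fun i hi => tyAt h i hi) tm (fun i hi => bd_tyAt ..) h1,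
    eq_of_heq (h3 _ _ rfl), ?_⟩
  exact shape_hom_ext (fun i hi => rfl) (fun i hi => h2 i _ hi.2)

end Shape

/-! ### Counting the places that stay variables -/

section Count

open Classical in
/-- The number of `r < q` such that `r + 1 ∉ s`. -/
noncomputable def gapCount (s : Set ℕ) (q : ℕ) : ℕ := Nat.count (fun r => r + 1 ∉ s) q

variable {s : Set ℕ} {q r : ℕ}

theorem gapCount_zero : gapCount s 0 = 0 := by simp [gapCount]

theorem gapCount_succ_of_mem (h : q + 1 ∈ s) : gapCount s (q + 1) = gapCount s q := by
  simp [gapCount, Nat.count_succ, h]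

theorem gapCount_succ_of_notMem (h : q + 1 ∉ s) : gapCount s (q + 1) = gapCount s q + 1 := by
  simp [gapCount, Nat.count_succ, h]

theorem gapCount_mono (h : q ≤ r) : gapCount s q ≤ gapCount s r := by
  classical exact Nat.count_monotone _ h

theorem gapCount_lt (h : q < r) (hq : q + 1 ∉ s) : gapCount s q < gapCount s r := by
  have := gapCount_mono (s := s) (Nat.succ_le_of_lt h)
  rw [Nat.succ_eq_add_one, gapCount_succ_of_notMem hq] at this
  omega

theorem gapCount_congr {s' : Set ℕ} (h : ∀ r < q, r + 1 ∈ s ↔ r + 1 ∈ s') :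
    gapCount s q = gapCount s' q := by
  induction q with
  | zero => simp [gapCount_zero]
  | succ q ih =>
    have ih := ih fun r hr => h r (hr.trans (Nat.lt_succ_self q))
    have hq := h q (Nat.lt_succ_self q)
    by_cases hs : q + 1 ∈ s
    · rw [gapCount_succ_of_mem hs, gapCount_succ_of_mem (hq.1 hs), ih]
    · rw [gapCount_succ_of_notMem hs, gapCount_succ_of_notMem (fun h => hs (hq.2 h)), ih]

theorem gapCount_empty : gapCount ∅ q = q := by
  induction q with
  | zero => exact gapCount_zero
  | succ q ih => rw [gapCount_succ_of_notMem (Set.notMem_empty _), ih]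

theorem gapCount_insert_of_le {p : ℕ} (h : q ≤ p) : gapCount (insert (p + 1) s) q = gapCount s q :=
  gapCount_congr fun r hr => by
    have : r ≠ p := by omega
    simp [this]

/-- This is the renumbering that `Expr.subst` performs on the variables behind the substituted one.
-/
theorem gapCount_insert_of_lt {p : ℕ} (hp : p + 1 ∉ s) (h : p < q) :
    gapCount (insert (p + 1) s) q + 1 = gapCount s q := by
  induction q, h using Nat.le_induction with
  | base =>
    rw [Nat.succ_eq_add_one, gapCount_succ_of_mem (Set.mem_insert _ _),
      gapCount_succ_of_notMem hp, gapCount_insert_of_le le_rfl]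
  | succ q hq ih =>
    have hne : q ≠ p := by omega
    by_cases hs : q + 1 ∈ s
    · rw [gapCount_succ_of_mem hs, gapCount_succ_of_mem (Set.mem_insert_of_mem _ hs), ih]
    · rw [gapCount_succ_of_notMem hs, gapCount_succ_of_notMem (by simp [hne, hs]), ih]

end Count

/-! ### Normal forms as expressions -/

section Args

variable {X : TTS.{u}} {m : ℕ} {s : Set ℕ}

open Classical in
/-- The expression that is substituted for the variable `x_(q+1)`. -/
noncomputable def argE (h : shape m s ⟶ X) (q : ℕ) : Expr (Letter X) :=
  if hq : q + 1 ≤ m ∧ q + 1 ∈ s then .app (.inr ⟨q, tmAt h q hq⟩) q fun r => argE h r.1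
  else .var (gapCount s q)
termination_by q
decreasing_by exact r.2

/-- The type-element of degree `i + 1`, applied to its arguments. -/
noncomputable def tyE (h : shape m s ⟶ X) (i : ℕ) (hi : i + 1 ≤ m) : Expr (Letter X) :=
  .app (.inl ⟨i, tyAt h i hi⟩) i fun r => argE h r.1

open Classical in
/-- The context in degree `i + 1`. -/
noncomputable def ctxE (h : shape m s ⟶ X) : ℕ → Ctx (Letter X)
  | 0 => []
  | i + 1 => if hi : i + 1 ≤ m ∧ i + 1 ∉ s then ctxE h i ++ [tyE h i hi.1] else ctxE h i

variable (h : shape m s ⟶ X)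

theorem argE_of_mem {q : ℕ} (hq : q + 1 ≤ m ∧ q + 1 ∈ s) :
    argE h q = .app (.inr ⟨q, tmAt h q hq⟩) q fun r => argE h r.1 := by
  rw [argE, dif_pos hq]

theorem argE_of_notMem {q : ℕ} (hq : q + 1 ∉ s) : argE h q = .var (gapCount s q) := by
  rw [argE, dif_neg fun h => hq h.2]

theorem ctxE_succ_of_notMem {i : ℕ} (hi : i + 1 ≤ m) (hs : i + 1 ∉ s) :
    ctxE h (i + 1) = ctxE h i ++ [tyE h i hi] := by
  rw [ctxE, dif_pos ⟨hi, hs⟩]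

theorem ctxE_succ_of_mem {i : ℕ} (hs : i + 1 ∈ s) : ctxE h (i + 1) = ctxE h i := by
  rw [ctxE, dif_neg fun h => h.2 hs]

theorem length_ctxE (i : ℕ) (hi : i ≤ m) : (ctxE h i).length = gapCount s i := by
  induction i with
  | zero => simp [ctxE, gapCount_zero]
  | succ i ih =>
    by_cases hs : i + 1 ∈ s
    · rw [ctxE_succ_of_mem h hs, ih (by omega), gapCount_succ_of_mem hs]
    · rw [ctxE_succ_of_notMem h hi hs, List.length_append, ih (by omega),
        gapCount_succ_of_notMem hs]
      rfl

section Incl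

variable {m' : ℕ} {s' : Set ℕ} (hm : m ≤ m') (hs : ∀ i ≤ m, i ∈ s → i ∈ s') (h' : shape m' s' ⟶ X)

/-- The argument in place `q + 1` depends only on places up to `q + 1`. On these the two sets of
filled places agree, by `hs` in one direction and by `hq'` in the other. -/
theorem argE_incl (q : ℕ) (hq : q + 1 ≤ m) (hq' : ∀ r ≤ q, r + 1 ∈ s' → r + 1 ∈ s) :
    argE (shapeIncl hm hs ≫ h') q = argE h' q := by
  induction q using Nat.strong_induction_on with
  | _ q ih =>
    by_cases hqs : q + 1 ∈ s
    · rw [argE_of_mem _ ⟨hq, hqs⟩, argE_of_mem _ ⟨hq.trans hm, hs _ hq hqs⟩, tmAt_incl]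
      congr 1
      funext r
      exact ih r.1 r.2 (by omega) fun i hi => hq' i (by omega)
    · rw [argE_of_notMem _ hqs, argE_of_notMem _ fun h => hqs (hq' q le_rfl h)]
      congr 1
      exact gapCount_congr fun r hr => ⟨hs _ (by omega), hq' r hr.le⟩

theorem tyE_incl (i : ℕ) (hi : i + 1 ≤ m) (hi' : ∀ r < i, r + 1 ∈ s' → r + 1 ∈ s) :
    tyE (shapeIncl hm hs ≫ h') i hi = tyE h' i (hi.trans hm) := by
  rw [tyE, tyE, tyAt_incl]
  congr 1
  funext r
  exact argE_incl hm hs h' r.1 (by omega) fun j hj => hi' j (by omega)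

theorem ctxE_incl (i : ℕ) (hi : i ≤ m) (hi' : ∀ r < i, r + 1 ∈ s' → r + 1 ∈ s) :
    ctxE (shapeIncl hm hs ≫ h') i = ctxE h' i := by
  induction i with
  | zero => rfl
  | succ i ih =>
    have ih := ih (by omega) fun r hr => hi' r (by omega)
    by_cases his : i + 1 ∈ s
    · rw [ctxE_succ_of_mem _ his, ctxE_succ_of_mem _ (hs _ hi his), ih]
    · rw [ctxE_succ_of_notMem _ hi his,
        ctxE_succ_of_notMem _ (hi.trans hm) fun h => his (hi' i (by omega) h), ih,
        tyE_incl hm hs h' i hi fun r hr => hi' r (by omega)]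

end Incl

/-! ### Normal forms are derivable -/

/-- Substitution of the arguments for the first `i` variables. -/
noncomputable def instE (i : ℕ) (q : ℕ) : Expr (Letter X) :=
  if q < i then argE h q else .var (q - i + gapCount s i)

def Assertion.bind {W : Type u} : Assertion W → (ℕ → Expr W) → Assertion W
  | .ty T, σ => .ty (T.bind σ)
  | .tm t T, σ => .tm (t.bind σ) (T.bind σ)
  | .tyEq T T', σ => .tyEq (T.bind σ) (T'.bind σ)
  | .tmEq t t' T, σ => .tmEq (t.bind σ) (t'.bind σ) (T.bind σ)

theorem instE_zero : instE h 0 = Expr.var := by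
  funext q
  simp [instE, gapCount_zero]

/-- An unfilled place has as its argument the variable numbered `gapCount s i`, and this is where
`instE h i` sends the variable anyway. -/
theorem instE_succ_of_notMem {i : ℕ} (hi : i + 1 ∉ s) : instE h (i + 1) = instE h i := by
  funext q
  unfold instE
  rcases lt_trichotomy q i with hq | rfl | hq
  · rw [if_pos hq, if_pos (by omega)]
  · rw [if_pos (Nat.lt_succ_self q), if_neg (lt_irrefl q), argE_of_notMem h hi]
    simp
  · rw [if_neg (by omega), if_neg (by omega), gapCount_succ_of_notMem hi]
    congr 1
    omega

theorem applyVars_bind_instE (w : Letter X) (i : ℕ) :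
    (applyVars w i).bind (instE h i) = .app w i fun r => argE h r.1 := by
  simp only [applyVars, Expr.bind, instE, Fin.is_lt, if_true]

/-- The generator for the term-element in place `i + 1` is applied to the first `i` variables; once
these receive their arguments, it becomes the argument of place `i + 1`. -/
theorem subst_bind_instE {i : ℕ} (hi : i + 1 ≤ m ∧ i + 1 ∈ s) (e : Expr (Letter X)) :
    (e.subst i (genTm X i (tmAt h i hi))).bind (instE h i) = e.bind (instE h (i + 1)) := by
  rw [Expr.subst_eq_bind, Expr.bind_bind]
  congr 1
  funext q
  unfold substFun
  split_ifs with h1 h2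
  · simp only [Expr.bind, instE, h1, if_true]
    rw [if_pos (by omega)]
  · subst h2
    rw [applyVars_bind_instE, instE, if_pos (Nat.lt_succ_self q), argE_of_mem h hi]
  · simp only [Expr.bind, instE]
    rw [if_neg (by omega), if_neg (by omega), gapCount_succ_of_mem hi.2]
    congr 2
    omega

/-- The places are treated from right to left. The last type of the telescope is removed by
substituting a generator if its place is filled, and is otherwise handed over to `Δ`; this is why
`Δ` and `a` are general. One instance of the rule suffices for each filled place because the
generator lives in the telescope that is left. -/
theorem derivable_instE (i : ℕ) (hi : i + 1 ≤ m) (Δ : Ctx (Letter X)) (a : Assertion (Letter X))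
    (ha : Derivable (freeBasic X) ⟨teleCtx X (genTy X) i (tyAt h i hi) ++ Δ, a⟩) :
    Derivable (freeBasic X) ⟨ctxE h i ++ Δ.map (Expr.bind · (instE h i)), a.bind (instE h i)⟩ := by
  induction i generalizing Δ a with
  | zero =>
    have : a.bind Expr.var = a := by cases a <;> simp [Assertion.bind, Expr.bind_var]
    simpa [instE_zero, Expr.bind_var, this, ctxE, teleCtx] using ha
  | succ i ih =>
    rw [teleCtx, bd_tyAt, List.append_assoc, List.singleton_append] at ha
    by_cases hs : i + 1 ∈ s
    · have hi' : i + 1 ≤ m ∧ i + 1 ∈ s := ⟨(Nat.le_succ _).trans hi, hs⟩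
      have ht := derivable_genTm X i (tmAt h i hi')
      rw [bdTm_tmAt] at ht
      have := ih hi'.1 _ _ (Derivable.rule₂ (Rule.subst _ _ _ _ _) ht ha)
      rw [length_teleCtx] at this
      rw [ctxE_succ_of_mem h hs]
      have e1 : (a.subst i (genTm X i (tmAt h i hi'))).bind (instE h i) =
          a.bind (instE h (i + 1)) := by
        cases a <;> simp only [Assertion.bind, Assertion.subst, subst_bind_instE h hi']
      rw [e1] at this
      simpa [substCtx, Function.comp_def, subst_bind_instE h hi'] using this
    · have := ih ((Nat.le_succ _).trans hi) _ _ ha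
      rw [ctxE_succ_of_notMem h ((Nat.le_succ _).trans hi) hs, instE_succ_of_notMem h hs]
      rw [List.map_cons, applyVars_bind_instE] at this
      simpa [tyE] using this

theorem derivable_tyE (i : ℕ) (hi : i + 1 ≤ m) :
    Derivable (freeBasic X) ⟨ctxE h i, .ty (tyE h i hi)⟩ := by
  have := derivable_instE h i hi [] (.ty (genTy X i (tyAt h i hi)))
    (by simpa using derivable_genTy X i _)
  simpa [Assertion.bind, applyVars_bind_instE, tyE] using this

theorem derivable_tmE (i : ℕ) (hi : i + 1 ≤ m ∧ i + 1 ∈ s) :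
    Derivable (freeBasic X) ⟨ctxE h i, .tm (argE h i) (tyE h i hi.1)⟩ := by
  have := derivable_instE h i hi.1 [] (.tm (genTm X i (tmAt h i hi)) (genTy X i (tyAt h i hi.1)))
    (by simpa [bdTm_tmAt] using derivable_genTm X i (tmAt h i hi))
  simpa [Assertion.bind, applyVars_bind_instE, tyE, argE_of_mem h hi] using this

/-! ### Derivable judgements are normal forms -/

/-- Only unfilled places contribute a type to the context, so a splitting of the context before a
type singles out an unfilled place `p + 1`. -/
theorem ctxE_split (i : ℕ) (hi : i ≤ m) {Γ Δ : Ctx (Letter X)} {T : Expr (Letter X)}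
    (e : ctxE h i = Γ ++ T :: Δ) : ∃ (p : ℕ) (hp : p + 1 ≤ m), p < i ∧ p + 1 ∉ s ∧
      Γ = ctxE h p ∧ T = tyE h p hp := by
  induction i generalizing Δ with
  | zero => simp [ctxE] at e
  | succ i ih =>
    have hlt {Δ : Ctx (Letter X)} (e : ctxE h i = Γ ++ T :: Δ) := ih (by omega) e
    by_cases hs : i + 1 ∈ s
    · rw [ctxE_succ_of_mem h hs] at e
      obtain ⟨p, hp, hpi, hh⟩ := hlt e
      exact ⟨p, hp, by omega, hh⟩
    · rw [ctxE_succ_of_notMem h hi hs] at e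
      rcases List.eq_nil_or_concat Δ with rfl | ⟨Δ, S, rfl⟩
      · obtain ⟨e1, e2⟩ := List.append_inj' e rfl
        exact ⟨i, hi, Nat.lt_succ_self i, hs, e1.symm, (List.singleton_inj.1 e2).symm⟩
      · have e' : ctxE h i ++ [tyE h i hi] = (Γ ++ T :: Δ) ++ [S] := by simpa using e
        obtain ⟨p, hp, hpi, hh⟩ := hlt (List.append_inj' e' rfl).1
        exact ⟨p, hp, by omega, hh⟩

section Fill

variable (p : ℕ) (h' : shape m (insert (p + 1) s) ⟶ X)

/-- The inclusion that leaves out a term-element. -/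
abbrev leaveOut : shape.{u} m s ⟶ shape.{u} m (insert (p + 1) s) :=
  shapeIncl le_rfl fun _ _ h => Set.mem_insert_of_mem _ h

/-- Before place `p + 1` is filled, its variable has the number `gapCount s p`. Filling it amounts
to substituting its new content for that variable, recursively in all arguments. -/
theorem argE_fill (hp : p + 1 ≤ m) (hps : p + 1 ∉ s) (q : ℕ) (hq : q + 1 ≤ m) :
    argE h' q = (argE (leaveOut p ≫ h') q).subst (gapCount s p) (argE h' p) := by
  induction q using Nat.strong_induction_on with
  | _ q ih =>
    by_cases hs : q + 1 ∈ s
    · rw [argE_of_mem _ ⟨hq, hs⟩, argE_of_mem h' ⟨hq, Set.mem_insert_of_mem _ hs⟩]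
      simp only [Expr.subst, tmAt_incl]
      congr 1
      funext r
      exact ih r.1 r.2 (by omega)
    · rw [argE_of_notMem _ hs]
      unfold Expr.subst
      -- Variables of earlier places keep their numbers, that of place `p + 1` is replaced, and
      -- those of later places drop by one.
      rcases lt_trichotomy q p with hlt | rfl | hlt
      · rw [if_pos (gapCount_lt hlt hs), argE_of_notMem h' (by
          have : q ≠ p := by omega
          simp [hs, this]), gapCount_insert_of_le hlt.le]
      · rw [if_neg (lt_irrefl _), if_pos rfl]
      · have hc := gapCount_lt hlt hps
        rw [if_neg (by omega), if_neg (by omega), argE_of_notMem h' (by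
          have : q ≠ p := by omega
          simp [hs, this]), ← gapCount_insert_of_lt hps hlt]
        simp

theorem tyE_fill (hp : p + 1 ≤ m) (hps : p + 1 ∉ s) (i : ℕ) (hi : i + 1 ≤ m) :
    tyE h' i hi = (tyE (leaveOut p ≫ h') i hi).subst (gapCount s p) (argE h' p) := by
  simp only [tyE, Expr.subst]
  congr 1
  funext r
  exact argE_fill p h' hp hps r.1 (by omega)

/-- Filling place `p + 1` deletes its type from the context, leaves the types before it alone and
substitutes into those behind it. -/
theorem ctxE_fill (hp : p + 1 ≤ m) (hps : p + 1 ∉ s) (i : ℕ) (hi : i ≤ m) (hpi : p < i) {Δ : Ctx (Letter X)}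
    (e : ctxE (leaveOut p ≫ h') i = ctxE (leaveOut p ≫ h') p ++ tyE (leaveOut p ≫ h') p hp :: Δ) :
    ctxE h' i = ctxE (leaveOut p ≫ h') p ++ substCtx (gapCount s p) (argE h' p) Δ := by
  induction i, hpi using Nat.le_induction generalizing Δ with
  | base =>
    rw [Nat.succ_eq_add_one, ctxE_succ_of_notMem _ hp hps] at e
    have : Δ = [] := by simpa using e
    subst this
    rw [Nat.succ_eq_add_one, ctxE_succ_of_mem _ (Set.mem_insert _ _)]
    simp only [substCtx, List.map_nil, List.append_nil]
    exact (ctxE_incl _ _ h' p (by omega) fun r hr hrs => by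
      have : r ≠ p := by omega
      simpa [this] using hrs).symm
  | succ i hpi ih =>
    have hne : i ≠ p := by omega
    by_cases hs : i + 1 ∈ s
    · rw [ctxE_succ_of_mem _ hs] at e
      rw [ctxE_succ_of_mem _ (Set.mem_insert_of_mem _ hs)]
      exact ih (by omega) e
    · rw [ctxE_succ_of_notMem _ hi hs] at e
      rw [ctxE_succ_of_notMem _ hi (by simp [hs, hne])]
      rcases List.eq_nil_or_concat Δ with rfl | ⟨Δ, S, rfl⟩
      · have := congrArg List.length e
        simp only [List.length_append, List.length_cons, List.length_nil] at this
        rw [length_ctxE _ _ (by omega), length_ctxE _ _ (by omega)] at this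
        have := gapCount_lt hpi hps
        omega
      · have e' : ctxE (leaveOut p ≫ h') i ++ [tyE (leaveOut p ≫ h') i hi] =
            (ctxE (leaveOut p ≫ h') p ++ tyE (leaveOut p ≫ h') p hp :: Δ) ++ [S] := by simpa using e
        obtain ⟨e1, e2⟩ := List.append_inj' e' rfl
        rw [ih (by omega) e1, tyE_fill p h' hp hps i hi, List.singleton_inj.1 e2]
        simp [substCtx]

end Fill

/-- The normal forms of type judgements. -/
def NormalTy (X : TTS.{u}) (Γ : Ctx (Letter X)) (T : Expr (Letter X)) : Prop :=
  ∃ (m : ℕ) (s : Set ℕ) (h : shape (m + 1) s ⟶ X), Γ = ctxE h m ∧ T = tyE h m le_rfl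

/-- The normal forms of term judgements. -/
def NormalTm (X : TTS.{u}) (Γ : Ctx (Letter X)) (t T : Expr (Letter X)) : Prop :=
  ∃ (m : ℕ) (s : Set ℕ) (h : shape (m + 1) s ⟶ X), m + 1 ∈ s ∧ Γ = ctxE h m ∧
    t = argE h m ∧ T = tyE h m le_rfl

/-- The normal forms of judgements; of an equality only one side is considered. -/
def Normal (X : TTS.{u}) (Γ : Ctx (Letter X)) : Assertion (Letter X) → Prop
  | .ty T => NormalTy X Γ T
  | .tm t T => NormalTm X Γ t T
  | .tyEq T _ => NormalTy X Γ T
  | .tmEq t _ T => NormalTm X Γ t T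

variable {Γ Δ : Ctx (Letter X)} {t T t' T' : Expr (Letter X)}

/-- This is the reason why normal forms are closed under substitution. The type `T` occurs in the
context of `h` at some unfilled place and is also the type of `t`; its head letter shows that the
term-element at the head of `t` lies over the type-element of that place. So this term-element can
be added to `h`, and `argE_fill`, `tyE_fill` and `ctxE_fill` identify the result with the
substitution. -/
theorem exists_fill (ht : NormalTm X Γ t T) {m : ℕ} {s : Set ℕ} (h : shape (m + 1) s ⟶ X)
    (e : Γ ++ T :: Δ = ctxE h m) : ∃ (p : ℕ) (h' : shape (m + 1) (insert (p + 1) s) ⟶ X),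
      p < m ∧ ctxE h' m = Γ ++ substCtx Γ.length t Δ ∧
      ∀ q ≤ m, argE h' q = (argE h q).subst Γ.length t ∧
        ∀ hq : q + 1 ≤ m + 1, tyE h' q hq = (tyE h q hq).subst Γ.length t := by
  obtain ⟨m₁, s₁, h₁, hs₁, e₁, e₂, e₃⟩ := ht
  obtain ⟨p, hp, hpm, hps, e₄, e₅⟩ := ctxE_split h m (Nat.le_succ m) e.symm
  rw [e₃] at e₅
  -- The two descriptions of `T` have the same degree, the same type-element at the head and the
  -- same arguments.
  simp only [tyE, Expr.app.injEq, Sum.inl.injEq] at e₅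
  obtain ⟨e₅, rfl, e₆⟩ := e₅
  have e₅ := eq_of_heq (Sigma.mk.inj_iff.1 e₅).2
  obtain ⟨h', ha, rfl⟩ := exists_extend_tm h m₁ hp hps (tmAt h₁ m₁ ⟨le_rfl, hs₁⟩)
    (by rw [bdTm_tmAt, e₅])
  -- The terms `t` and `T` have the same arguments, and those of `T` are what `h` has in the places
  -- before the new one.
  have ht' : t = argE h' m₁ := by
    rw [e₂, argE_of_mem h₁ ⟨le_rfl, hs₁⟩, argE_of_mem h' ⟨hp, Set.mem_insert _ _⟩, ha]
    congr 1
    rw [eq_of_heq e₆]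
    funext r
    refine argE_incl _ _ h' r.1 (by omega) fun j hj hjs => ?_
    have : j ≠ m₁ := by omega
    simpa [this] using hjs
  have hl : Γ.length = gapCount s m₁ := by rw [e₄, length_ctxE _ _ (by omega)]
  rw [hl, ht']
  refine ⟨m₁, h', hpm, ?_, fun q hq => ⟨argE_fill m₁ h' hp hps q (by omega),
    fun hq => tyE_fill m₁ h' hp hps q hq⟩⟩
  rw [e₄]
  refine ctxE_fill m₁ h' hp hps m (Nat.le_succ m) hpm ?_
  rw [← e, e₃, ← e₄]
  congr 2
  simp only [tyE]
  rw [e₅, eq_of_heq e₆]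

theorem NormalTm.subst_ty (ht : NormalTm X Γ t T) (hT : NormalTy X (Γ ++ T :: Δ) T') :
    NormalTy X (Γ ++ substCtx Γ.length t Δ) (T'.subst Γ.length t) := by
  obtain ⟨m, s, h, e, rfl⟩ := hT
  obtain ⟨p, h', -, e', hh⟩ := exists_fill ht h e
  exact ⟨m, _, h', e'.symm, ((hh m le_rfl).2 _).symm⟩

theorem NormalTm.subst_tm (ht : NormalTm X Γ t T) (hT : NormalTm X (Γ ++ T :: Δ) t' T') :
    NormalTm X (Γ ++ substCtx Γ.length t Δ) (t'.subst Γ.length t) (T'.subst Γ.length t) := by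
  obtain ⟨m, s, h, hs, e, rfl, rfl⟩ := hT
  obtain ⟨p, h', -, e', hh⟩ := exists_fill ht h e
  exact ⟨m, _, h', Set.mem_insert_of_mem _ hs, e'.symm, (hh m le_rfl).1.symm,
    ((hh m le_rfl).2 _).symm⟩

theorem gapCount_of_forall_notMem {s : Set ℕ} {q : ℕ} (hs : ∀ r < q, r + 1 ∉ s) :
    gapCount s q = q :=
  (gapCount_congr fun r hr => iff_of_false (hs r hr) (Set.notMem_empty _)).trans gapCount_empty

/-- Generators are the normal forms in which no earlier place is filled: there every place keeps its
own variable. -/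
theorem tyE_of_forall_notMem {m : ℕ} {s : Set ℕ} (h : shape m s ⟶ X) (i : ℕ) (hi : i + 1 ≤ m)
    (hs : ∀ r < i, r + 1 ∉ s) : tyE h i hi = genTy X i (tyAt h i hi) := by
  simp only [tyE, applyVars]
  congr 1
  funext r
  rw [argE_of_notMem _ (hs r.1 r.2), gapCount_of_forall_notMem fun j hj => hs j (by omega)]

theorem argE_of_forall_notMem {m : ℕ} {s : Set ℕ} (h : shape m s ⟶ X) (i : ℕ)
    (hi : i + 1 ≤ m ∧ i + 1 ∈ s) (hs : ∀ r < i, r + 1 ∉ s) :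
    argE h i = genTm X i (tmAt h i hi) := by
  rw [argE_of_mem h hi]
  simp only [applyVars]
  congr 1
  funext r
  rw [argE_of_notMem _ (hs r.1 r.2), gapCount_of_forall_notMem fun j hj => hs j (by omega)]

theorem ctxE_of_forall_notMem {m : ℕ} {s : Set ℕ} (h : shape m s ⟶ X) (i : ℕ) (hi : i + 1 ≤ m)
    (hs : ∀ r < i, r + 1 ∉ s) : ctxE h i = teleCtx X (genTy X) i (tyAt h i hi) := by
  induction i with
  | zero => rfl
  | succ i ih =>
    rw [ctxE_succ_of_notMem h (by omega) (hs i (Nat.lt_succ_self i)), teleCtx, bd_tyAt,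
      ih ((Nat.le_succ _).trans hi) fun r hr => hs r (by omega),
      tyE_of_forall_notMem h i _ fun r hr => hs r (by omega)]

/-- Generators are normal. Equalities are trivial, so the equality rules only repeat a normal form
already at hand. Substitution is covered by `exists_fill`. -/
theorem normal_of_derivable {J : Judgement (Letter X)} (hJ : Derivable (freeBasic X) J) :
    Normal X J.ctx J.asn := by
  induction hJ with
  | basic J hJ =>
    cases hJ with
    | ty k A =>
      obtain ⟨h, rfl⟩ := exists_shape_hom k A
      exact ⟨k, ∅, h, (ctxE_of_forall_notMem h k le_rfl fun _ _ => Set.notMem_empty _).symm,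
        (tyE_of_forall_notMem h k le_rfl fun _ _ => Set.notMem_empty _).symm⟩
    | tm k a =>
      obtain ⟨h, hh⟩ := exists_shape_hom k (X.bdTm k a)
      obtain ⟨h', rfl, rfl⟩ := exists_extend_tm h k le_rfl (Set.notMem_empty _) a hh.symm
      -- Only the top place is filled, and none of the arguments of the generator comes from it.
      have hr (r : ℕ) (hr : r < k) : r + 1 ∉ insert (k + 1) (∅ : Set ℕ) := by
        have : r ≠ k := by omega
        simp [this]
      refine ⟨k, _, h', Set.mem_insert _ _, ?_,
        (argE_of_forall_notMem h' k ⟨le_rfl, Set.mem_insert _ _⟩ hr).symm, ?_⟩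
      · rw [ctxE_of_forall_notMem h' k le_rfl hr, bdTm_tmAt]
      · rw [tyE_of_forall_notMem h' k le_rfl hr, bdTm_tmAt]
  | rule r Js J hr hJs ih =>
    cases hr with
    | tmRefl => have := ih _ (List.mem_cons_self ..); exact this
    | tyRefl => have := ih _ (List.mem_cons_self ..); exact this
    | tmSymm Γ t₁ t₂ T =>
      obtain rfl : t₁ = t₂ := diagonal_of_derivable (hJs _ (List.mem_cons_self ..))
      exact ih _ (List.mem_cons_self ..)
    | tySymm Γ T₁ T₂ =>
      obtain rfl : T₁ = T₂ := diagonal_of_derivable (hJs _ (List.mem_cons_self ..))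
      exact ih _ (List.mem_cons_self ..)
    | tmTrans => have := ih _ (List.mem_cons_self ..); exact this
    | tyTrans => have := ih _ (List.mem_cons_self ..); exact this
    | tmConv Γ t T₁ T₂ =>
      obtain rfl : T₁ = T₂ := diagonal_of_derivable (hJs _ (List.mem_cons_self ..))
      exact ih _ (List.mem_cons_of_mem _ (List.mem_cons_self ..))
    | tmEqConv Γ t₁ t₂ T₁ T₂ =>
      obtain rfl : T₁ = T₂ := diagonal_of_derivable (hJs _ (List.mem_cons_self ..))
      exact ih _ (List.mem_cons_of_mem _ (List.mem_cons_self ..))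
    | ctxConv Γ Δ T₁ T₂ a =>
      obtain rfl : T₁ = T₂ := diagonal_of_derivable (hJs _ (List.mem_cons_self ..))
      exact ih _ (List.mem_cons_of_mem _ (List.mem_cons_self ..))
    | subst Γ Δ t T a =>
      have h1 := ih _ (List.mem_cons_self ..)
      have h2 := ih _ (List.mem_cons_of_mem _ (List.mem_cons_self ..))
      cases a with
      | ty => exact NormalTm.subst_ty h1 h2
      | tm => exact NormalTm.subst_tm h1 h2
      | tyEq => exact NormalTm.subst_ty h1 h2
      | tmEq => exact NormalTm.subst_tm h1 h2
    | substTyEq Γ Δ t₁ t₂ T T' =>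
      obtain rfl : t₁ = t₂ := diagonal_of_derivable (hJs _ (List.mem_cons_self ..))
      have h1 := ih _ (List.mem_cons_self ..)
      have h2 := ih _ (List.mem_cons_of_mem _ (List.mem_cons_self ..))
      exact NormalTm.subst_ty h1 h2
    | substTmEq Γ Δ t₁ t₂ T t' T' =>
      obtain rfl : t₁ = t₂ := diagonal_of_derivable (hJs _ (List.mem_cons_self ..))
      have h1 := ih _ (List.mem_cons_self ..)
      have h2 := ih _ (List.mem_cons_of_mem _ (List.mem_cons_self ..))
      exact NormalTm.subst_tm h1 h2

end Args


/-! ## Normal forms and inc-lists -/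

namespace IncList

theorem le_top {n : ℕ} (α : IncList n) (i : Fin (n + 1)) : α.toFun i ≤ α.top :=
  α.strictMono.monotone (Fin.le_last i)

theorem top_pos {k : ℕ} (α : IncList (k + 1)) : 0 < α.top := by
  rw [← α.map_zero]
  exact α.strictMono (Fin.last_pos)

theorem sub_one_add_one {k : ℕ} (α : IncList (k + 1)) : α.top - 1 + 1 = α.top :=
  Nat.sub_add_cancel α.top_pos

/-- A strictly increasing map is determined by its image; `0` and the top value always belong to it,
and nothing above the top value does. -/
theorem ext_of_mem {n : ℕ} {α β : IncList n} (htop : α.top = β.top)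
    (h : ∀ i, i + 1 < α.top → (i + 1 ∈ Set.range α.toFun ↔ i + 1 ∈ Set.range β.toFun)) :
    α = β := by
  have : Set.range α.toFun = Set.range β.toFun := by
    ext i
    rcases lt_trichotomy i α.top with hi | rfl | hi
    · cases i with
      | zero => exact iff_of_true ⟨0, α.map_zero⟩ ⟨0, β.map_zero⟩
      | succ i => exact h i hi
    · exact iff_of_true ⟨_, rfl⟩ ⟨_, htop.symm⟩
    · refine iff_of_false ?_ ?_
      · rintro ⟨j, rfl⟩
        exact absurd (α.le_top j) (not_le.2 hi)
      · rintro ⟨j, rfl⟩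
        exact absurd (β.le_top j) (not_le.2 (htop ▸ hi))
  exact IncList.ext ((α.strictMono.range_inj β.strictMono).1 this)

/-- The inc-list of the elements of a set of natural numbers. -/
theorem exists_of_gapCount {s : Set ℕ} {m k : ℕ} (h : gapCount s m = k) :
    ∃ α : IncList (k + 1), α.top = m + 1 ∧ ∀ i < m, i + 1 ∈ Set.range α.toFun ↔ i + 1 ∉ s := by
  classical
  -- The `k` unfilled places are framed by `0` and `m + 1`, which gives the `k + 2` values of an
  -- inc-list of length `k + 1`.
  let F : Finset ℕ := insert (m + 1)
    (insert 0 (((Finset.range m).filter fun r => r + 1 ∉ s).image Nat.succ))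
  have hF (i : ℕ) : i ∈ F ↔ i = m + 1 ∨ i = 0 ∨ ∃ r < m, r + 1 ∉ s ∧ r + 1 = i := by
    simp [F, and_assoc]
  have hc : F.card = k + 2 := by
    rw [Finset.card_insert_of_notMem (by simp), Finset.card_insert_of_notMem (by simp),
      Finset.card_image_of_injective _ Nat.succ_injective, ← Nat.count_eq_card_filter_range, ← h,
      gapCount]
  have hr (i : ℕ) : i ∈ Set.range (F.orderEmbOfFin hc) ↔ i ∈ F := by simp
  have h0 : F.orderEmbOfFin hc 0 = 0 := by
    obtain ⟨j, hj⟩ := (hr 0).2 ((hF 0).2 (by simp))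
    exact Nat.le_zero.1 (((F.orderEmbOfFin hc).monotone (Fin.zero_le j)).trans hj.le)
  have ht : F.orderEmbOfFin hc (Fin.last _) = m + 1 := by
    apply le_antisymm
    · rcases (hF _).1 ((hr _).1 ⟨Fin.last (k + 1), rfl⟩) with h | h | ⟨r, hr, -, h⟩ <;> omega
    · obtain ⟨j, hj⟩ := (hr (m + 1)).2 ((hF _).2 (by simp))
      exact hj.ge.trans ((F.orderEmbOfFin hc).monotone (Fin.le_last j))
  refine ⟨⟨F.orderEmbOfFin hc, h0, (F.orderEmbOfFin hc).strictMono⟩, ht, fun i hi => ?_⟩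
  rw [hr, hF]
  constructor
  · rintro (h | h | ⟨r, -, hrs, h⟩)
    · omega
    · omega
    · exact h ▸ hrs
  · exact fun h => .inr (.inr ⟨i, hi, h, rfl⟩)

end IncList

theorem gapCount_eq_of_forall_mem {s : Set ℕ} {a b : ℕ} (hab : a ≤ b)
    (h : ∀ r, a ≤ r → r < b → r + 1 ∈ s) : gapCount s b = gapCount s a := by
  induction b, hab using Nat.le_induction with
  | base => rfl
  | succ b hab ih =>
    rw [gapCount_succ_of_mem (h b hab (Nat.lt_succ_self b)),
      ih fun r hr hrb => h r hr (by omega)]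

theorem ctxE_eq_of_forall_mem {X : TTS.{u}} {m : ℕ} {s : Set ℕ} (h : shape m s ⟶ X) {a b : ℕ}
    (hab : a ≤ b) (hs : ∀ r, a ≤ r → r < b → r + 1 ∈ s) : ctxE h b = ctxE h a := by
  induction b, hab using Nat.le_induction with
  | base => rfl
  | succ b hab ih =>
    rw [ctxE_succ_of_mem h (hs b hab (Nat.lt_succ_self b)),
      ih fun r hr hrb => hs r hr (by omega)]

/-- Counting of gaps along an inc-list. -/
theorem IncList.gapCount_eq {n : ℕ} (β : IncList n) {s S : Set ℕ} {M : ℕ}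
    (hS : ∀ i < M, i ∈ S ↔ ∀ p, β.toFun p = i → (p : ℕ) ∈ s) (j : ℕ) (hj : j + 1 < n + 1)
    (q : ℕ) (hq : β.toFun ⟨j + 1, hj⟩ = q + 1) (hqM : q < M) : gapCount S q = gapCount s j := by
  induction j generalizing q with
  | zero =>
    rw [gapCount_zero, gapCount_eq_of_forall_mem (Nat.zero_le q), gapCount_zero]
    intro r _ hr
    rw [hS _ (by omega)]
    rintro p hp
    -- No value of `β` lies strictly between `β(0) = 0` and `β(1)`, so these places satisfy the
    -- condition vacuously.
    have h1 : β.toFun p < β.toFun ⟨0 + 1, hj⟩ := by omega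
    have h2 : p = 0 := by
      have := β.strictMono.lt_iff_lt.1 h1
      exact Fin.ext (by simpa [Fin.lt_def] using this)
    rw [h2, β.map_zero] at hp
    omega
  | succ j ih =>
    have hlt : β.toFun ⟨j + 1, by omega⟩ < β.toFun ⟨j + 1 + 1, hj⟩ :=
      β.strictMono (Fin.mk_lt_mk.2 (Nat.lt_succ_self _))
    have hpos : β.toFun 0 < β.toFun ⟨j + 1, by omega⟩ :=
      β.strictMono (Fin.mk_lt_mk.2 (Nat.succ_pos _))
    obtain ⟨q', hq'⟩ := Nat.exists_eq_add_of_lt hpos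
    rw [β.map_zero, zero_add] at hq'
    -- The places strictly between two consecutive values of `β` are filled and do not count; what
    -- remains is the step at the earlier value.
    rw [gapCount_eq_of_forall_mem (a := q' + 1) (by omega)]
    · have ih := ih (by omega) q' hq' (by omega)
      have hiff : q' + 1 ∈ S ↔ j + 1 ∈ s := by
        rw [hS _ (by omega)]
        constructor
        · exact fun h => h _ hq'
        · intro h p hp
          rw [β.strictMono.injective (hp.trans hq'.symm)]
          exact h
      by_cases hs : j + 1 ∈ s
      · rw [gapCount_succ_of_mem hs, gapCount_succ_of_mem (hiff.2 hs), ih]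
      · rw [gapCount_succ_of_notMem hs, gapCount_succ_of_notMem fun h => hs (hiff.1 h), ih]
    · intro r hr hrq
      rw [hS _ (by omega)]
      intro p hp
      have h1 : β.toFun ⟨j + 1, by omega⟩ < β.toFun p := by omega
      have h2 : β.toFun p < β.toFun ⟨j + 1 + 1, hj⟩ := by omega
      have h1 := β.strictMono.lt_iff_lt.1 h1
      have h2 := β.strictMono.lt_iff_lt.1 h2
      simp only [Fin.lt_def] at h1 h2
      omega

/-- The unfilled places below the top are the values `α(1), …, α(k)`. Consequently the normal form
given by `α` has a context of length `k`. -/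
theorem IncList.gapCount_top {k : ℕ} (α : IncList (k + 1)) {s : Set ℕ}
    (hs : ∀ i < α.top, i ∈ s ↔ i ∉ Set.range α.toFun) : gapCount s (α.top - 1) = k := by
  rw [α.gapCount_eq (s := ∅) (M := α.top) (j := k) (fun i hi => ?_) (Nat.lt_succ_self _) _
    α.sub_one_add_one.symm (by have := α.top_pos; omega), gapCount_empty]
  rw [hs i hi]
  exact ⟨fun h p hp => h ⟨p, hp⟩, fun h ⟨p, hp⟩ => h p hp⟩

/-- The structure `[α]`. -/
abbrev IncList.dom {n : ℕ} (α : IncList n) : TTS.{u} := SGAT.shape α.top (Set.range α.toFun)ᶜ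

/-- The structure `[α]_t`. -/
abbrev IncList.domTm {n : ℕ} (α : IncList n) : TTS.{u} :=
  SGAT.shape α.top ((Set.range α.toFun)ᶜ ∪ {α.top})

section Normal

variable {X : TTS.{u}}

theorem mem_shapeTm_iff {n : ℕ} (α : IncList n) {i : ℕ} (hi : i < α.top) :
    i ∈ (Set.range α.toFun)ᶜ ∪ {α.top} ↔ i ∉ Set.range α.toFun := by
  simp [hi.ne]

theorem top_mem_shapeTm {k : ℕ} (α : IncList (k + 1)) :
    α.top - 1 + 1 ≤ α.top ∧ α.top - 1 + 1 ∈ (Set.range α.toFun)ᶜ ∪ {α.top} := by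
  rw [α.sub_one_add_one]
  exact ⟨le_rfl, .inr rfl⟩

/-- The type judgement given by an inc-list `α` and a map from `[α]`. -/
noncomputable def incTy {k : ℕ} (α : IncList (k + 1)) (h : α.dom ⟶ X) :
    (freeGAT X).TyJudgement k :=
  .of (derivable_tyE h (α.top - 1) α.sub_one_add_one.le) (by
    rw [length_ctxE _ _ (Nat.sub_le _ _)]
    exact α.gapCount_top fun i hi => Iff.rfl)

/-- The term judgement given by an inc-list `α` and a map from `[α]_t`. -/
noncomputable def incTm {k : ℕ} (α : IncList (k + 1)) (h : α.domTm ⟶ X) :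
    (freeGAT X).TmJudgement k :=
  .of (derivable_tmE h (α.top - 1) (top_mem_shapeTm α)) (by
    rw [length_ctxE _ _ (Nat.sub_le _ _), α.gapCount_top fun i hi => mem_shapeTm_iff α hi])

theorem GAT.TyJudgement.boundary_eq {𝕋 : GAT.{u}} {k : ℕ} {J : 𝕋.TyJudgement (k + 1)}
    {K : 𝕋.TyJudgement k} {Γ : Ctx 𝕋.Alphabet} {S T : Expr 𝕋.Alphabet}
    (hJ : J.1.1 = ⟨Γ ++ [S], .ty T⟩) (hK : K.1.1 = ⟨Γ, .ty S⟩) : J.boundary = K := by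
  obtain ⟨Γ', S', T', e, e'⟩ := J.exists_eq
  apply Subtype.ext
  apply Subtype.ext
  rw [e', hK]
  have h := congrArg Judgement.ctx (hJ.symm.trans e)
  obtain ⟨rfl, h'⟩ := List.append_inj' h rfl
  obtain rfl := List.singleton_inj.1 h'
  rfl

/-- The places between the last two values of `α` are filled and add nothing to the context, so the
last type of the context is the one at the place `α.bd.top`. Its normal form involves only earlier
places, where `[∂α]` and `[α]` agree. -/
theorem incTy_boundary {k : ℕ} (α : IncList (k + 1 + 1)) (h : α.dom ⟶ X) (hm : α.bd.top ≤ α.top)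
    (hs : ∀ i ≤ α.bd.top, i ∈ (Set.range α.bd.toFun)ᶜ → i ∈ (Set.range α.toFun)ᶜ) :
    (incTy α h).boundary = incTy α.bd (shapeIncl hm hs ≫ h) := by
  have hlt : α.bd.top < α.top := α.strictMono (Fin.castSucc_lt_last (Fin.last (k + 1)))
  have hgap (r : ℕ) (h1 : α.bd.top < r + 1) (h2 : r + 1 < α.top) : r + 1 ∉ Set.range α.toFun := by
    rintro ⟨p, hp⟩
    rw [← hp] at h1 h2
    have h1 := α.strictMono.lt_iff_lt.1 (show α.toFun (Fin.castSucc (Fin.last (k + 1))) < _ from h1)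
    have h2 := α.strictMono.lt_iff_lt.1 h2
    simp only [Fin.lt_def, Fin.val_castSucc, Fin.val_last] at h1 h2
    omega
  have hlow (r : ℕ) (hr : r < α.bd.top - 1) (h1 : r + 1 ∈ (Set.range α.toFun)ᶜ) :
      r + 1 ∈ (Set.range α.bd.toFun)ᶜ := by
    rintro ⟨p, hp⟩
    exact h1 ⟨_, hp⟩
  have hpos := α.bd.top_pos
  refine GAT.TyJudgement.boundary_eq (Γ := ctxE h (α.bd.top - 1))
    (S := tyE h (α.bd.top - 1) (by omega))
    (T := tyE h (α.top - 1) α.sub_one_add_one.le) ?_ ?_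
  · change Judgement.mk _ _ = Judgement.mk _ _
    congr 1
    rw [← ctxE_succ_of_notMem]
    · exact ctxE_eq_of_forall_mem _ (by omega) fun r h1 h2 => hgap r (by omega) (by omega)
    · rw [α.bd.sub_one_add_one]
      exact fun h => h ⟨_, rfl⟩
  · change Judgement.mk _ _ = Judgement.mk _ _
    congr 1
    · exact ctxE_incl _ _ _ _ (by omega) hlow
    · exact congrArg _ (tyE_incl _ _ _ _ (by omega) hlow)

/-- The context and the type only involve places below the top, where `[α]` and `[α]_t` have the
same term-elements. -/
theorem incTm_boundary {k : ℕ} (α : IncList (k + 1)) (h : α.domTm ⟶ X)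
    (hs : ∀ i ≤ α.top, i ∈ (Set.range α.toFun)ᶜ → i ∈ (Set.range α.toFun)ᶜ ∪ {α.top}) :
    (incTm α h).boundary = incTy α (shapeIncl le_rfl hs ≫ h) := by
  have hlow (r : ℕ) (hr : r < α.top - 1) (h1 : r + 1 ∈ (Set.range α.toFun)ᶜ ∪ {α.top}) :
      r + 1 ∈ (Set.range α.toFun)ᶜ := (mem_shapeTm_iff α (by omega)).1 h1
  apply Subtype.ext
  apply Subtype.ext
  change Judgement.mk _ _ = Judgement.mk _ _
  congr 1
  · exact (ctxE_incl _ _ _ _ (by omega) hlow).symm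
  · exact congrArg _ (tyE_incl _ _ _ _ α.sub_one_add_one.le hlow).symm

/-! ### Injectivity -/

/-- A filled place shows a letter and an unfilled one a variable; the letter records the
term-element. -/
theorem argE_inj {m m' : ℕ} {s s' : Set ℕ} {h : shape m s ⟶ X} {h' : shape m' s' ⟶ X} {q : ℕ}
    (hq : q + 1 ≤ m) (hq' : q + 1 ≤ m') (e : argE h q = argE h' q) :
    (q + 1 ∈ s ↔ q + 1 ∈ s') ∧ ∀ hs hs', tmAt h q hs = tmAt h' q hs' := by
  by_cases hs : q + 1 ∈ s
  · rw [argE_of_mem h ⟨hq, hs⟩] at e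
    by_cases hs' : q + 1 ∈ s'
    · rw [argE_of_mem h' ⟨hq', hs'⟩] at e
      simp only [Expr.app.injEq, Sum.inr.injEq] at e
      exact ⟨iff_of_true hs hs', fun _ _ => eq_of_heq (Sigma.mk.inj_iff.1 e.1).2⟩
    · rw [argE_of_notMem h' hs'] at e
      cases e
  · rw [argE_of_notMem h hs] at e
    by_cases hs' : q + 1 ∈ s'
    · rw [argE_of_mem h' ⟨hq', hs'⟩] at e
      cases e
    · exact ⟨iff_of_false hs hs', fun h => absurd h.2 hs⟩

theorem Expr.app_inj {W : Type u} {w w' : W} {n n' : ℕ} {args : Fin n → Expr W}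
    {args' : Fin n' → Expr W} (e : Expr.app w n args = .app w' n' args') :
    w = w' ∧ n = n' ∧ ∀ i hi hi', args ⟨i, hi⟩ = args' ⟨i, hi'⟩ := by
  cases e
  exact ⟨rfl, rfl, fun _ _ _ => rfl⟩

/-- The head letter displays the top type-element, the number of arguments gives the top value, and
the arguments show which places are filled and by what. The type alone suffices; its context need
not be compared. -/
theorem incTy_inj {k : ℕ} {α α' : IncList (k + 1)} {h : α.dom ⟶ X} {h' : α'.dom ⟶ X}
    (e : tyE h (α.top - 1) α.sub_one_add_one.le = tyE h' (α'.top - 1) α'.sub_one_add_one.le) :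
    (⟨α, h⟩ : Σ α : IncList (k + 1), (α.dom ⟶ X)) = ⟨α', h'⟩ := by
  obtain ⟨e₁, e₂, e₃⟩ := Expr.app_inj e
  have hp := α.top_pos
  have hp' := α'.top_pos
  have hargs (q : ℕ) (hq : q < α.top - 1) := argE_inj (by omega) (by omega)
    (e₃ q hq (e₂ ▸ hq))
  obtain rfl : α = α' := IncList.ext_of_mem (by omega) fun i hi =>
    not_iff_not.1 (hargs i (by omega)).1
  congr 1
  refine shape_hom_ext_top (α.top - 1) α.sub_one_add_one.symm
    (eq_of_heq (Sigma.mk.inj_iff.1 (Sum.inl_injective e₁)).2) fun i hi => ?_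
  -- `[α]` has no term-element in the top degree, so each of its term-elements is the head of some
  -- argument.
  have hne : i ≠ α.top - 1 := by
    rintro rfl
    exact hi.2 ⟨Fin.last _, α.sub_one_add_one.symm⟩
  exact (hargs i (by omega)).2 hi hi

theorem incTm_inj {k : ℕ} {α α' : IncList (k + 1)} {h : α.domTm ⟶ X} {h' : α'.domTm ⟶ X}
    (e : argE h (α.top - 1) = argE h' (α'.top - 1)) :
    (⟨α, h⟩ : Σ α : IncList (k + 1), (α.domTm ⟶ X)) = ⟨α', h'⟩ := by
  rw [argE_of_mem h (top_mem_shapeTm α), argE_of_mem h' (top_mem_shapeTm α')] at e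
  obtain ⟨e₁, e₂, e₃⟩ := Expr.app_inj e
  have hp := α.top_pos
  have hp' := α'.top_pos
  have hargs (q : ℕ) (hq : q < α.top - 1) := argE_inj (by omega) (by omega)
    (e₃ q hq (e₂ ▸ hq))
  obtain rfl : α = α' := IncList.ext_of_mem (by omega) fun i hi => by
    have := (hargs i (by omega)).1
    rwa [mem_shapeTm_iff α (by omega), mem_shapeTm_iff α' (by omega), not_iff_not] at this
  congr 1
  have ht := eq_of_heq (Sigma.mk.inj_iff.1 (Sum.inr_injective e₁)).2
  refine shape_hom_ext_top (α.top - 1) α.sub_one_add_one.symm ?_ fun i hi => ?_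
  · have := congrArg (X.bdTm _) ht
    rwa [bdTm_tmAt, bdTm_tmAt] at this
  · by_cases hne : i = α.top - 1
    · subst hne
      exact ht
    · exact (hargs i (by omega)).2 hi hi

/-! ### Surjectivity -/

/-- The unfilled places of a normal form give `α`. Restriction of the map to `[α]` changes nothing,
because the sets of filled places agree below the top, and a type judgement does not involve the
term-element in the top place. -/
theorem exists_incTy {k : ℕ} (J : (freeGAT X).TyJudgement k) :
    ∃ (α : IncList (k + 1)) (h : α.dom ⟶ X), incTy α h = J := by
  obtain ⟨Γ, T, hJ, hl, rfl⟩ := J.exists_of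
  obtain ⟨m, s, h, rfl, rfl⟩ := normal_of_derivable hJ
  rw [length_ctxE _ _ (Nat.le_succ m)] at hl
  obtain ⟨α, htop, hα⟩ := IncList.exists_of_gapCount hl
  -- The top place is a value of `α`, so it does not matter whether `s` contains it.
  have hs (i : ℕ) (hi : i ≤ α.top) (his : i ∈ (Set.range α.toFun)ᶜ) : i ∈ s := by
    cases i with
    | zero => exact absurd ⟨0, α.map_zero⟩ his
    | succ i =>
      have hne : i + 1 ≠ α.top := fun e => his ⟨Fin.last _, e.symm⟩
      by_contra hcon
      exact his ((hα i (by omega)).2 hcon)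
  have hlow (i : ℕ) (hi : i < m) (his : i + 1 ∈ s) : i + 1 ∈ (Set.range α.toFun)ᶜ :=
    fun h => (hα i hi).1 h his
  have hm : α.top - 1 = m := by omega
  refine ⟨α, shapeIncl htop.le hs ≫ h, ?_⟩
  apply Subtype.ext
  apply Subtype.ext
  change Judgement.mk _ _ = Judgement.mk _ _
  congr 1
  · rw [ctxE_incl _ _ _ _ (by omega) fun r hr => hlow r (by omega), hm]
  · rw [tyE_incl _ _ _ _ _ fun r hr => hlow r (by omega)]
    congr 2

theorem exists_incTm {k : ℕ} (J : (freeGAT X).TmJudgement k) :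
    ∃ (α : IncList (k + 1)) (h : α.domTm ⟶ X), incTm α h = J := by
  obtain ⟨Γ, t, T, hJ, hl, rfl⟩ := J.exists_of
  obtain ⟨m, s, h, hms, rfl, rfl, rfl⟩ := normal_of_derivable hJ
  rw [length_ctxE _ _ (Nat.le_succ m)] at hl
  obtain ⟨α, htop, hα⟩ := IncList.exists_of_gapCount hl
  have hs (i : ℕ) (hi : i ≤ α.top) (his : i ∈ (Set.range α.toFun)ᶜ ∪ {α.top}) : i ∈ s := by
    rcases hi.eq_or_lt with rfl | hi
    · rwa [htop]
    · rw [mem_shapeTm_iff α hi] at his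
      cases i with
      | zero => exact absurd ⟨0, α.map_zero⟩ his
      | succ i =>
        by_contra hcon
        exact his ((hα i (by omega)).2 hcon)
  have hlow (i : ℕ) (hi : i ≤ m) (his : i + 1 ∈ s) :
      i + 1 ∈ (Set.range α.toFun)ᶜ ∪ {α.top} := by
    rcases hi.eq_or_lt with rfl | hi
    · exact .inr htop.symm
    · exact .inl fun h => (hα i hi).1 h his
  have hm : α.top - 1 = m := by omega
  refine ⟨α, shapeIncl htop.le hs ≫ h, ?_⟩
  apply Subtype.ext
  apply Subtype.ext
  change Judgement.mk _ _ = Judgement.mk _ _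
  congr 1
  · rw [ctxE_incl _ _ _ _ (by omega) fun r hr => hlow r (by omega), hm]
  · rw [argE_incl _ _ _ _ (by omega) fun r hr => hlow r (by omega),
      tyE_incl _ _ _ _ _ fun r hr => hlow r (by omega)]
    congr 2

/-! ### The comparison -/

/-- Congruent judgements of the free theory are equal. -/
theorem eq_of_eqv {J J' : Judgement (freeGAT X).Alphabet} (h : (freeGAT X).Eqv J J') : J = J' := by
  have hctx {Γ Γ' : Ctx (Letter X)} (h : CtxEq (freeBasic X) Γ Γ') : Γ = Γ' := by
    induction h with
    | nil => rfl
    | concat Γ Γ' T T' _ hT ih =>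
      obtain rfl : T = T' := diagonal_of_derivable hT
      rw [ih]
  cases h with
  | ty Γ Γ' T T' hΓ hT =>
    obtain rfl : T = T' := diagonal_of_derivable hT
    rw [hctx hΓ]
  | tm Γ Γ' t t' T T' hΓ hT ht =>
    obtain rfl : T = T' := diagonal_of_derivable hT
    obtain rfl : t = t' := diagonal_of_derivable ht
    rw [hctx hΓ]

/-- The comparison map from pairs of an inc-list and a map to classes of judgements of the free
theory. -/
noncomputable def incHom (X : TTS.{u}) : incObj X ⟶ GAT.forget.obj (freeGAT X) :=
  TTS.homMk (X := incObj X) (Y := (freeGAT X).forgetObj)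
    (fun _ x => Quot.mk _ (incTy x.1 x.2)) (fun _ x => Quot.mk _ (incTm x.1 x.2))
    (fun _ x => congrArg (Quot.mk _) (incTy_boundary x.1 x.2 _ _).symm)
    (fun _ x => congrArg (Quot.mk _) (incTm_boundary x.1 x.2 _).symm)

theorem incHom_bijective_ty (X : TTS.{u}) (k : ℕ) :
    Function.Bijective (TTS.onTy (incHom X) k) := by
  constructor
  · rintro ⟨α, h⟩ ⟨α', h'⟩ e
    have e := eq_of_eqv (GAT.TyJudgement.eqv_of_mk_eq e)
    exact incTy_inj (Assertion.ty.inj (congrArg Judgement.asn e))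
  · rintro ⟨J⟩
    obtain ⟨α, h, rfl⟩ := exists_incTy J
    exact ⟨⟨α, h⟩, rfl⟩

theorem incHom_bijective_tm (X : TTS.{u}) (k : ℕ) :
    Function.Bijective (TTS.onTm (incHom X) k) := by
  constructor
  · rintro ⟨α, h⟩ ⟨α', h'⟩ e
    have e := eq_of_eqv (GAT.TmJudgement.eqv_of_mk_eq e)
    exact incTm_inj (Assertion.tm.inj (congrArg Judgement.asn e)).1
  · rintro ⟨J⟩
    obtain ⟨α, h, rfl⟩ := exists_incTm J
    exact ⟨⟨α, h⟩, rfl⟩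

theorem TTS.isIso_of_bijective {X Y : TTS.{u}} (f : X ⟶ Y)
    (h : ∀ k, Function.Bijective (TTS.onTy f k)) (h' : ∀ k, Function.Bijective (TTS.onTm f k)) :
    IsIso f := by
  rw [NatTrans.isIso_iff_isIso_app]
  rintro ⟨v⟩
  rw [isIso_iff_bijective]
  cases v with
  | ty k => exact h k
  | tm k => exact h' k

instance (X : TTS.{u}) : IsIso (incHom X) :=
  TTS.isIso_of_bijective _ (incHom_bijective_ty X) (incHom_bijective_tm X)

end Normal


/-! ## Iterated normal forms -/

section Unfold

variable {X : TTS.{u}}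

/-- The restriction of an inc-list to `{0, …, n}`. -/
def IncList.restrict {M : ℕ} (β : IncList M) (n : ℕ) (hn : n ≤ M) : IncList n where
  toFun i := β.toFun ⟨i, by omega⟩
  map_zero := β.map_zero
  strictMono _ _ h := β.strictMono (Fin.mk_lt_mk.2 h)

theorem IncList.restrict_top {M : ℕ} (β : IncList M) (n : ℕ) (hn : n ≤ M) :
    (β.restrict n hn).top = β.toFun ⟨n, by omega⟩ := rfl

theorem IncList.mem_range_restrict {M : ℕ} (β : IncList M) (n : ℕ) (hn : n ≤ M) {i : ℕ}
    (hi : i ≤ (β.restrict n hn).top) :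
    i ∈ Set.range (β.restrict n hn).toFun ↔ i ∈ Set.range β.toFun := by
  constructor
  · rintro ⟨p, rfl⟩
    exact ⟨_, rfl⟩
  · rintro ⟨p, rfl⟩
    have hp := β.strictMono.le_iff_le.1 (show β.toFun p ≤ β.toFun ⟨n, by omega⟩ from hi)
    exact ⟨⟨p, Nat.lt_succ_of_le hp⟩, rfl⟩

/-- The set of places that are filled if the places in `s` are filled after `β`. -/
def Filled {M : ℕ} (β : IncList M) (s S : Set ℕ) (M' : ℕ) : Prop :=
  ∀ i ≤ M', i ∈ S ↔ ∀ p, β.toFun p = i → (p : ℕ) ∈ s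

variable {m M M' : ℕ} {s S : Set ℕ}

section

variable {β : IncList M} (hm : m ≤ M) (hM : β.toFun ⟨m, by omega⟩ ≤ M') (hS : Filled β s S M')

include hM in
theorem top_restrict_le {n : ℕ} (hn : n ≤ m) : (β.restrict n (hn.trans hm)).top ≤ M' :=
  (β.strictMono.monotone (Fin.mk_le_mk.2 hn)).trans hM

include hM hS in
theorem mem_filled_of_restrict {n : ℕ} (hn : n ≤ m) (i : ℕ)
    (hi : i ≤ (β.restrict n (hn.trans hm)).top)
    (h : i ∈ (Set.range (β.restrict n (hn.trans hm)).toFun)ᶜ) : i ∈ S := by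
  rw [hS i (hi.trans (top_restrict_le hm hM hn))]
  intro p hp
  exact absurd ((β.mem_range_restrict n _ hi).2 ⟨p, hp⟩) h

include hM hS in
theorem mem_filled_of_restrict_tm {n : ℕ} (hn : n ≤ m) (hns : n ∈ s) (i : ℕ)
    (hi : i ≤ (β.restrict n (hn.trans hm)).top)
    (h : i ∈ (Set.range (β.restrict n (hn.trans hm)).toFun)ᶜ ∪ {(β.restrict n (hn.trans hm)).top}) :
    i ∈ S := by
  rcases h with h | rfl
  · exact mem_filled_of_restrict hm hM hS hn i hi h
  · rw [hS _ (top_restrict_le hm hM hn)]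
    intro p hp
    rw [β.strictMono.injective hp]
    exact hns

/-- The restriction of a map to `[β|ₙ]`. -/
abbrev restrictTy (g : shape M' S ⟶ X) (n : ℕ) (hn : n ≤ m) :
    (β.restrict n (hn.trans hm)).dom ⟶ X :=
  shapeIncl (top_restrict_le hm hM hn) (mem_filled_of_restrict hm hM hS hn) ≫ g

/-- The restriction of a map to `[β|ₙ]_t`. -/
abbrev restrictTm (g : shape M' S ⟶ X) (n : ℕ) (hn : n ≤ m) (hns : n ∈ s) :
    (β.restrict n (hn.trans hm)).domTm ⟶ X :=
  shapeIncl (top_restrict_le hm hM hn) (mem_filled_of_restrict_tm hm hM hS hn hns) ≫ g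

variable (β) in
/-- The map to `incObj X` whose values are the restrictions of a map to `X`. -/
def unfold (g : shape M' S ⟶ X) : shape m s ⟶ incObj X :=
  shapeHom (X := incObj X)
    (fun i hi => (⟨β.restrict (i + 1) (hi.trans hm), restrictTy hm hM hS g (i + 1) hi⟩ :
      Σ β : IncList (i + 1), (β.shape ⟶ X)))
    (fun i hi => (⟨β.restrict (i + 1) (hi.1.trans hm), restrictTm hm hM hS g (i + 1) hi.1 hi.2⟩ :
      Σ β : IncList (i + 1), (β.shapeTm ⟶ X)))
    (fun i _ => congrArg (Sigma.mk (β.restrict (i + 1) _))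
      (shape_hom_ext (fun _ _ => rfl) (fun _ _ => rfl)))
    (fun i _ => congrArg (Sigma.mk (β.restrict (i + 1) _))
      (shape_hom_ext (fun _ _ => rfl) (fun _ _ => rfl)))

end

/-! ### Translation of iterated normal forms -/

variable (β : IncList M) (hm : m ≤ M) (hM : β.toFun ⟨m, by omega⟩ ≤ M') (hS : Filled β s S M')
  (a : Assign (incObj X) (freeGAT X))
  (hty : ∀ k (α : IncList (k + 1)) (h : α.dom ⟶ X),
    a.ty k (⟨α, h⟩ : Σ α : IncList (k + 1), (α.shape ⟶ X)) =
      tyE h (α.top - 1) α.sub_one_add_one.le)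
  (htm : ∀ k (α : IncList (k + 1)) (h : α.domTm ⟶ X),
    a.tm k (⟨α, h⟩ : Σ α : IncList (k + 1), (α.shapeTm ⟶ X)) = argE h (α.top - 1))
  (d : Expr (freeGAT X).Alphabet) (g : shape M' S ⟶ X)

include htm in
-- Both claims are proved together by induction on the place. The first concerns places that are
-- values of `β`, where an argument of the outer normal form is translated. The second concerns
-- arguments of an inner normal form, whose variables receive the translated outer arguments. A
-- filled place reduces to the second claim at earlier places; a variable of an inner normal form
-- reduces to the first claim at the same place.
theorem argE_unfold (q : ℕ) :
    (∀ j (hj : j + 1 ≤ m), β.toFun ⟨j + 1, by omega⟩ = q + 1 →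
      (argE (unfold β hm hM hS g) j).tr a.letter d = argE g q) ∧
    ∀ i (hi : i + 1 ≤ m), q + 1 < β.toFun ⟨i + 1, by omega⟩ →
      ((argE (restrictTy hm hM hS g (i + 1) hi) q).bind fun r =>
        if r < i then (argE (unfold β hm hM hS g) r).tr a.letter d else d) = argE g q := by
  induction q using Nat.strong_induction_on with
  | _ q ih =>
    have h1 (j) (hj : j + 1 ≤ m) (e : β.toFun ⟨j + 1, by omega⟩ = q + 1) :
        (argE (unfold β hm hM hS g) j).tr a.letter d = argE g q := by
      have hqM : q + 1 ≤ M' := e ▸ top_restrict_le hm hM hj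
      have hiff : q + 1 ∈ S ↔ j + 1 ∈ s := by
        rw [hS _ hqM]
        constructor
        · exact fun h => h _ e
        · intro h p hp
          rw [β.strictMono.injective (hp.trans e.symm)]
          exact h
      by_cases hs : j + 1 ∈ s
      · rw [argE_of_mem _ ⟨hj, hs⟩, argE_of_mem g ⟨hqM, hiff.2 hs⟩]
        -- By `htm` the outer letter is translated to an inner normal form whose head is the
        -- term-element of `g` in place `q + 1`.
        have htop : (β.restrict (j + 1) (hj.trans hm)).top - 1 = q := by
          rw [IncList.restrict_top, e, Nat.add_sub_cancel]
        have := ((htm j (β.restrict (j + 1) (hj.trans hm))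
          (restrictTm hm hM hS g (j + 1) hj hs)).trans (congrArg (argE _) htop)).trans
            (argE_of_mem _ ⟨e.ge, .inr e.symm⟩)
        change Expr.bind (a.tm j _) _ = _
        refine (congrArg (fun x => Expr.bind x _) this).trans ?_
        simp only [Expr.bind]
        congr 1
        funext r
        rw [← (ih r.1 r.2).2 j hj (by omega)]
        congr 1
        -- Below the top, the restrictions to `[β|]` and `[β|]_t` have the same arguments, so the
        -- second induction hypothesis applies.
        have := argE_incl (s := (Set.range (β.restrict (j + 1) (hj.trans hm)).toFun)ᶜ) le_rfl
          (fun _ _ => .inl) (restrictTm hm hM hS g (j + 1) hj hs) r.1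
          (by rw [IncList.restrict_top]; omega) fun i hi => (mem_shapeTm_iff _
            (by rw [IncList.restrict_top]; omega)).1
        refine this.symm.trans (congrArg (fun f => argE f _) ?_)
        exact shape_hom_ext (fun _ _ => rfl) (fun _ _ => rfl)
      -- Both sides are variables. Their numbers agree because the places missed by `β` are all
      -- filled.
      · rw [argE_of_notMem _ hs, argE_of_notMem _ fun h => hs (hiff.1 h),
          β.gapCount_eq (fun i hi => hS i hi.le) j (by omega) q e (by omega)]
        rfl
    refine ⟨h1, fun i hi hlt => ?_⟩
    have hq : q + 1 ≤ (β.restrict (i + 1) (hi.trans hm)).top := hlt.le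
    by_cases hr : q + 1 ∈ Set.range β.toFun
    · obtain ⟨p, hp⟩ := hr
      have hpi := β.strictMono.lt_iff_lt.1 (hp.trans_lt hlt)
      obtain ⟨p, hpM⟩ := p
      cases p with
      | zero => exact absurd (β.map_zero.symm.trans hp) (by omega)
      | succ j =>
        have hji : j < i := by simpa [Fin.lt_def] using hpi
        have hnot : q + 1 ∉ (Set.range (β.restrict (i + 1) (hi.trans hm)).toFun)ᶜ :=
          fun h => h ((β.mem_range_restrict _ _ hq).2 ⟨_, hp⟩)
        -- The place is the value `β(j + 1)`, so exactly `j` unfilled places precede it and its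
        -- variable in the inner normal form has index `j`.
        rw [argE_of_notMem _ hnot,
          (β.restrict (i + 1) (hi.trans hm)).gapCount_eq (s := ∅) (M := β.toFun ⟨i + 1, by omega⟩)
            (S := (Set.range (β.restrict (i + 1) (hi.trans hm)).toFun)ᶜ)
            (fun r _ => ⟨fun h p hp => h ⟨p, hp⟩, fun h ⟨p, hp⟩ => h p hp⟩) j (by omega) q hp
            (by omega), gapCount_empty]
        simp only [Expr.bind, hji, if_true]
        exact h1 j (by omega) hp
    · have hr' : q + 1 ∈ (Set.range (β.restrict (i + 1) (hi.trans hm)).toFun)ᶜ :=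
        fun h => hr ((β.mem_range_restrict _ _ hq).1 h)
      rw [argE_of_mem _ ⟨hq, hr'⟩,
        argE_of_mem g ⟨hq.trans (top_restrict_le hm hM hi), mem_filled_of_restrict hm hM hS hi _ hq hr'⟩]
      simp only [Expr.bind, tmAt_incl]
      congr 1
      funext r
      exact (ih r.1 r.2).2 i hi (by omega)

include hty htm in
theorem tyE_unfold (i : ℕ) (hi : i + 1 ≤ m) (q : ℕ) (hq : q + 1 ≤ M')
    (e : β.toFun ⟨i + 1, by omega⟩ = q + 1) :
    (tyE (unfold β hm hM hS g) i hi).tr a.letter d = tyE g q hq := by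
  have htop : (β.restrict (i + 1) (hi.trans hm)).top - 1 = q := by
    rw [IncList.restrict_top, e, Nat.add_sub_cancel]
  have := hty i (β.restrict (i + 1) (hi.trans hm)) (restrictTy hm hM hS g (i + 1) hi)
  simp only [htop] at this
  change Expr.bind (a.ty i _) _ = _
  refine (congrArg (fun x => Expr.bind x _) this).trans ?_
  simp only [tyE, Expr.bind, tyAt_incl]
  congr 1
  funext r
  exact (argE_unfold β hm hM hS a htm d g r.1).2 i hi (by omega)

end Unfold

/-! ### Every map is of this form -/

section Fold

variable {X : TTS.{u}}

theorem filled_empty {M : ℕ} (β : IncList M) (M' : ℕ) : Filled β ∅ (Set.range β.toFun)ᶜ M' :=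
  fun _ _ => ⟨fun h p hp => h ⟨p, hp⟩, fun h ⟨p, hp⟩ => h p hp⟩

/-- The lower type-elements are iterated boundaries of the top one, and each boundary drops the last
value of the inc-list. The induction is on the distance from the top. -/
theorem tyAt_eq_restrict {n : ℕ} {s : Set ℕ} (ℓ : shape (n + 1) s ⟶ incObj X)
    (β : IncList (n + 1)) (h : β.dom ⟶ X)
    (hℓ : tyAt ℓ n le_rfl = (⟨β, h⟩ : Σ β : IncList (n + 1), (β.shape ⟶ X)))
    (i : ℕ) (hi : i + 1 ≤ n + 1) :
    tyAt ℓ i hi = (⟨β.restrict (i + 1) hi,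
      restrictTy le_rfl le_rfl (filled_empty β _) h (i + 1) hi⟩ :
      Σ β : IncList (i + 1), (β.shape ⟶ X)) := by
  obtain ⟨d, e⟩ := Nat.exists_eq_add_of_le (Nat.le_of_succ_le_succ hi)
  induction d generalizing i with
  | zero =>
    obtain rfl : n = i := e
    exact hℓ.trans (congrArg (Sigma.mk β) (shape_hom_ext (fun _ _ => rfl) (fun _ _ => rfl)))
  | succ d ih =>
    rw [← bd_tyAt ℓ i (by omega), ih (i + 1) (by omega) (by omega)]
    exact congrArg (Sigma.mk (β.restrict (i + 1) hi))
      (shape_hom_ext (fun _ _ => rfl) (fun _ _ => rfl))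

end Fold


section Fold

variable {X : TTS.{u}}

/-- The type-elements and term-elements of `incObj X`, in terms of the structures `[α]`. -/
abbrev incTyElem {k : ℕ} (α : IncList (k + 1)) (h : α.dom ⟶ X) : (incObj X).Ty k :=
  (⟨α, h⟩ : Σ α : IncList (k + 1), (α.shape ⟶ X))

/-- The term-elements of `incObj X`, in terms of the structures `[α]_t`. -/
abbrev incTmElem {k : ℕ} (α : IncList (k + 1)) (h : α.domTm ⟶ X) : (incObj X).Tm k :=
  (⟨α, h⟩ : Σ α : IncList (k + 1), (α.shapeTm ⟶ X))

theorem incTyElem_inj {k : ℕ} {α : IncList (k + 1)} {h h' : α.dom ⟶ X}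
    (e : incTyElem α h = incTyElem α h') : h = h' :=
  eq_of_heq (Sigma.mk.inj_iff.1 e).2

theorem incTmElem_inj {k : ℕ} {α : IncList (k + 1)} {h h' : α.domTm ⟶ X}
    (e : incTmElem α h = incTmElem α h') : h = h' :=
  eq_of_heq (Sigma.mk.inj_iff.1 e).2

/-- The boundary keeps the inc-list, so a term-element over `(α, h)` is an extension of `h` to
`[α]_t`. -/
theorem exists_of_bdTm_eq {k : ℕ} {t : (incObj X).Tm k} {α : IncList (k + 1)} {h : α.dom ⟶ X}
    (e : (incObj X).bdTm k t = incTyElem α h) : ∃ b : α.domTm ⟶ X, t = incTmElem α b ∧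
      (∀ i hi, tyAt b i hi = tyAt h i hi) ∧
      ∀ i hi, tmAt b i ⟨hi.1, .inl hi.2⟩ = tmAt h i hi := by
  obtain ⟨δ, b⟩ := t
  obtain ⟨rfl, e⟩ := Sigma.mk.inj_iff.1 e
  obtain rfl := eq_of_heq e
  exact ⟨b, rfl, fun _ _ => rfl, fun _ _ => rfl⟩

/-- The map `g` is the union `h ∪ k`. Its type-elements are those of `h`; at a place that is a value
`β(j + 1)` its term-element is the one adjoined in the value of `ℓ` at degree `j + 1`; at the other
filled places it is that of `h`. -/
theorem exists_unfold {m n M' : ℕ} {s S : Set ℕ} (ℓ : shape m s ⟶ incObj X) (e : m = n + 1)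
    (β : IncList (n + 1)) (h : β.dom ⟶ X) (hℓ : tyAt ℓ n e.ge = incTyElem β h)
    (hM : β.toFun ⟨m, by omega⟩ ≤ M') (hM' : M' = β.top) (hS : Filled β s S M') :
    ∃ g : shape M' S ⟶ X, ℓ = unfold β e.le hM hS g := by
  subst e hM'
  have hty := tyAt_eq_restrict ℓ β h hℓ
  have (j : ℕ) (hj : j + 1 ≤ n + 1 ∧ j + 1 ∈ s) :=
    exists_of_bdTm_eq ((bdTm_tmAt ℓ j hj).trans (hty j hj.1))
  choose b hb hbty hbtm using this
  -- The value is characterised relative to both sources at once. They do not conflict, since `h`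
  -- has no term-element at a value of `β`, and `j` is unique because `β` is injective.
  have (r : ℕ) (hr : r + 1 ≤ β.top ∧ r + 1 ∈ S) : ∃ t : X.Tm r, X.bdTm r t = tyAt h r hr.1 ∧
      (∀ hr', t = tmAt h r hr') ∧
      ∀ j hj, β.toFun ⟨j + 1, Nat.lt_succ_of_le hj.1⟩ = r + 1 → ∀ hr', t = tmAt (b j hj) r hr' := by
    by_cases hrβ : r + 1 ∈ Set.range β.toFun
    · obtain ⟨⟨p, hpn⟩, hp⟩ := hrβ
      cases p with
      | zero => exact absurd (β.map_zero.symm.trans hp) (by omega)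
      | succ j =>
        have hjs := (hS _ hr.1).1 hr.2 _ hp
        have hj : j + 1 ≤ n + 1 ∧ j + 1 ∈ s := ⟨Nat.le_of_lt_succ hpn, hjs⟩
        refine ⟨tmAt (b j hj) r ⟨hp.ge, .inr hp.symm⟩, ?_, fun hr' => absurd ⟨_, hp⟩ hr'.2, ?_⟩
        · rw [bdTm_tmAt, hbty]
          rfl
        · intro j' hj' hp' _
          have := β.strictMono.injective (hp.trans hp'.symm)
          obtain rfl : j = j' := by simpa using this
          rfl
    · exact ⟨tmAt h r ⟨hr.1, hrβ⟩, bdTm_tmAt .., fun _ => rfl, fun j _ hp => absurd ⟨_, hp⟩ hrβ⟩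
  choose t ht ht' ht'' using this
  refine ⟨shapeHom (fun i hi => tyAt h i hi) t (fun _ _ => bd_tyAt ..) ht, ?_⟩
  refine shape_hom_ext (fun i hi => ?_) (fun i hi => ?_)
  · rw [hty]
    exact congrArg (incTyElem (β.restrict (i + 1) hi))
      (shape_hom_ext (fun _ _ => rfl) (fun j hj => (ht' j _ _).symm))
  · rw [hb]
    refine congrArg (incTmElem (β.restrict (i + 1) hi.1)) (shape_hom_ext (fun j hj => ?_)
      (fun j hj => ?_))
    · rw [hbty]
      rfl
    · by_cases hjr : j + 1 ∈ (Set.range (β.restrict (i + 1) hi.1).toFun)ᶜ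
      · rw [hbtm i hi j ⟨hj.1, hjr⟩]
        exact (ht' j _ _).symm
      · exact (ht'' j _ i hi (hj.2.resolve_left hjr).symm _).symm

end Fold

/-! ### Composites of inc-lists -/

section Comp

variable {k M : ℕ} (α : IncList k) (β : IncList M) (hm : α.top = M)

theorem filled_comp (M' : ℕ) :
    Filled β (Set.range α.toFun)ᶜ (Set.range (α.comp β hm).toFun)ᶜ M' := by
  intro i _
  constructor
  · rintro h p hp ⟨x, hx⟩
    exact h ⟨x, (congrArg β.toFun (Fin.ext hx)).trans hp⟩
  · rintro h ⟨x, hx⟩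
    exact h _ hx ⟨x, rfl⟩

/-- The adjoined place of `[βα]_t` is the image under `β` of the adjoined place of `[α]_t`. -/
theorem filled_compTm (M' : ℕ) : Filled β ((Set.range α.toFun)ᶜ ∪ {α.top})
    ((Set.range (α.comp β hm).toFun)ᶜ ∪ {(α.comp β hm).top}) M' := by
  intro i hi
  constructor
  · rintro (h | rfl) p hp
    · exact .inl ((filled_comp α β hm M' i hi).1 h p hp)
    · exact .inr (congrArg Fin.val (β.strictMono.injective hp))
  · intro h
    by_cases hr : i ∈ Set.range (α.comp β hm).toFun
    · obtain ⟨x, hx⟩ := hr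
      rcases h _ hx with h | h
      · exact absurd ⟨x, rfl⟩ h
      · exact .inr (hx.symm.trans (congrArg β.toFun (Fin.ext h)))
    · exact .inl hr

variable {X : TTS.{u}}

/-- The map from `[α]` to `incObj X` given by a map from `[βα]` to `X`. -/
abbrev unfoldTy (g : (α.comp β hm).dom ⟶ X) : α.dom ⟶ incObj X :=
  unfold β hm.le le_rfl (filled_comp α β hm _) g

/-- The map from `[α]_t` to `incObj X` given by a map from `[βα]_t` to `X`. -/
abbrev unfoldTm (g : (α.comp β hm).domTm ⟶ X) : α.domTm ⟶ incObj X :=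
  unfold β hm.le le_rfl (filled_compTm α β hm _) g

theorem comp_top : (α.comp β hm).top = β.top := by
  subst hm
  rfl

end Comp

/-! ### Unfolding and the union `h ∪ k` -/

section Union

variable {X : TTS.{u}} {k m : ℕ} {α : IncList (k + 1)} (hm : α.top = m + 1)
  {β : IncList (m + 1)}

/-- All values of an unfolding are restrictions of `g`, so `h` and the adjoined terms agree with `g`
by definition. -/
theorem isUnion_unfoldTy (h : β.dom ⟶ X) (g : (α.comp β hm).dom ⟶ X)
    (hℓ : HasTy (unfoldTy α β hm g) m (incTyElem β h)) :
    IsUnion (α := α) (unfoldTy α β hm g) h hm g := by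
  obtain ⟨hk, e⟩ := hℓ
  obtain rfl := incTyElem_inj (α := β) e
  refine ⟨fun i A hA => ?_, fun i a ha => ?_, fun j δ b p i a hb _ _ ha => ?_⟩
  · obtain ⟨_, rfl⟩ := hA
    exact ⟨_, rfl⟩
  · obtain ⟨_, rfl⟩ := ha
    exact ⟨_, rfl⟩
  · obtain ⟨hj, e⟩ := hb
    obtain ⟨rfl, e⟩ := Sigma.mk.inj_iff.1 e
    obtain rfl := eq_of_heq e
    obtain ⟨_, rfl⟩ := ha
    exact ⟨_, rfl⟩

theorem exists_unfoldTy (ℓ : α.dom ⟶ incObj X) (h : β.dom ⟶ X)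
    (hℓ : HasTy ℓ m (incTyElem β h)) :
    ∃ g : (α.comp β hm).dom ⟶ X, ℓ = unfoldTy α β hm g := by
  obtain ⟨hk, e⟩ := hℓ
  exact exists_unfold ℓ hm β h e le_rfl (comp_top α β hm) (filled_comp α β hm _)

theorem hasTm_of_unfoldTm (b : β.domTm ⟶ X) (g : (α.comp β hm).domTm ⟶ X)
    (hℓ : HasTm (unfoldTm α β hm g) m (incTmElem β b)) (i : ℕ) (a : X.Tm i) (ha : HasTm b i a) :
    HasTm g i a := by
  obtain ⟨hk, e⟩ := hℓ
  obtain rfl := incTmElem_inj (α := β) e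
  obtain ⟨_, rfl⟩ := ha
  exact ⟨_, rfl⟩

theorem exists_unfoldTm (ℓ : α.domTm ⟶ incObj X) (h : β.dom ⟶ X)
    (hℓ : HasTy ℓ m (incTyElem β h)) :
    ∃ g : (α.comp β hm).domTm ⟶ X, ℓ = unfoldTm α β hm g := by
  obtain ⟨hk, e⟩ := hℓ
  exact exists_unfold ℓ hm β h e le_rfl (comp_top α β hm) (filled_compTm α β hm _)

theorem HasTm.hasTy {Y : TTS.{u}} {m : ℕ} {s : Set ℕ} {h : shape m s ⟶ Y} {k : ℕ} {a : Y.Tm k}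
    (ha : HasTm h k a) : HasTy h k (Y.bdTm k a) := by
  obtain ⟨hk, rfl⟩ := ha
  exact ⟨hk.1, (bdTm_tmAt h k hk).symm⟩

end Union

/-! ### Translation of normal forms along morphisms of free theories -/

section Expression

variable {X Y : TTS.{u}}

/-- Congruence in a free theory is equality, so the class determines the assigned expression. -/
theorem Assign.ty_eq (a : Assign X (freeGAT Y)) {k : ℕ} {A : X.Ty k} {J : (freeGAT Y).TyJudgement k}
    (e : TTS.onTy a.toHom k A = (Quot.mk _ J : (freeGAT Y).VTy k)) :
    J.1.1.asn = .ty (a.ty k A) :=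
  (congrArg Judgement.asn (eq_of_eqv (GAT.TyJudgement.eqv_of_mk_eq e))).symm

theorem Assign.tm_eq (a : Assign X (freeGAT Y)) {k : ℕ} {A : X.Tm k} {J : (freeGAT Y).TmJudgement k}
    (e : TTS.onTm a.toHom k A = (Quot.mk _ J : (freeGAT Y).VTm k)) :
    J.1.1.asn = .tm (a.tm k A) (a.ty k (X.bdTm k A)) :=
  (congrArg Judgement.asn (eq_of_eqv (GAT.TmJudgement.eqv_of_mk_eq e))).symm

/-- The translated judgement is again a normal form by `exists_incTy`, and `incTy_inj` identifies it
by its type alone. Hence contexts never have to be translated explicitly. -/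
theorem incHom_map_ty (a : Assign X (freeGAT Y)) {k : ℕ} {α α' : IncList (k + 1)} (h : α.dom ⟶ X)
    (h' : α'.dom ⟶ Y)
    (e : (tyE h (α.top - 1) α.sub_one_add_one.le).tr a.letter (closedExpr (freeGAT Y).Alphabet) =
      tyE h' (α'.top - 1) α'.sub_one_add_one.le) :
    TTS.onTy (incHom X ≫ GAT.forget.map a.hom) k (incTyElem α h) =
      TTS.onTy (incHom Y) k (incTyElem α' h') := by
  obtain ⟨α'', h'', hJ⟩ := exists_incTy (a.interp.onTy k (incTy α h))
  have := Assertion.ty.inj (congrArg (fun J => J.1.1.asn) hJ)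
  refine (congrArg (Quot.mk _) hJ).symm.trans ?_
  exact congrArg (TTS.onTy (incHom Y) k) (incTy_inj (this.trans e))

theorem incHom_map_tm (a : Assign X (freeGAT Y)) {k : ℕ} {α α' : IncList (k + 1)} (h : α.domTm ⟶ X)
    (h' : α'.domTm ⟶ Y)
    (e : (argE h (α.top - 1)).tr a.letter (closedExpr (freeGAT Y).Alphabet) =
      argE h' (α'.top - 1)) :
    TTS.onTm (incHom X ≫ GAT.forget.map a.hom) k (incTmElem α h) =
      TTS.onTm (incHom Y) k (incTmElem α' h') := by
  obtain ⟨α'', h'', hJ⟩ := exists_incTm (a.interp.onTm k (incTm α h))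
  have := Assertion.tm.inj (congrArg (fun J => J.1.1.asn) hJ)
  refine (congrArg (Quot.mk _) hJ).symm.trans ?_
  exact congrArg (TTS.onTm (incHom Y) k) (incTm_inj (this.1.trans e))

/-! ### Naturality -/

/-- The interpretation induced by `f` replaces each letter by its image under `f` and keeps the
arguments in their places. -/
theorem argE_comp (f : X ⟶ Y) (a : Assign X (freeGAT Y)) (ha : a.toHom = f ≫ freeUnit Y)
    (d : Expr (freeGAT Y).Alphabet) {m : ℕ} {s : Set ℕ} (h : shape m s ⟶ X) (q : ℕ) :
    (argE h q).tr a.letter d = argE (h ≫ f) q := by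
  induction q using Nat.strong_induction_on with
  | _ q ih =>
    by_cases hq : q + 1 ≤ m ∧ q + 1 ∈ s
    · have : genTm Y q (TTS.onTm f q (tmAt h q hq)) = a.tm q (tmAt h q hq) :=
        (Assertion.tm.inj (a.tm_eq (congrArg (fun f => TTS.onTm f q (tmAt h q hq)) ha))).1
      rw [argE_of_mem _ hq, argE_of_mem _ hq]
      change Expr.bind (a.tm q _) _ = _
      rw [← this]
      simp only [applyVars, Expr.bind, Fin.is_lt, dif_pos, tmAt_comp]
      congr 1
      funext r
      exact ih r.1 r.2
    · rw [argE, argE, dif_neg hq, dif_neg hq]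
      rfl

theorem tyE_comp (f : X ⟶ Y) (a : Assign X (freeGAT Y)) (ha : a.toHom = f ≫ freeUnit Y)
    (d : Expr (freeGAT Y).Alphabet) {m : ℕ} {s : Set ℕ} (h : shape m s ⟶ X) (i : ℕ)
    (hi : i + 1 ≤ m) : (tyE h i hi).tr a.letter d = tyE (h ≫ f) i hi := by
  have : genTy Y i (TTS.onTy f i (tyAt h i hi)) = a.ty i (tyAt h i hi) :=
    Assertion.ty.inj (a.ty_eq (congrArg (fun f => TTS.onTy f i (tyAt h i hi)) ha))
  change Expr.bind (a.ty i _) _ = _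
  rw [← this]
  simp only [applyVars, Expr.bind, Fin.is_lt, dif_pos, tyE, tyAt_comp]
  congr 1
  funext r
  exact argE_comp f a ha d h r.1

theorem incHom_naturality (f : X ⟶ Y) (φ : freeGAT X ⟶ freeGAT Y)
    (hφ : freeUnit X ≫ GAT.forget.map φ = f ≫ freeUnit Y) :
    incHom X ≫ GAT.forget.map φ = incFunctor.map f ≫ incHom Y := by
  obtain ⟨a, ha⟩ := Assign.exists_toHom_eq (f ≫ freeUnit Y)
  obtain rfl : a.hom = φ := freeGAT_hom_ext ((a.gen_hom.trans ha).trans hφ.symm)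
  apply TTS.hom_ext
  · rintro k ⟨α, h⟩
    exact incHom_map_ty a h (h ≫ f) (tyE_comp f a ha _ h _ _)
  · rintro k ⟨α, h⟩
    exact incHom_map_tm a h (h ≫ f) (argE_comp f a ha _ h _)

/-! ### Multiplication and unit -/

/-- An assignment that represents `incHom X` must choose the normal forms themselves; this is the
hypothesis needed in `tyE_unfold`. -/
theorem Assign.ty_of_incHom (a : Assign (incObj X) (freeGAT X)) (ha : a.toHom = incHom X) (k : ℕ)
    (α : IncList (k + 1)) (h : α.dom ⟶ X) :
    a.ty k (incTyElem α h) = tyE h (α.top - 1) α.sub_one_add_one.le :=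
  (Assertion.ty.inj (a.ty_eq (J := incTy α h)
    (congrArg (fun f => TTS.onTy f k (incTyElem α h)) ha))).symm

theorem Assign.tm_of_incHom (a : Assign (incObj X) (freeGAT X)) (ha : a.toHom = incHom X) (k : ℕ)
    (α : IncList (k + 1)) (h : α.domTm ⟶ X) :
    a.tm k (incTmElem α h) = argE h (α.top - 1) :=
  (Assertion.tm.inj (a.tm_eq (J := incTm α h)
    (congrArg (fun f => TTS.onTm f k (incTmElem α h)) ha))).1.symm

/-- The morphism `φ` extends `incHom X`, so it is the multiplication in terms of free theories. By
uniqueness it is the translation of letters by normal forms, to which `tyE_unfold` applies. -/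
theorem incHom_unfoldTy {φ : freeGAT (incObj X) ⟶ freeGAT X}
    (hφ : freeUnit (incObj X) ≫ GAT.forget.map φ = incHom X) {k m : ℕ} (α : IncList (k + 1))
    (hm : α.top = m + 1) (β : IncList (m + 1)) (g : (α.comp β hm).dom ⟶ X) :
    TTS.onTy (incHom (incObj X) ≫ GAT.forget.map φ) k (incTyElem α (unfoldTy α β hm g)) =
      TTS.onTy (incHom X) k (incTyElem (α.comp β hm) g) := by
  obtain ⟨a, ha⟩ := Assign.exists_toHom_eq (incHom X)
  obtain rfl : a.hom = φ := freeGAT_hom_ext ((a.gen_hom.trans ha).trans hφ.symm)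
  refine incHom_map_ty a _ _ ?_
  refine tyE_unfold β _ _ _ a (a.ty_of_incHom ha) (a.tm_of_incHom ha) _ g _ _ _ _ ?_
  -- The top value of `βα` is `β(α(k + 1))`.
  exact (congrArg β.toFun (Fin.ext α.sub_one_add_one : (⟨α.top - 1 + 1, _⟩ : Fin (m + 1 + 1)) =
    ⟨α.top, by omega⟩)).trans (α.comp β hm).sub_one_add_one.symm

theorem incHom_unfoldTm {φ : freeGAT (incObj X) ⟶ freeGAT X}
    (hφ : freeUnit (incObj X) ≫ GAT.forget.map φ = incHom X) {k m : ℕ} (α : IncList (k + 1))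
    (hm : α.top = m + 1) (β : IncList (m + 1)) (g : (α.comp β hm).domTm ⟶ X) :
    TTS.onTm (incHom (incObj X) ≫ GAT.forget.map φ) k (incTmElem α (unfoldTm α β hm g)) =
      TTS.onTm (incHom X) k (incTmElem (α.comp β hm) g) := by
  obtain ⟨a, ha⟩ := Assign.exists_toHom_eq (incHom X)
  obtain rfl : a.hom = φ := freeGAT_hom_ext ((a.gen_hom.trans ha).trans hφ.symm)
  refine incHom_map_tm a _ _ ?_
  refine (argE_unfold β _ _ _ a (a.tm_of_incHom ha) _ g _).1 _ α.sub_one_add_one.le ?_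
  exact (congrArg β.toFun (Fin.ext α.sub_one_add_one : (⟨α.top - 1 + 1, _⟩ : Fin (m + 1 + 1)) =
    ⟨α.top, by omega⟩)).trans (α.comp β hm).sub_one_add_one.symm

theorem notMem_iota_compl {n r : ℕ} (hr : r + 1 ≤ n) :
    r + 1 ∉ (Set.range (IncList.iota n).toFun)ᶜ :=
  fun h => h ⟨⟨r + 1, Nat.lt_succ_of_le hr⟩, rfl⟩

/-- Every place below `k + 1` is a value of `ι`, so nothing is filled and the normal form is the
generator. -/
theorem incHom_iotaTy (k : ℕ) (A : X.Ty k) : ∃ h : (IncList.iota (k + 1)).dom ⟶ X,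
    HasTy h k A ∧ TTS.onTy (incHom X) k (incTyElem _ h) = TTS.onTy (freeUnit X) k A := by
  obtain ⟨h, hh⟩ := exists_shape_hom k A
  let h' : (IncList.iota (k + 1)).dom ⟶ X :=
    shapeIncl le_rfl (fun i hi his => his ⟨⟨i, Nat.lt_succ_of_le hi⟩, rfl⟩) ≫ h
  refine ⟨h', ⟨le_rfl, hh⟩, congrArg (Quot.mk _) (Subtype.ext (Subtype.ext ?_))⟩
  change Judgement.mk (ctxE h' k) (.ty (tyE h' k le_rfl)) = Judgement.mk _ _
  rw [ctxE_of_forall_notMem h' k le_rfl fun r hr => notMem_iota_compl (by omega),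
    tyE_of_forall_notMem h' k le_rfl fun r hr => notMem_iota_compl (by omega)]
  rw [show tyAt h' k le_rfl = A from hh]
  rfl

theorem incHom_iotaTm (k : ℕ) (a : X.Tm k) : ∃ h : (IncList.iota (k + 1)).domTm ⟶ X,
    HasTm h k a ∧ TTS.onTm (incHom X) k (incTmElem _ h) = TTS.onTm (freeUnit X) k a := by
  obtain ⟨h, hh⟩ := exists_shape_hom k (X.bdTm k a)
  obtain ⟨h₁, hh₁, hh₂⟩ := exists_extend_tm h k le_rfl (Set.notMem_empty _) a hh.symm
  let h' : (IncList.iota (k + 1)).domTm ⟶ X :=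
    shapeIncl le_rfl (fun i hi his => .inl (his.resolve_left fun h =>
      h ⟨⟨i, Nat.lt_succ_of_le hi⟩, rfl⟩)) ≫ h₁
  have hmem : k + 1 ≤ k + 1 ∧ k + 1 ∈ (Set.range (IncList.iota (k + 1)).toFun)ᶜ ∪
    {(IncList.iota (k + 1)).top} := ⟨le_rfl, .inr rfl⟩
  have hnot (r : ℕ) (hr : r < k) : r + 1 ∉ (Set.range (IncList.iota (k + 1)).toFun)ᶜ ∪
      {(IncList.iota (k + 1)).top} := by
    rintro (h | h)
    · exact notMem_iota_compl (by omega) h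
    · exact hr.ne (Nat.succ_injective h)
  have h1 : tmAt h' k hmem = a := hh₁
  have h2 : tyAt h' k le_rfl = X.bdTm k a := by rw [← bdTm_tmAt h' k hmem, h1]
  refine ⟨h', ⟨hmem, hh₁⟩, congrArg (Quot.mk _) (Subtype.ext (Subtype.ext ?_))⟩
  change Judgement.mk (ctxE h' k) (.tm (argE h' k) (tyE h' k le_rfl)) = Judgement.mk _ _
  rw [ctxE_of_forall_notMem h' k le_rfl hnot, tyE_of_forall_notMem h' k le_rfl hnot,
    argE_of_forall_notMem h' k hmem hnot, h1, h2]
  rfl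

end Expression


/-! ## Sums of representable functors -/

/-- A functor that is in each degree a sum of representable functors. -/
structure Familial (F : TTS.{u} ⥤ TTS.{u}) where
  ix : H → Type
  shape : ∀ v, ix v → TTS.{u}
  equiv : ∀ v Z, (F.obj Z).obj (op v) ≃ Σ i : ix v, (shape v i ⟶ Z)
  equiv_map : ∀ v {Z Z' : TTS.{u}} (f : Z ⟶ Z') (x : (F.obj Z).obj (op v)),
    equiv v Z' ((F.map f).app (op v) x) = ⟨(equiv v Z x).1, (equiv v Z x).2 ≫ f⟩

namespace Familial

variable {F F' : TTS.{u} ⥤ TTS.{u}}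

/-- Transport along an isomorphism of functors. -/
def ofIso (a : Familial F) (e : F' ≅ F) : Familial F' where
  ix := a.ix
  shape := a.shape
  equiv v Z := (((e.app Z).app (op v)).toEquiv).trans (a.equiv v Z)
  equiv_map v {Z Z'} f x := by
    refine Eq.trans (congrArg (a.equiv v Z') ?_) (a.equiv_map v f _)
    exact congrArg (fun g => g.app (op v) x) (e.hom.naturality f)

/-- Representables preserve pullbacks, and maps preserve the index of a summand, so two elements
with a common image lie in the same summand. Pullbacks of presheaves are checked degreewise. -/
theorem preservesPullbacks (a : Familial F) :
    Limits.PreservesLimitsOfShape Limits.WalkingCospan F := by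
  have hF {P X Y Z : TTS.{u}} {t : P ⟶ X} {l : P ⟶ Y} {r : X ⟶ Z} {b : Y ⟶ Z}
      (h : IsPullback t l r b) : IsPullback (F.map t) (F.map l) (F.map r) (F.map b) := by
    refine IsPullback.of_forall_isPullback_app fun ⟨v⟩ => ?_
    rw [Limits.Types.isPullback_iff]
    refine ⟨?_, fun x y hxy => ?_, fun x y hxy => ?_⟩
    · rw [← NatTrans.comp_app, ← NatTrans.comp_app, ← F.map_comp, ← F.map_comp, h.w]
    · have h1 := congrArg (a.equiv v X) hxy.1
      have h2 := congrArg (a.equiv v Y) hxy.2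
      rw [a.equiv_map, a.equiv_map] at h1 h2
      apply (a.equiv v P).injective
      generalize a.equiv v P x = x' at h1 h2
      generalize a.equiv v P y = y' at h1 h2
      obtain ⟨i, x'⟩ := x'
      obtain ⟨j, y'⟩ := y'
      obtain ⟨e, h1⟩ := Sigma.mk.inj_iff.1 h1
      dsimp only at e
      subst e
      exact congrArg (Sigma.mk i) (h.hom_ext (eq_of_heq h1)
        (eq_of_heq (Sigma.mk.inj_iff.1 h2).2))
    · have h1 := congrArg (a.equiv v Z) hxy
      rw [a.equiv_map, a.equiv_map] at h1
      obtain ⟨⟨i, x⟩, rfl⟩ := (a.equiv v X).symm.surjective x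
      obtain ⟨⟨j, y⟩, rfl⟩ := (a.equiv v Y).symm.surjective y
      rw [Equiv.apply_symm_apply, Equiv.apply_symm_apply] at h1
      obtain ⟨e, h1⟩ := Sigma.mk.inj_iff.1 h1
      dsimp only at e
      subst e
      refine ⟨(a.equiv v P).symm ⟨i, h.lift x y (eq_of_heq h1)⟩, ?_, ?_⟩
      · rw [Equiv.eq_symm_apply, a.equiv_map, Equiv.apply_symm_apply, h.lift_fst]
      · rw [Equiv.eq_symm_apply, a.equiv_map, Equiv.apply_symm_apply, h.lift_snd]
  -- An arbitrary diagram is isomorphic to a cospan, and limit cones over a cospan are pullback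
  -- squares.
  refine ⟨fun {K} => ?_⟩
  suffices Limits.PreservesLimit (Limits.cospan (K.map Limits.WalkingCospan.Hom.inl)
      (K.map Limits.WalkingCospan.Hom.inr)) F from
    Limits.preservesLimit_of_iso_diagram F (Limits.diagramIsoCospan K).symm
  refine ⟨fun {c} hc => ⟨?_⟩⟩
  exact (Limits.PullbackCone.isLimitMapConeEquiv c F).symm (hF (IsPullback.of_isLimit hc)).isLimit

/-- By Yoneda, `q` is an element `(i, h)` of `F X`. A map over `F X` from the representable to the
image of an object over `X` is an element `(i, k)` lying over `(i, h)`, that is, a map `k` over `X`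
out of `h`. So `Over.mk h` is the value of the left adjoint. -/
theorem corepresentableBy (a : Familial F) {X : TTS.{u}} (v : H)
    (q : uliftYoneda.{u}.obj v ⟶ F.obj X) :
    (Over.post (X := X) F).leftAdjointObjIsDefined (Over.mk q) := by
  obtain ⟨x, rfl⟩ := uliftYonedaEquiv.symm.surjective q
  obtain ⟨⟨i, h⟩, rfl⟩ := (a.equiv v X).symm.surjective x
  have key (Z : TTS.{u}) (k : a.shape v i ⟶ Z) (f : Z ⟶ X) :
      (F.map f).app (op v) ((a.equiv v Z).symm ⟨i, k⟩) = (a.equiv v X).symm ⟨i, k ≫ f⟩ := by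
    rw [Equiv.eq_symm_apply, a.equiv_map, Equiv.apply_symm_apply]
  refine Functor.CorepresentableBy.isCorepresentable (X := Over.mk h)
    { homEquiv := fun {A} => Equiv.ofBijective
        (fun w => Over.homMk (uliftYonedaEquiv.symm ((a.equiv v A.left).symm ⟨i, w.left⟩)) ?_) ?_
      homEquiv_comp := ?_ }
  · refine (uliftYonedaEquiv_symm_comp _ _).trans (congrArg _ ?_)
    refine (key _ _ _).trans ?_
    rw [Over.w w]
    rfl
  · constructor
    · intro w w' e
      have e := uliftYonedaEquiv.symm.injective (congrArg CommaMorphism.left e)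
      have e := Sigma.mk.inj_iff.1 ((a.equiv v A.left).symm.injective e)
      exact Over.OverMorphism.ext (eq_of_heq e.2)
    · intro w
      obtain ⟨x, hx⟩ := uliftYonedaEquiv.symm.surjective w.left
      obtain ⟨⟨j, k⟩, rfl⟩ := (a.equiv v A.left).symm.surjective x
      have hw := Over.w w
      rw [← hx] at hw
      have hw := uliftYonedaEquiv.symm.injective ((uliftYonedaEquiv_symm_comp _ _).symm.trans hw)
      have hw := congrArg (a.equiv v X) hw
      erw [a.equiv_map, Equiv.apply_symm_apply, Equiv.apply_symm_apply] at hw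
      obtain ⟨e, hw⟩ := Sigma.mk.inj_iff.1 hw
      dsimp only at e
      subst e
      exact ⟨Over.homMk k (eq_of_heq hw), Over.OverMorphism.ext hx⟩
  · intro A A' g w
    apply Over.OverMorphism.ext
    refine Eq.trans (congrArg uliftYonedaEquiv.symm ?_) (uliftYonedaEquiv_symm_comp _ _).symm
    change _ = (F.map g.left).app _ _
    rw [Equiv.symm_apply_eq]
    refine Eq.symm ((a.equiv_map _ _ _).trans ?_)
    rw [Equiv.apply_symm_apply]
    rfl

/-- Every object of the slice is a colimit of representables over the base, and the objects at which
a left adjoint is defined are closed under colimits. -/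
theorem isLocalRightAdjoint (a : Familial F) : IsLocalRightAdjoint F := by
  intro X
  apply Functor.isRightAdjoint_of_leftAdjointObjIsDefined_eq_top
  ext Y
  simp only [Pi.top_apply, Prop.top_eq_true, iff_true]
  exact Functor.leftAdjointObjIsDefined_of_isColimit
    (Over.isColimitLiftCocone _ Y.hom (Presheaf.colimitOfRepresentable.{u} Y.left))
    fun j => a.corepresentableBy _ _

end Familial

/-- The functor `incFunctor` is a sum of representable functors in each degree. -/
def familialInc : Familial incFunctor.{u} where
  ix
    | .ty k => IncList (k + 1)
    | .tm k => IncList (k + 1)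
  shape
    | .ty _ => fun α => α.shape
    | .tm _ => fun α => α.shapeTm
  equiv
    | .ty _ => fun _ => Equiv.refl _
    | .tm _ => fun _ => Equiv.refl _
  equiv_map
    | .ty _ => fun _ _ => rfl
    | .tm _ => fun _ _ => rfl


/-! ## Naturality squares -/

/-- Recognition of pullback squares of type-and-term structures. -/
theorem TTS.isPullback {P X Y Z : TTS.{u}} {t : P ⟶ X} {l : P ⟶ Y} {r : X ⟶ Z} {b : Y ⟶ Z}
    (w : t ≫ r = l ≫ b)
    (inj_ty : ∀ k (x y : P.Ty k), onTy t k x = onTy t k y → onTy l k x = onTy l k y → x = y)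
    (inj_tm : ∀ k (x y : P.Tm k), onTm t k x = onTm t k y → onTm l k x = onTm l k y → x = y)
    (surj_ty : ∀ k (x : X.Ty k) (y : Y.Ty k), onTy r k x = onTy b k y →
      ∃ p, onTy t k p = x ∧ onTy l k p = y)
    (surj_tm : ∀ k (x : X.Tm k) (y : Y.Tm k), onTm r k x = onTm b k y →
      ∃ p, onTm t k p = x ∧ onTm l k p = y) : IsPullback t l r b := by
  refine IsPullback.of_forall_isPullback_app fun ⟨v⟩ => ?_
  rw [Limits.Types.isPullback_iff]
  refine ⟨congrArg (fun f => f.app (op v)) w, ?_⟩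
  cases v with
  | ty k => exact ⟨fun x y h => inj_ty k x y h.1 h.2, surj_ty k⟩
  | tm k => exact ⟨fun x y h => inj_tm k x y h.1 h.2, surj_tm k⟩

section Unit

variable {X Y : TTS.{u}}

/-- `[ι]` has no term-elements, so a map out of it is determined by its top value. -/
theorem incTy_eq_of_hasTy {k : ℕ} {A : X.Ty k} {h h' : (IncList.iota (k + 1)).dom ⟶ X}
    (hh : HasTy h k A) (hh' : HasTy h' k A) : h = h' := by
  obtain ⟨_, e⟩ := hh
  obtain ⟨_, e'⟩ := hh'
  refine shape_hom_ext_top k rfl (e.trans e'.symm) fun i hi => ?_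
  exact absurd hi.2 (notMem_iota_compl hi.1)

theorem incTm_eq_of_hasTm {k : ℕ} {a : X.Tm k} {h h' : (IncList.iota (k + 1)).domTm ⟶ X}
    (hh : HasTm h k a) (hh' : HasTm h' k a) : h = h' := by
  obtain ⟨hk, e⟩ := hh
  obtain ⟨_, e'⟩ := hh'
  have e : tmAt h k hk = tmAt h' k hk := e.trans e'.symm
  refine shape_hom_ext_top k rfl ?_ fun i hi => ?_
  · rw [← bdTm_tmAt h k hk, e, bdTm_tmAt]
  · rcases hi.2 with hi' | hi'
    · exact absurd hi' (notMem_iota_compl hi.1)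
    · obtain rfl : i = k := Nat.succ_injective hi'
      exact e

/-- The unit is injective, since `A` is the top value of its image. A map of `X` does not change the
inc-list, so an element lying over a value of the unit has inc-list `ι` and is itself a value of the
unit. -/
theorem equifibered_of_isIncUnit {η : 𝟭 TTS.{u} ⟶ incFunctor.{u}} (hη : IsIncUnit η) :
    NatTrans.Equifibered η := by
  intro X Y f
  refine TTS.isPullback (η.naturality f) ?_ ?_ ?_ ?_
  · intro k A A' _ e
    obtain ⟨h, ⟨_, hA⟩, e₁⟩ := hη.ty X k A
    obtain ⟨h', ⟨_, hA'⟩, e₂⟩ := hη.ty X k A'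
    obtain rfl := incTyElem_inj (e₁.symm.trans (e.trans e₂))
    exact hA.symm.trans hA'
  · intro k A A' _ e
    obtain ⟨h, ⟨_, hA⟩, e₁⟩ := hη.tm X k A
    obtain ⟨h', ⟨_, hA'⟩, e₂⟩ := hη.tm X k A'
    obtain rfl := incTmElem_inj (e₁.symm.trans (e.trans e₂))
    exact hA.symm.trans hA'
  · rintro k A ⟨α, h⟩ e
    obtain ⟨h', ⟨_, hA⟩, e'⟩ := hη.ty Y k A
    have e : incTyElem α (h ≫ f) = incTyElem _ h' := e.symm.trans e'
    obtain ⟨rfl, e⟩ := Sigma.mk.inj_iff.1 e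
    obtain rfl := eq_of_heq e
    refine ⟨tyAt h k le_rfl, hA, ?_⟩
    obtain ⟨h₁, hh₁, e₁⟩ := hη.ty X k (tyAt h k le_rfl)
    exact e₁.trans (congrArg (incTyElem _) (incTy_eq_of_hasTy hh₁ ⟨_, rfl⟩))
  · rintro k A ⟨α, h⟩ e
    obtain ⟨h', ⟨hk, hA⟩, e'⟩ := hη.tm Y k A
    have e : incTmElem α (h ≫ f) = incTmElem _ h' := e.symm.trans e'
    obtain ⟨rfl, e⟩ := Sigma.mk.inj_iff.1 e
    obtain rfl := eq_of_heq e
    refine ⟨tmAt h k hk, hA, ?_⟩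
    obtain ⟨h₁, hh₁, e₁⟩ := hη.tm X k (tmAt h k hk)
    exact e₁.trans (congrArg (incTmElem _) (incTm_eq_of_hasTm hh₁ ⟨_, rfl⟩))

end Unit

/-! ### Multiplication -/

/-- A transformation that sends the iterated normal form given by `g` to `g`. -/
structure IsUnfoldMult (μ : incFunctor.{u} ⋙ incFunctor.{u} ⟶ incFunctor.{u}) : Prop where
  ty (X : TTS.{u}) (k m : ℕ) (α : IncList (k + 1)) (hm : α.top = m + 1) (β : IncList (m + 1))
    (g : (α.comp β hm).dom ⟶ X) : TTS.onTy (μ.app X) k (incTyElem α (unfoldTy α β hm g)) =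
      incTyElem (α.comp β hm) g
  tm (X : TTS.{u}) (k m : ℕ) (α : IncList (k + 1)) (hm : α.top = m + 1) (β : IncList (m + 1))
    (g : (α.comp β hm).domTm ⟶ X) : TTS.onTm (μ.app X) k (incTmElem α (unfoldTm α β hm g)) =
      incTmElem (α.comp β hm) g

section Mult

variable {X : TTS.{u}} {k : ℕ} {α : IncList (k + 1)}

/-- Here `β` is the inc-list of the value of `ℓ` at the top type-element. -/
theorem eq_unfoldTy (ℓ : α.dom ⟶ incObj X) :
    ∃ (m : ℕ) (hm : α.top = m + 1) (β : IncList (m + 1)) (g : (α.comp β hm).dom ⟶ X),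
      ℓ = unfoldTy α β hm g := by
  have hm := α.sub_one_add_one.symm
  obtain ⟨⟨β, h⟩, e⟩ : ∃ x, tyAt ℓ _ hm.ge = x := ⟨_, rfl⟩
  obtain ⟨g, hg⟩ := exists_unfoldTy hm ℓ h ⟨_, e⟩
  exact ⟨_, hm, β, g, hg⟩

theorem eq_unfoldTm (ℓ : α.domTm ⟶ incObj X) :
    ∃ (m : ℕ) (hm : α.top = m + 1) (β : IncList (m + 1)) (g : (α.comp β hm).domTm ⟶ X),
      ℓ = unfoldTm α β hm g := by
  have hm := α.sub_one_add_one.symm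
  obtain ⟨⟨β, h⟩, e⟩ : ∃ x, tyAt ℓ _ hm.ge = x := ⟨_, rfl⟩
  obtain ⟨g, hg⟩ := exists_unfoldTm hm ℓ h ⟨_, e⟩
  exact ⟨_, hm, β, g, hg⟩

theorem unfold_comp {Y : TTS.{u}} (f : X ⟶ Y) {m M M' : ℕ} {s S : Set ℕ} (β : IncList M)
    (hm : m ≤ M) (hM : β.toFun ⟨m, by omega⟩ ≤ M') (hS : Filled β s S M') (g : shape M' S ⟶ X) :
    unfold β hm hM hS g ≫ incFunctor.map f = unfold β hm hM hS (g ≫ f) :=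
  shape_hom_ext
    (fun i _ => congrArg (incTyElem (β.restrict (i + 1) _)) (Category.assoc _ _ _))
    (fun i _ => congrArg (incTmElem (β.restrict (i + 1) _)) (Category.assoc _ _ _))

theorem unfold_inj {M M' M'' : ℕ} {s S S' : Set ℕ} {m : ℕ} (e : m = M + 1)
    {β β' : IncList (M + 1)} {hm : m ≤ M + 1} {hM : β.toFun ⟨m, by omega⟩ ≤ M'}
    {hM' : β'.toFun ⟨m, by omega⟩ ≤ M''}
    {hS : Filled β s S M'} {hS' : Filled β' s S' M''} {g : shape M' S ⟶ X} {g' : shape M'' S' ⟶ X}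
    (h : unfold β hm hM hS g = unfold β' hm hM' hS' g') : β = β' :=
  (Sigma.mk.inj_iff.1 (congrArg (fun f => tyAt f M e.ge) h)).1

/-- Elements of the twofold application are triples `(α, β, g)`, sent to `(βα, g)`, and a map of `X`
changes only `g`. So the factorisation of the inc-list can be lifted from one corner of the square
and `g` from the other, in a unique way. -/
theorem IsUnfoldMult.equifibered {μ : incFunctor.{u} ⋙ incFunctor.{u} ⟶ incFunctor.{u}}
    (hμ : IsUnfoldMult μ) : NatTrans.Equifibered μ := by
  intro X Y f
  refine TTS.isPullback (μ.naturality f) ?_ ?_ ?_ ?_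
  · rintro k ⟨α, ℓ⟩ ⟨α', ℓ'⟩ e₁ e₂
    obtain ⟨rfl, e₁⟩ := Sigma.mk.inj_iff.1 e₁
    obtain ⟨m, hm, β, g, rfl⟩ := eq_unfoldTy ℓ
    obtain ⟨m', hm', β', g', rfl⟩ := eq_unfoldTy ℓ'
    obtain rfl : m = m' := Nat.succ_injective (hm.symm.trans hm')
    obtain rfl : β = β' := unfold_inj hm
      ((unfold_comp f _ _ _ _ _).symm.trans ((eq_of_heq e₁).trans (unfold_comp f _ _ _ _ _)))
    have e₂ := ((hμ.ty X k m α hm β g).symm.trans e₂).trans (hμ.ty X k m α hm β g')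
    rw [incTyElem_inj e₂]
  · rintro k ⟨α, ℓ⟩ ⟨α', ℓ'⟩ e₁ e₂
    obtain ⟨rfl, e₁⟩ := Sigma.mk.inj_iff.1 e₁
    obtain ⟨m, hm, β, g, rfl⟩ := eq_unfoldTm ℓ
    obtain ⟨m', hm', β', g', rfl⟩ := eq_unfoldTm ℓ'
    obtain rfl : m = m' := Nat.succ_injective (hm.symm.trans hm')
    obtain rfl : β = β' := unfold_inj hm
      ((unfold_comp f _ _ _ _ _).symm.trans ((eq_of_heq e₁).trans (unfold_comp f _ _ _ _ _)))
    have e₂ := ((hμ.tm X k m α hm β g).symm.trans e₂).trans (hμ.tm X k m α hm β g')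
    rw [incTmElem_inj e₂]
  · rintro k ⟨α, ℓ⟩ ⟨γ, g⟩ e
    obtain ⟨m, hm, β, g', rfl⟩ := eq_unfoldTy ℓ
    obtain ⟨rfl, e⟩ := Sigma.mk.inj_iff.1 ((hμ.ty Y k m α hm β g').symm.trans e)
    obtain rfl := eq_of_heq e
    exact ⟨incTyElem α (unfoldTy α β hm g),
      congrArg (incTyElem α) (unfold_comp f _ _ _ _ _), hμ.ty X k m α hm β g⟩
  · rintro k ⟨α, ℓ⟩ ⟨γ, g⟩ e
    obtain ⟨m, hm, β, g', rfl⟩ := eq_unfoldTm ℓ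
    obtain ⟨rfl, e⟩ := Sigma.mk.inj_iff.1 ((hμ.tm Y k m α hm β g').symm.trans e)
    obtain rfl := eq_of_heq e
    exact ⟨incTmElem α (unfoldTm α β hm g),
      congrArg (incTmElem α) (unfold_comp f _ _ _ _ _), hμ.tm X k m α hm β g⟩

/-- Every `ℓ` is an unfolding of some `g`, and the conditions on `h ∪ k` hold for this `g`. -/
theorem IsUnfoldMult.isIncMult {μ : incFunctor.{u} ⋙ incFunctor.{u} ⟶ incFunctor.{u}}
    (hμ : IsUnfoldMult μ) : IsIncMult μ where
  ty X k α ℓ m hm β h hℓ := by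
    obtain ⟨g, rfl⟩ := exists_unfoldTy hm ℓ h hℓ
    exact ⟨g, isUnion_unfoldTy hm h g hℓ, hμ.ty X k m α hm β g⟩
  tm X k α ℓ m hm β b hℓ := by
    obtain ⟨g, rfl⟩ := exists_unfoldTm hm ℓ (shapeIncl le_rfl (fun _ _ => .inl) ≫ b) hℓ.hasTy
    exact ⟨g, fun i a _ => hasTm_of_unfoldTm hm b g hℓ i a, hμ.tm X k m α hm β g⟩

end Mult

/-! ## Arbitrary left adjoints -/

section Adjunction

variable {G : TTS.{u} ⥤ GAT.{u}} (adj : G ⊣ GAT.forget.{u})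

/-- The comparison of the free theory with the value of a left adjoint. -/
noncomputable def freeComparison (X : TTS.{u}) : freeGAT X ≅ G.obj X :=
  (freeAdj.leftAdjointUniq adj).app X

theorem freeUnit_comparison (X : TTS.{u}) :
    freeUnit X ≫ GAT.forget.map (freeComparison adj X).hom = adj.unit.app X := by
  rw [← freeAdj_unit_app]
  exact Adjunction.unit_leftAdjointUniq_hom_app freeAdj adj X

/-- The comparison at `X` of `incFunctor` with the monad of an adjunction. -/
noncomputable def incIso (X : TTS.{u}) : incFunctor.obj X ≅ GAT.forget.obj (G.obj X) :=
  show incObj X ≅ _ from asIso (incHom X) ≪≫ GAT.forget.mapIso (freeComparison adj X)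

theorem incIso_naturality {X Y : TTS.{u}} (f : X ⟶ Y) :
    incFunctor.map f ≫ (incIso adj Y).hom = (incIso adj X).hom ≫ GAT.forget.map (G.map f) := by
  have hn : adj.unit.app X ≫ GAT.forget.map (G.map f) = f ≫ adj.unit.app Y :=
    (adj.unit.naturality f).symm
  have := incHom_naturality f
    ((freeComparison adj X).hom ≫ G.map f ≫ (freeComparison adj Y).inv) (by
      rw [Functor.map_comp, ← Category.assoc, freeUnit_comparison, Functor.map_comp,
        ← Category.assoc, hn, ← freeUnit_comparison adj Y, Category.assoc, Category.assoc,
        ← Functor.map_comp, Iso.hom_inv_id, CategoryTheory.Functor.map_id, Category.comp_id])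
  refine (Category.assoc _ _ _).symm.trans
    ((congrArg (· ≫ GAT.forget.map (freeComparison adj Y).hom) this.symm).trans ?_)
  refine (Category.assoc _ _ _).trans
    ((congrArg (incHom X ≫ ·) ?_).trans (Category.assoc _ _ _).symm)
  change _ = GAT.forget.map (freeComparison adj X).hom ≫ _
  rw [← Functor.map_comp, ← Functor.map_comp, Category.assoc, Category.assoc, Iso.inv_hom_id,
    Category.comp_id]

/-- The comparison of `incFunctor` with the monad of an adjunction. -/
noncomputable def incNatIso : incFunctor.{u} ≅ adj.toMonad.toFunctor :=
  NatIso.ofComponents (incIso adj) (incIso_naturality adj)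

theorem onTy_incIso_inv {X : TTS.{u}} {k : ℕ} {x : (incFunctor.obj X).Ty k}
    {y : (GAT.forget.obj (G.obj X)).Ty k} (h : TTS.onTy (incIso adj X).hom k x = y) :
    TTS.onTy (incIso adj X).inv k y = x := by
  rw [← h]
  exact congrArg (fun f => TTS.onTy f k x) (incIso adj X).hom_inv_id

theorem onTm_incIso_inv {X : TTS.{u}} {k : ℕ} {x : (incFunctor.obj X).Tm k}
    {y : (GAT.forget.obj (G.obj X)).Tm k} (h : TTS.onTm (incIso adj X).hom k x = y) :
    TTS.onTm (incIso adj X).inv k y = x := by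
  rw [← h]
  exact congrArg (fun f => TTS.onTm f k x) (incIso adj X).hom_inv_id

theorem incNatIso_unit : IsIncUnit (adj.toMonad.η ≫ (incNatIso adj).symm.hom) where
  ty X k A := by
    obtain ⟨h, hh, e⟩ := incHom_iotaTy k A
    exact ⟨h, hh, onTy_incIso_inv adj
      ((congrArg (TTS.onTy (GAT.forget.map (freeComparison adj X).hom) k) e).trans
        (congrArg (fun f => TTS.onTy f k A) (freeUnit_comparison adj X)))⟩
  tm X k a := by
    obtain ⟨h, hh, e⟩ := incHom_iotaTm k a
    exact ⟨h, hh, onTm_incIso_inv adj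
      ((congrArg (TTS.onTm (GAT.forget.map (freeComparison adj X).hom) k) e).trans
        (congrArg (fun f => TTS.onTm f k a) (freeUnit_comparison adj X)))⟩

/-- Both sides are morphisms out of a free theory, so it suffices to compare them on the unit, where
the left side reduces to `κ` by naturality and a triangle identity. -/
theorem freeComparison_comp {X Y : TTS.{u}} (φ : freeGAT Y ⟶ freeGAT X)
    (κ : Y ⟶ GAT.forget.obj (G.obj X))
    (h : freeUnit Y ≫ GAT.forget.map φ ≫ GAT.forget.map (freeComparison adj X).hom = κ) :
    (freeComparison adj Y).hom ≫ G.map κ ≫ adj.counit.app (G.obj X) =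
      φ ≫ (freeComparison adj X).hom := by
  have hn : adj.unit.app Y ≫ GAT.forget.map (G.map κ) =
      κ ≫ adj.unit.app (GAT.forget.obj (G.obj X)) := (adj.unit.naturality κ).symm
  apply freeGAT_hom_ext
  rw [Functor.map_comp, ← Category.assoc, freeUnit_comparison, Functor.map_comp,
    ← Category.assoc, hn, Category.assoc, adj.right_triangle_components, Functor.map_comp, h,
    Category.comp_id]

/-- The multiplication of the monad is given by the counit. Along the comparison with free theories
it becomes the extension `φ` of `incHom X`, for which the value on unfoldings is known. -/
theorem exists_incNatIso_hcomp (X : TTS.{u}) : ∃ φ : freeGAT (incObj X) ⟶ freeGAT X,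
    freeUnit (incObj X) ≫ GAT.forget.map φ = incHom X ∧
    ((incNatIso adj).hom ◫ (incNatIso adj).hom).app X ≫ adj.toMonad.μ.app X =
      (incHom (incObj X) ≫ GAT.forget.map φ) ≫
        GAT.forget.map (freeComparison adj X).hom := by
  obtain ⟨φ, hφ⟩ := (freeEquiv (incObj X) (freeGAT X)).surjective (incHom X)
  change freeUnit (incObj X) ≫ GAT.forget.map φ = incHom X at hφ
  refine ⟨φ, hφ, ?_⟩
  have key := freeComparison_comp adj φ (incIso adj X).hom (by
    rw [← Category.assoc, hφ]
    rfl)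
  have hl : ((incNatIso adj).hom ◫ (incNatIso adj).hom).app X ≫ adj.toMonad.μ.app X =
      ((incHom (incObj X) ≫ GAT.forget.map (freeComparison adj (incObj X)).hom) ≫
        GAT.forget.map (G.map (incIso adj X).hom)) ≫
          GAT.forget.map (adj.counit.app (G.obj X)) := rfl
  rw [hl, Category.assoc, Category.assoc, ← Functor.map_comp, ← Functor.map_comp, key,
    Functor.map_comp, Category.assoc]

theorem incNatIso_mult : IsUnfoldMult
    (((incNatIso adj).symm.inv ◫ (incNatIso adj).symm.inv) ≫ adj.toMonad.μ ≫
      (incNatIso adj).symm.hom) where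
  ty X k m α hm β g := by
    obtain ⟨φ, hφ, e⟩ := exists_incNatIso_hcomp adj X
    refine onTy_incIso_inv adj (Eq.symm ?_)
    refine (congrArg (fun f => TTS.onTy f k _) e).trans ?_
    exact congrArg (TTS.onTy (GAT.forget.map (freeComparison adj X).hom) k)
      (incHom_unfoldTy hφ α hm β g)
  tm X k m α hm β g := by
    obtain ⟨φ, hφ, e⟩ := exists_incNatIso_hcomp adj X
    refine onTm_incIso_inv adj (Eq.symm ?_)
    refine (congrArg (fun f => TTS.onTm f k _) e).trans ?_
    exact congrArg (TTS.onTm (GAT.forget.map (freeComparison adj X).hom) k)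
      (incHom_unfoldTm hφ α hm β g)

/-- All properties are known for `incFunctor` and are transported: being a degreewise sum of
representables along the isomorphism of functors, and the pullback squares by composition with
isomorphisms, whose naturality squares are pullbacks. -/
theorem isStronglyCartesian_toMonad : IsStronglyCartesian adj.toMonad where
  cartesian :=
    { preservesPullbacks := (familialInc.ofIso (incNatIso adj).symm).preservesPullbacks
      unit := by
        have := (equifibered_of_isIncUnit (incNatIso_unit adj)).comp
          (.of_isIso (incNatIso adj).hom)
        rwa [Category.assoc, Iso.symm_hom, Iso.inv_hom_id, Category.comp_id] at this
      mult := by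
        let e := NatIso.hcomp (incNatIso adj).symm (incNatIso adj).symm
        have := ((NatTrans.Equifibered.of_isIso e.hom).comp
          (incNatIso_mult adj).equifibered).comp (.of_isIso (incNatIso adj).hom)
        rwa [Category.assoc, Category.assoc, Category.assoc, Iso.symm_hom, Iso.inv_hom_id,
          Category.comp_id, show (incNatIso adj).symm.inv ◫ (incNatIso adj).symm.inv = e.inv from
          rfl, Iso.hom_inv_id_assoc] at this }
  localRightAdjoint := (familialInc.ofIso (incNatIso adj).symm).isLocalRightAdjoint

end Adjunction

end SGAT

theorem mainTheorem6 :
    SGAT.GAT.forget.{u}.IsRightAdjoint ∧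
    ∀ (G : SGAT.TTS.{u} ⥤ SGAT.GAT.{u}) (adj : G ⊣ SGAT.GAT.forget.{u}),
      IsStronglyCartesian adj.toMonad ∧
      ∃ e : adj.toMonad.toFunctor ≅ SGAT.incFunctor.{u},
        SGAT.IsIncUnit (adj.toMonad.η ≫ e.hom) ∧
        SGAT.IsIncMult ((e.inv ◫ e.inv) ≫ adj.toMonad.μ ≫ e.hom) :=
  ⟨SGAT.freeAdj.isRightAdjoint, fun _ adj => ⟨SGAT.isStronglyCartesian_toMonad adj,
    (SGAT.incNatIso adj).symm, SGAT.incNatIso_unit adj, (SGAT.incNatIso_mult adj).isIncMult⟩⟩
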